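/- Let $\Delta\ge 3$ be an integer and let $B_1,B_2\ge 0$, $\lambda>0$ be real. For a finite multigraph $G=(V,E)$ and $\sigma:V\to\{-1,+1\}$ let $w_G(\sigma)=\lambda^{n_-(\sigma)}B_1^{m_-(\sigma)}B_2^{m_+(\sigma)}$, where $n_-(\sigma)$ is the number of vertices of spin $-1$, $m_-(\sigma)$ (resp. $m_+(\sigma)$) is the number of edges with both endpoints of spin $-1$ (resp. $+1$), and $0^0=1$. The 2-spin model is antiferromagnetic if $B_1B_2<1$. *First moment.* Let $\mathcal G(n,\Delta)$ be the distribution of the bipartite multigraph with sides $V_1,V_2$ of size $n$ that is the union of $\Delta$ independent uniformly random perfect matchings between $V_1$ and $V_2$. For $G\sim\mathcal G(n,\Delta)$ let $Z_G^{\alpha,\beta}$ be the sum of $w_G(\sigma)$ over all $\sigma$ with exactly $\alpha n$ vertices of $V_1$ and exactly $\beta n$ vertices of $V_2$ of spin $-1$. For real $(\alpha,\beta)\in[0,1]^2$, the limit $$\varphi(\alpha,\beta)=\lim_{n\to\infty}\frac1n\log \mathbb E_{\mathcal G}\big[Z_G^{\alpha,\beta}\big]\in[-\infty,\infty)$$ (with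 $\log 0=-\infty$) is understood as follows: $\alpha n,\beta n$ are replaced by integers $a_n,b_n\in\{0,\dots,n\}$ with $a_n/n\to\alpha$, $b_n/n\to\beta$ (and $a_n+b_n=n$ for all $n$ in case $B_1B_2=0$ and $\alpha+\beta=1$), and the limit is the same for all such choices. *Tree measures.* Let $\mathbb T_\Delta$ be the infinite $\Delta$-regular tree with root $\rho$. The parameters are in the uniqueness region of $\mathbb T_\Delta$ if, for the Gibbs distribution (probability proportional to $w$) on the ball of radius $h$ about $\rho$, the difference of the probabilities of $\sigma_\rho=-1$ under any two feasible (positive total weight) fixings of the spins at level $h$ tends to $0$ as $h\to\infty$, uniformly in the two fixings; otherwise they are in the non-uniqueness region. Let $\mu^*$ be the weak limit as $h\to\infty$ of the Gibbs distributions on the balls of radius $h$ (free boundary), and let $\mu^+$ (resp. $\mu^-$) be the weak limit as $\ell\to\infty$ of the Gibbs distributions on the balls of radius $2\ell$ (resp. $2\ell+1$), conditioned on all spins at level $2\ell$ (resp. $2\ell+1$) being $-1$. Put $p^*=\mu^*(\sigma_\rho=-1)$ and $p^\pm=\mu^\pm(\sigma_\rho=-1)$. **Lemma.** The limit $\varphi(\alpha,\beta)$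 exists for every $(\alpha,\beta)\in[0,1]^2$, and: 1. In the uniqueness region of $\mathbb T_\Delta$, the weak limit $\mu^*$ exists, and the set of maximizers of $\varphi$ over $[0,1]^2$ is $\{(p^*,p^*)\}$. 2. If $B_1B_2<1$, then in the non-uniqueness region of $\mathbb T_\Delta$, the weak limits $\mu^+,\mu^-$ exist, and the set of maximizers of $\varphi$ over $[0,1]^2$ is $\{(p^+,p^-),(p^-,p^+)\}$. -/

import Mathlib

open Filter Topology MeasureTheory

namespace TwoSpin

/-- Spins `-1, +1`, encoded as Booleans: `true` is the spin `-1` and `false` is the spin `+1`. -/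
abbrev Spin : Type := Bool

/-- The weight `lam ^ n₋(σ) * B₁ ^ m₋(σ) * B₂ ^ m₊(σ)` of a configuration `σ` on a finite multigraph
with vertex set `V` and edge set `E`, where the edge `e` joins `(ends e).1` and `(ends e).2`. -/
def weight {V E : Type*} [Fintype V] [Fintype E] (B₁ B₂ lam : ℝ) (ends : E → V × V)
    (σ : V → Spin) : ℝ :=
  lam ^ (Finset.univ.filter fun v => σ v = true).card
    * B₁ ^ (Finset.univ.filter fun e => σ (ends e).1 = true ∧ σ (ends e).2 = true).card
    * B₂ ^ (Finset.univ.filter fun e => σ (ends e).1 = false ∧ σ (ends e).2 = false).card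

/-! ### Random bipartite regular multigraphs -/

/-- The union of the `Δ` perfect matchings `M 0, …, M (Δ - 1)` between `V₁` and `V₂` (two copies of
`Fin n`): the `k`-th matching contributes the edges joining `i ∈ V₁` to `M k i ∈ V₂`. -/
def matchingEnds {n Δ : ℕ} (M : Fin Δ → Equiv.Perm (Fin n)) :
    Fin Δ × Fin n → (Fin n ⊕ Fin n) × (Fin n ⊕ Fin n) :=
  fun e => (Sum.inl e.2, Sum.inr (M e.1 e.2))

/-- The sum of the weights of all configurations with exactly `a` vertices of `V₁` and exactly `b`
vertices of `V₂` having spin `-1`. -/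
def restrictedZ {n Δ : ℕ} (B₁ B₂ lam : ℝ) (M : Fin Δ → Equiv.Perm (Fin n)) (a b : ℕ) : ℝ :=
  ∑ σ ∈ Finset.univ.filter (fun σ : Fin n ⊕ Fin n → Spin =>
      (Finset.univ.filter fun i => σ (Sum.inl i) = true).card = a ∧
      (Finset.univ.filter fun j => σ (Sum.inr j) = true).card = b),
    weight B₁ B₂ lam (matchingEnds M) σ

/-- The expectation of `restrictedZ` when the `Δ` perfect matchings are independent and uniform. -/
noncomputable def expectedZ (Δ : ℕ) (B₁ B₂ lam : ℝ) (n a b : ℕ) : ℝ :=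
  (∑ M : Fin Δ → Equiv.Perm (Fin n), restrictedZ B₁ B₂ lam M a b)
    / (Fintype.card (Fin Δ → Equiv.Perm (Fin n)) : ℝ)

/-- `(1 / n) * log E[Z]`, with the convention `log 0 = -∞`. -/
noncomputable def logRate (Δ : ℕ) (B₁ B₂ lam : ℝ) (n a b : ℕ) : EReal :=
  ((1 / (n : ℝ) : ℝ) : EReal) * ENNReal.log (ENNReal.ofReal (expectedZ Δ B₁ B₂ lam n a b))

/-- `L` is the limit of `(1 / n) * log E[Z^{α,β}]`. As `α n` and `β n` need not be integers, they are
replaced by integers `a n`, `b n` with `a n / n → α` and `b n / n → β`, and the limit has to be `L`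
for every such choice. In the presence of hard constraints (`B₁ * B₂ = 0`) and when `α + β = 1`,
the choice has to respect the identity `α n + β n = n`, since `Z` may vanish on one side of that
line. -/
def IsFirstMomentRate (Δ : ℕ) (B₁ B₂ lam : ℝ) (α β : ℝ) (L : EReal) : Prop :=
  ∀ a b : ℕ → ℕ, (∀ n, a n ≤ n ∧ b n ≤ n) →
    Tendsto (fun n => (a n : ℝ) / (n : ℝ)) atTop (𝓝 α) →
    Tendsto (fun n => (b n : ℝ) / (n : ℝ)) atTop (𝓝 β) →
    (B₁ * B₂ = 0 → α + β = 1 → ∀ n, a n + b n = n) →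
    Tendsto (fun n => logRate Δ B₁ B₂ lam n (a n) (b n)) atTop (𝓝 L)

/-! ### The infinite regular tree and its Gibbs measures -/

/-- The vertices of the infinite `Δ`-regular tree: words over `Fin Δ` without two equal consecutive
letters. The parent of `i :: w` is `w`, so that the root `[]` has `Δ` children and every other vertex
has `Δ - 1` children. The level of a vertex is its length. -/
abbrev TreeVertex (Δ : ℕ) : Type := {w : List (Fin Δ) // w.IsChain (· ≠ ·)}

/-- The root of the tree. -/
def root (Δ : ℕ) : TreeVertex Δ := ⟨[], List.isChain_nil⟩

/-- The parent of a vertex (the root is sent to itself). -/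
def parent {Δ : ℕ} (v : TreeVertex Δ) : TreeVertex Δ := ⟨v.1.tail, v.2.tail⟩

/-- The vertices at distance at most `h` from the root. -/
abbrev Ball (Δ h : ℕ) : Type := {v : TreeVertex Δ // v.1.length ≤ h}

noncomputable instance instFintypeBall (Δ h : ℕ) : Fintype (Ball Δ h) :=
  haveI : Finite {w : List (Fin Δ) // w.length ≤ h} := (List.finite_length_le (Fin Δ) h).to_subtype
  haveI : Finite (Ball Δ h) :=
    Finite.of_injective (fun v : Ball Δ h => (⟨v.1.1, v.2⟩ : {w : List (Fin Δ) // w.length ≤ h}))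
      fun _ _ huv => Subtype.ext (Subtype.ext (by simpa using huv))
  Fintype.ofFinite _

/-- The edges of the subtree induced on `Ball Δ h`: each vertex other than the root is joined to its
parent. -/
def ballEnds (Δ h : ℕ) : {v : Ball Δ h // v.1 ≠ root Δ} → Ball Δ h × Ball Δ h :=
  fun e => (e.1, ⟨parent e.1.1, le_trans (by simp [parent]) e.1.2⟩)

/-- Configurations on the infinite tree. -/
abbrev Config (Δ : ℕ) : Type := TreeVertex Δ → Spin

/-- Extend a configuration on a ball by the spin `+1`. (The weak limits below do not depend on how
configurations are extended.) -/
def extend {Δ h : ℕ} (σ : Ball Δ h → Spin) : Config Δ :=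
  fun v => if hv : v.1.length ≤ h then σ ⟨v, hv⟩ else false

open Classical in
/-- The total weight of the configurations in `C` on the ball of radius `h`. -/
noncomputable def ballZ {Δ h : ℕ} (B₁ B₂ lam : ℝ) (C : Set (Ball Δ h → Spin)) : ℝ :=
  ∑ σ ∈ Finset.univ.filter (fun σ => σ ∈ C), weight B₁ B₂ lam (ballEnds Δ h) σ

open Classical in
/-- The expectation of `f` under the Gibbs distribution on the ball of radius `h`, conditioned on
the event `C`. -/
noncomputable def ballExp {Δ h : ℕ} (B₁ B₂ lam : ℝ) (C : Set (Ball Δ h → Spin))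
    (f : Config Δ → ℝ) : ℝ :=
  (∑ σ ∈ Finset.univ.filter (fun σ => σ ∈ C), weight B₁ B₂ lam (ballEnds Δ h) σ * f (extend σ))
    / ballZ B₁ B₂ lam C

/-- The configurations on the ball of radius `h` that agree with `τ` on the vertices at level `h`. -/
def boundary (Δ h : ℕ) (τ : Config Δ) : Set (Ball Δ h → Spin) :=
  {σ | ∀ v : Ball Δ h, v.1.1.length = h → σ v = τ v.1}

/-- The probability that the root has spin `-1`, in the ball of radius `h` with the spins at level
`h` fixed to those of `τ`. -/
noncomputable def rootProb (Δ : ℕ) (B₁ B₂ lam : ℝ) (h : ℕ) (τ : Config Δ) : ℝ :=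
  ballExp B₁ B₂ lam (boundary Δ h τ) (fun σ => if σ (root Δ) = true then 1 else 0)

/-- The parameters lie in the uniqueness region of the infinite `Δ`-regular tree: the influence on
the root of (feasible) boundary conditions at level `h` dies off as `h → ∞`. The non-uniqueness
region is the complement. -/
def Uniqueness (Δ : ℕ) (B₁ B₂ lam : ℝ) : Prop :=
  ∀ ε : ℝ, 0 < ε → ∃ H : ℕ, ∀ h : ℕ, H ≤ h → ∀ τ τ' : Config Δ,
    0 < ballZ B₁ B₂ lam (boundary Δ h τ) → 0 < ballZ B₁ B₂ lam (boundary Δ h τ') →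
    |rootProb Δ B₁ B₂ lam h τ - rootProb Δ B₁ B₂ lam h τ'| < ε

/-- `μ` is the weak limit, as `ℓ → ∞`, of the Gibbs distributions on the balls of radius `r ℓ`
conditioned on the events `C (r ℓ)`. (The space `Config Δ` is compact, so that all continuous
functions are bounded.) -/
def IsWeakLimit {Δ : ℕ} (B₁ B₂ lam : ℝ) (r : ℕ → ℕ) (C : (h : ℕ) → Set (Ball Δ h → Spin))
    (μ : ProbabilityMeasure (Config Δ)) : Prop :=
  ∀ f : C(Config Δ, ℝ),
    Tendsto (fun ℓ => ballExp B₁ B₂ lam (C (r ℓ)) f) atTop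
      (𝓝 (∫ σ, f σ ∂(μ : Measure (Config Δ))))

/-- `μ*`: the measure with free boundary condition. -/
def IsFreeMeasure (Δ : ℕ) (B₁ B₂ lam : ℝ) (μ : ProbabilityMeasure (Config Δ)) : Prop :=
  IsWeakLimit B₁ B₂ lam (fun ℓ => ℓ) (fun _ => Set.univ) μ

/-- `μ⁺`: all spins at the even level `2ℓ` are `-1`, and `ℓ → ∞`. -/
def IsEvenMeasure (Δ : ℕ) (B₁ B₂ lam : ℝ) (μ : ProbabilityMeasure (Config Δ)) : Prop :=
  IsWeakLimit B₁ B₂ lam (fun ℓ => 2 * ℓ) (fun h => boundary Δ h fun _ => true) μ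

/-- `μ⁻`: all spins at the odd level `2ℓ + 1` are `-1`, and `ℓ → ∞`. -/
def IsOddMeasure (Δ : ℕ) (B₁ B₂ lam : ℝ) (μ : ProbabilityMeasure (Config Δ)) : Prop :=
  IsWeakLimit B₁ B₂ lam (fun ℓ => 2 * ℓ + 1) (fun h => boundary Δ h fun _ => true) μ

/-- The probability under `μ` that the root has spin `-1`. -/
noncomputable def rootMarginal {Δ : ℕ} (μ : ProbabilityMeasure (Config Δ)) : ℝ :=
  (μ : Measure (Config Δ)).real {σ | σ (root Δ) = true}

/-- The points of the square `[0,1]²` at which `φ` attains its maximum over the square. -/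
def maximizers (φ : ℝ × ℝ → EReal) : Set (ℝ × ℝ) :=
  {x | x ∈ Set.Icc (0 : ℝ) 1 ×ˢ Set.Icc (0 : ℝ) 1 ∧
    IsMaxOn φ (Set.Icc (0 : ℝ) 1 ×ˢ Set.Icc (0 : ℝ) 1) x}

end TwoSpin

/-! Averaging over the matchings turns the first moment into an explicit sum over the number of
edges of one matching with both ends of spin -1, raised to the power Δ. By Stirling's formula, φ(α,
β) is a supremum over edge distributions with marginals α and β
(`isFirstMomentRate_firstMomentRate`). Its entropies rearrange into relative entropies
(`rateFn_eq`), so that φ ≤ Δ log `edgeZ`, where `edgeZ` is a bilinear form in the amplitudes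
(λ^(1/Δ) α^w, (1-α)^w) and those of β, with w = (Δ-1)/Δ.

For fixed β, weighted AM-GM gives the form a unique maximizer, `bestResponse`. At a pair of mutual
best responses the edge distribution proportional to the four summands of `edgeZ` has marginals α
and β, hence φ = Δ log `edgeZ` there. Every maximizer of `edgeZ` is such a pair, so φ and `edgeZ`
have the same maximizers (`mem_maximizers_iff`). In the coordinate `message`, the best response
becomes the tree recursion T with Δ - 1 children (`message_treeMap`). Maximizers thus come from
fixed points p of T ∘ T, and their coordinates are the root marginals, obtained from p and T p by
the recursion with Δ children.

On the tree side, summing out the outer levels replaces a constant boundary message p by T^j p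
(`homExp_add`). This gives the weak limits and their root marginals (`exists_weakLimit`). In the
uniqueness region all orbits of T converge to one point s, the only fixed point of T ∘ T, which
leaves one maximizer.

In the antiferromagnetic non-uniqueness region T is decreasing, and the even iterates of 0 and 1
converge to a 2-cycle a < b around a fixed point s. A Rolle argument in logarithmic odds shows that
T ∘ T has no fixed points besides a, s, b and moves points of (a, s) to the left
(`two_step_fixed_points`). Alternating maximization cannot decrease `edgeZ`, so a repelling point is
not a maximizer (`exists_edgeZ_gt_of_repelling`), and only the cycle remains. -/

namespace TwoSpin

/-! ### The tree recursion on probabilities. -/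

section TreeMap

variable {B₁ B₂ lam : ℝ}

/-- The factor contributed to the spin `-1` by a neighbour whose message is `(p, 1 - p)`. -/
def minusFactor (B₁ p : ℝ) : ℝ := B₁ * p + (1 - p)

/-- The factor contributed to the spin `+1` by a neighbour whose message is `(p, 1 - p)`. -/
def plusFactor (B₂ p : ℝ) : ℝ := p + B₂ * (1 - p)

/-- The total weight at a vertex with `k` children whose messages are all `(p, 1 - p)`. -/
def treeTotal (B₁ B₂ lam : ℝ) (k : ℕ) (p : ℝ) : ℝ :=
  lam * minusFactor B₁ p ^ k + plusFactor B₂ p ^ k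

/-- The probability of the spin `-1` at a vertex with `k` children whose messages are all
`(p, 1 - p)`. -/
noncomputable def treeMap (B₁ B₂ lam : ℝ) (k : ℕ) (p : ℝ) : ℝ :=
  lam * minusFactor B₁ p ^ k / treeTotal B₁ B₂ lam k p

lemma minusFactor_nonneg (hB₁ : 0 ≤ B₁) {p : ℝ} (hp : p ∈ Set.Icc (0 : ℝ) 1) :
    0 ≤ minusFactor B₁ p := by
  have := mul_nonneg hB₁ hp.1
  have := hp.2
  unfold minusFactor; linarith

lemma plusFactor_nonneg (hB₂ : 0 ≤ B₂) {p : ℝ} (hp : p ∈ Set.Icc (0 : ℝ) 1) :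
    0 ≤ plusFactor B₂ p := by
  have := mul_nonneg hB₂ (sub_nonneg.2 hp.2)
  have := hp.1
  unfold plusFactor; linarith

/-- Even under hard constraints the factors are at least 1 - p and p, so they cannot vanish
together. This keeps the normalising total positive. -/
lemma minusFactor_pos_or_plusFactor_pos (hB₁ : 0 ≤ B₁) (hB₂ : 0 ≤ B₂) {p : ℝ}
    (hp : p ∈ Set.Icc (0 : ℝ) 1) : 0 < minusFactor B₁ p ∨ 0 < plusFactor B₂ p := by
  have h1 := mul_nonneg hB₁ hp.1
  have h2 := mul_nonneg hB₂ (sub_nonneg.2 hp.2)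
  have h3 := hp.1
  have h4 := hp.2
  unfold minusFactor plusFactor
  rcases hp.2.lt_or_eq with h | h
  · left; linarith
  · right; linarith

lemma treeTotal_pos (hB₁ : 0 ≤ B₁) (hB₂ : 0 ≤ B₂) (hlam : 0 < lam) (k : ℕ) {p : ℝ}
    (hp : p ∈ Set.Icc (0 : ℝ) 1) : 0 < treeTotal B₁ B₂ lam k p := by
  have h1 := minusFactor_nonneg hB₁ hp
  have h2 := plusFactor_nonneg hB₂ hp
  unfold treeTotal
  rcases minusFactor_pos_or_plusFactor_pos hB₁ hB₂ hp with h | h <;> positivity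

lemma one_sub_treeMap (hB₁ : 0 ≤ B₁) (hB₂ : 0 ≤ B₂) (hlam : 0 < lam) (k : ℕ) {p : ℝ}
    (hp : p ∈ Set.Icc (0 : ℝ) 1) :
    1 - treeMap B₁ B₂ lam k p = plusFactor B₂ p ^ k / treeTotal B₁ B₂ lam k p := by
  have h := treeTotal_pos hB₁ hB₂ hlam k hp
  unfold treeMap
  rw [eq_div_iff h.ne', sub_mul, div_mul_cancel₀ _ h.ne']
  unfold treeTotal; ring

lemma treeMap_mem_Icc (hB₁ : 0 ≤ B₁) (hB₂ : 0 ≤ B₂) (hlam : 0 < lam) (k : ℕ) {p : ℝ}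
    (hp : p ∈ Set.Icc (0 : ℝ) 1) : treeMap B₁ B₂ lam k p ∈ Set.Icc (0 : ℝ) 1 := by
  have h := treeTotal_pos hB₁ hB₂ hlam k hp
  have h1 := minusFactor_nonneg hB₁ hp
  have h2 := plusFactor_nonneg hB₂ hp
  refine ⟨?_, ?_⟩
  · unfold treeMap; positivity
  · rw [← sub_nonneg, one_sub_treeMap hB₁ hB₂ hlam k hp]; positivity

lemma iterate_treeMap_mem_Icc (hB₁ : 0 ≤ B₁) (hB₂ : 0 ≤ B₂) (hlam : 0 < lam) (k j : ℕ) {p : ℝ}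
    (hp : p ∈ Set.Icc (0 : ℝ) 1) : (treeMap B₁ B₂ lam k)^[j] p ∈ Set.Icc (0 : ℝ) 1 := by
  induction j with
  | zero => simpa using hp
  | succ j ih => rw [Function.iterate_succ_apply']; exact treeMap_mem_Icc hB₁ hB₂ hlam k ih

lemma continuousOn_treeMap (hB₁ : 0 ≤ B₁) (hB₂ : 0 ≤ B₂) (hlam : 0 < lam) (k : ℕ) :
    ContinuousOn (treeMap B₁ B₂ lam k) (Set.Icc 0 1) := by
  unfold treeMap
  refine ContinuousOn.div ?_ ?_ fun p hp => (treeTotal_pos hB₁ hB₂ hlam k hp).ne'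
  · unfold minusFactor; fun_prop
  · unfold treeTotal minusFactor plusFactor; fun_prop

/-- The sign of 1 - B₁B₂ decides whether the recursion decreases or increases. The cross difference
avoids a quotient whose denominator may vanish. -/
lemma minusFactor_mul_plusFactor_sub (p q : ℝ) :
    minusFactor B₁ p * plusFactor B₂ q - plusFactor B₂ p * minusFactor B₁ q
      = (1 - B₁ * B₂) * (q - p) := by
  unfold minusFactor plusFactor; ring

lemma treeMap_le_treeMap (hB₁ : 0 ≤ B₁) (hB₂ : 0 ≤ B₂) (hlam : 0 < lam) (k : ℕ) {p q : ℝ}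
    (hp : p ∈ Set.Icc (0 : ℝ) 1) (hq : q ∈ Set.Icc (0 : ℝ) 1)
    (h : 0 ≤ (1 - B₁ * B₂) * (q - p)) :
    treeMap B₁ B₂ lam k q ≤ treeMap B₁ B₂ lam k p := by
  have hcross : minusFactor B₁ q * plusFactor B₂ p ≤ minusFactor B₁ p * plusFactor B₂ q := by
    have := minusFactor_mul_plusFactor_sub (B₁ := B₁) (B₂ := B₂) p q
    linarith
  have hpow := pow_le_pow_left₀
    (mul_nonneg (minusFactor_nonneg hB₁ hq) (plusFactor_nonneg hB₂ hp)) hcross k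
  rw [mul_pow, mul_pow] at hpow
  unfold treeMap
  rw [div_le_div_iff₀ (treeTotal_pos hB₁ hB₂ hlam k hq) (treeTotal_pos hB₁ hB₂ hlam k hp)]
  unfold treeTotal
  have := mul_le_mul_of_nonneg_left hpow hlam.le
  nlinarith

lemma antitoneOn_treeMap (hB₁ : 0 ≤ B₁) (hB₂ : 0 ≤ B₂) (hlam : 0 < lam) (k : ℕ)
    (hB : B₁ * B₂ ≤ 1) : AntitoneOn (treeMap B₁ B₂ lam k) (Set.Icc 0 1) := fun _ hp _ hq hpq =>
  treeMap_le_treeMap hB₁ hB₂ hlam k hp hq (mul_nonneg (by linarith) (by linarith))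

lemma monotoneOn_treeMap (hB₁ : 0 ≤ B₁) (hB₂ : 0 ≤ B₂) (hlam : 0 < lam) (k : ℕ)
    (hB : 1 ≤ B₁ * B₂) : MonotoneOn (treeMap B₁ B₂ lam k) (Set.Icc 0 1) := fun _ hp _ hq hpq =>
  treeMap_le_treeMap hB₁ hB₂ hlam k hq hp
    (mul_nonneg_of_nonpos_of_nonpos (by linarith) (by linarith))

lemma exists_treeMap_eq_self (hB₁ : 0 ≤ B₁) (hB₂ : 0 ≤ B₂) (hlam : 0 < lam) (k : ℕ) :
    ∃ p ∈ Set.Icc (0 : ℝ) 1, treeMap B₁ B₂ lam k p = p := by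
  have h0 : (0 : ℝ) ∈ Set.Icc (0 : ℝ) 1 := by simp
  have h1 : (1 : ℝ) ∈ Set.Icc (0 : ℝ) 1 := by simp
  have hc : ContinuousOn (fun p => p - treeMap B₁ B₂ lam k p) (Set.Icc 0 1) :=
    continuousOn_id.sub (continuousOn_treeMap hB₁ hB₂ hlam k)
  have hmem : (0 : ℝ) ∈ Set.Icc (0 - treeMap B₁ B₂ lam k 0) (1 - treeMap B₁ B₂ lam k 1) :=
    ⟨sub_nonpos.2 (treeMap_mem_Icc hB₁ hB₂ hlam k h0).1,
      sub_nonneg.2 (treeMap_mem_Icc hB₁ hB₂ hlam k h1).2⟩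
  obtain ⟨p, hp, hpe⟩ := intermediate_value_Icc zero_le_one hc hmem
  exact ⟨p, hp, (sub_eq_zero.1 hpe).symm⟩

end TreeMap

/-! ### The edge partition function and alternating maximization. -/

section Norm

variable {B₁ B₂ lam : ℝ} {Δ : ℕ}

/-- The unnormalised message of spin `-1` at a vertex whose spin is `-1` with probability `β`. -/
noncomputable def minusAmp (Δ : ℕ) (lam β : ℝ) : ℝ :=
  lam ^ (1 / (Δ : ℝ)) * β ^ (((Δ - 1 : ℕ) : ℝ) / (Δ : ℝ))

/-- The unnormalised message of spin `+1` at a vertex whose spin is `-1` with probability `β`. -/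
noncomputable def plusAmp (Δ : ℕ) (β : ℝ) : ℝ := (1 - β) ^ (((Δ - 1 : ℕ) : ℝ) / (Δ : ℝ))

/-- The normalised message of a vertex whose spin is `-1` with probability `β`. -/
noncomputable def message (Δ : ℕ) (lam β : ℝ) : ℝ :=
  minusAmp Δ lam β / (minusAmp Δ lam β + plusAmp Δ β)

/-- The edge partition function of two vertices of marginals `α` and `β`. -/
noncomputable def edgeZ (Δ : ℕ) (B₁ B₂ lam α β : ℝ) : ℝ :=
  B₁ * (minusAmp Δ lam α * minusAmp Δ lam β) + minusAmp Δ lam α * plusAmp Δ β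
    + plusAmp Δ α * minusAmp Δ lam β + B₂ * (plusAmp Δ α * plusAmp Δ β)

/-- The conditional maximizer of `edgeZ` in one argument, given the other one. -/
noncomputable def bestResponse (Δ : ℕ) (B₁ B₂ lam β : ℝ) : ℝ :=
  treeMap B₁ B₂ lam Δ (message Δ lam β)

lemma ampExponent_pos (hΔ : 3 ≤ Δ) : 0 < (((Δ - 1 : ℕ) : ℝ) / (Δ : ℝ)) := by
  have h1 : 0 < Δ - 1 := by omega
  have h2 : 0 < Δ := by omega
  positivity

lemma ampExponent_add (hΔ : 3 ≤ Δ) : (((Δ - 1 : ℕ) : ℝ) / (Δ : ℝ)) + 1 / (Δ : ℝ) = 1 := by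
  have h2 : (0 : ℝ) < Δ := by exact_mod_cast (by omega : 0 < Δ)
  rw [Nat.cast_sub (by omega)]
  field_simp
  push_cast; ring

lemma minusAmp_nonneg (hlam : 0 < lam) {β : ℝ} (hβ : β ∈ Set.Icc (0 : ℝ) 1) :
    0 ≤ minusAmp Δ lam β :=
  mul_nonneg (Real.rpow_nonneg hlam.le _) (Real.rpow_nonneg hβ.1 _)

lemma plusAmp_nonneg {β : ℝ} (hβ : β ∈ Set.Icc (0 : ℝ) 1) : 0 ≤ plusAmp Δ β :=
  Real.rpow_nonneg (sub_nonneg.2 hβ.2) _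

lemma minusAmp_pos (hlam : 0 < lam) {β : ℝ} (hβ : 0 < β) : 0 < minusAmp Δ lam β :=
  mul_pos (Real.rpow_pos_of_pos hlam _) (Real.rpow_pos_of_pos hβ _)

lemma plusAmp_pos {β : ℝ} (hβ : β < 1) : 0 < plusAmp Δ β :=
  Real.rpow_pos_of_pos (sub_pos.2 hβ) _

lemma amp_add_pos (hlam : 0 < lam) {β : ℝ} (hβ : β ∈ Set.Icc (0 : ℝ) 1) :
    0 < minusAmp Δ lam β + plusAmp Δ β := by
  have h1 := minusAmp_nonneg (Δ := Δ) hlam hβ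
  have h2 := plusAmp_nonneg (Δ := Δ) hβ
  rcases hβ.2.lt_or_eq with h | h
  · have := plusAmp_pos (Δ := Δ) h; linarith
  · have := minusAmp_pos (Δ := Δ) hlam (by linarith : 0 < β); linarith

lemma continuous_minusAmp (hΔ : 3 ≤ Δ) : Continuous (minusAmp Δ lam) :=
  continuous_const.mul (continuous_id.rpow_const fun _ => Or.inr (ampExponent_pos hΔ).le)

lemma continuous_plusAmp (hΔ : 3 ≤ Δ) : Continuous (plusAmp Δ) :=
  (continuous_const.sub continuous_id).rpow_const fun _ => Or.inr (ampExponent_pos hΔ).le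

lemma continuousOn_message (hΔ : 3 ≤ Δ) (hlam : 0 < lam) :
    ContinuousOn (message Δ lam) (Set.Icc 0 1) :=
  (continuous_minusAmp hΔ).continuousOn.div
    ((continuous_minusAmp hΔ).add (continuous_plusAmp hΔ)).continuousOn
    fun _ hβ => (amp_add_pos hlam hβ).ne'

lemma message_mem_Icc (hlam : 0 < lam) {β : ℝ} (hβ : β ∈ Set.Icc (0 : ℝ) 1) :
    message Δ lam β ∈ Set.Icc (0 : ℝ) 1 := by
  have h1 := minusAmp_nonneg (Δ := Δ) hlam hβ
  have h2 := plusAmp_nonneg (Δ := Δ) hβ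
  have h := amp_add_pos (Δ := Δ) hlam hβ
  refine ⟨by unfold message; positivity, ?_⟩
  unfold message
  rw [div_le_one h]; linarith

lemma strictMonoOn_message (hΔ : 3 ≤ Δ) (hlam : 0 < lam) :
    StrictMonoOn (message Δ lam) (Set.Icc 0 1) := by
  intro α hα β hβ hαβ
  have he := ampExponent_pos hΔ
  have h1 : minusAmp Δ lam α < minusAmp Δ lam β :=
    mul_lt_mul_of_pos_left (Real.rpow_lt_rpow hα.1 hαβ he) (Real.rpow_pos_of_pos hlam _)
  have h2 : plusAmp Δ β < plusAmp Δ α :=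
    Real.rpow_lt_rpow (sub_nonneg.2 hβ.2) (by linarith) he
  have h3 := minusAmp_nonneg (Δ := Δ) hlam hα
  have h4 := plusAmp_nonneg (Δ := Δ) hβ
  unfold message
  rw [div_lt_div_iff₀ (amp_add_pos hlam hα) (amp_add_pos hlam hβ)]
  nlinarith

lemma edgeZ_comm (α β : ℝ) : edgeZ Δ B₁ B₂ lam α β = edgeZ Δ B₁ B₂ lam β α := by
  unfold edgeZ; ring

/-- For fixed β the form is linear in the amplitudes of α; up to a common factor its coefficients
are the tree factors for the message of β. -/
lemma edgeZ_eq (hlam : 0 < lam) (α : ℝ) {β : ℝ} (hβ : β ∈ Set.Icc (0 : ℝ) 1) :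
    edgeZ Δ B₁ B₂ lam α β = (minusAmp Δ lam β + plusAmp Δ β) *
      (minusAmp Δ lam α * minusFactor B₁ (message Δ lam β)
        + plusAmp Δ α * plusFactor B₂ (message Δ lam β)) := by
  have h := (amp_add_pos (Δ := Δ) hlam hβ).ne'
  unfold edgeZ minusFactor plusFactor message
  field_simp
  ring

lemma continuous_edgeZ (hΔ : 3 ≤ Δ) :
    Continuous fun x : ℝ × ℝ => edgeZ Δ B₁ B₂ lam x.1 x.2 := by
  have h1 := continuous_minusAmp (lam := lam) hΔ
  have h2 := continuous_plusAmp hΔ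
  unfold edgeZ
  fun_prop

/-- The amplitudes at the root of the tree. -/
lemma minusAmp_treeMap (hΔ : 3 ≤ Δ) (hB₁ : 0 ≤ B₁) (hB₂ : 0 ≤ B₂) (hlam : 0 < lam) {p : ℝ}
    (hp : p ∈ Set.Icc (0 : ℝ) 1) :
    minusAmp Δ lam (treeMap B₁ B₂ lam Δ p) = lam * minusFactor B₁ p ^ (Δ - 1)
      / treeTotal B₁ B₂ lam Δ p ^ (((Δ - 1 : ℕ) : ℝ) / (Δ : ℝ)) := by
  have hP := minusFactor_nonneg hB₁ hp
  have hS := treeTotal_pos hB₁ hB₂ hlam Δ hp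
  have hΔ0 : (Δ : ℝ) ≠ 0 := by exact_mod_cast (by omega : Δ ≠ 0)
  unfold minusAmp treeMap
  rw [Real.div_rpow (by positivity) hS.le, Real.mul_rpow hlam.le (by positivity),
    ← Real.rpow_natCast (minusFactor B₁ p) Δ, ← Real.rpow_mul hP, mul_div_cancel₀ _ hΔ0,
    Real.rpow_natCast, ← mul_div_assoc, ← mul_assoc, ← Real.rpow_add hlam, add_comm,
    ampExponent_add hΔ, Real.rpow_one]

lemma plusAmp_treeMap (hΔ : 3 ≤ Δ) (hB₁ : 0 ≤ B₁) (hB₂ : 0 ≤ B₂) (hlam : 0 < lam) {p : ℝ}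
    (hp : p ∈ Set.Icc (0 : ℝ) 1) :
    plusAmp Δ (treeMap B₁ B₂ lam Δ p) = plusFactor B₂ p ^ (Δ - 1)
      / treeTotal B₁ B₂ lam Δ p ^ (((Δ - 1 : ℕ) : ℝ) / (Δ : ℝ)) := by
  have hQ := plusFactor_nonneg hB₂ hp
  have hS := treeTotal_pos hB₁ hB₂ hlam Δ hp
  have hΔ0 : (Δ : ℝ) ≠ 0 := by exact_mod_cast (by omega : Δ ≠ 0)
  unfold plusAmp
  rw [one_sub_treeMap hB₁ hB₂ hlam Δ hp, Real.div_rpow (by positivity) hS.le,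
    ← Real.rpow_natCast (plusFactor B₂ p) Δ, ← Real.rpow_mul hQ, mul_div_cancel₀ _ hΔ0,
    Real.rpow_natCast]

/-- Amplitudes take the power (Δ-1)/Δ of a marginal and so turn the Δ-th powers at the root into
(Δ-1)-th powers. After normalisation this is the message of a vertex with one neighbour removed. -/
lemma message_treeMap (hΔ : 3 ≤ Δ) (hB₁ : 0 ≤ B₁) (hB₂ : 0 ≤ B₂) (hlam : 0 < lam) {p : ℝ}
    (hp : p ∈ Set.Icc (0 : ℝ) 1) :
    message Δ lam (treeMap B₁ B₂ lam Δ p) = treeMap B₁ B₂ lam (Δ - 1) p := by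
  have hS := Real.rpow_pos_of_pos (treeTotal_pos hB₁ hB₂ hlam Δ hp) (((Δ - 1 : ℕ) : ℝ) / (Δ : ℝ))
  unfold message
  rw [minusAmp_treeMap hΔ hB₁ hB₂ hlam hp, plusAmp_treeMap hΔ hB₁ hB₂ hlam hp, ← add_div,
    div_div_div_cancel_right₀ hS.ne']
  rfl

/-- The weighted inequality of arithmetic and geometric means, with its case of equality. -/
lemma rpow_mul_rpow_lt {w x y : ℝ} (hw0 : 0 < w) (hw1 : w < 1) (hx : 0 ≤ x) (hy : 0 ≤ y)
    (hxy : x ≠ y) : x ^ w * y ^ (1 - w) < w * x + (1 - w) * y := by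
  have h := (Real.geom_mean_lt_arith_mean_weighted_iff_of_pos Finset.univ ![w, 1 - w] ![x, y]
    (by simp [Fin.forall_fin_two, hw0, hw1]) (by simp)
    (by simp [Fin.forall_fin_two, hx, hy])).2 ⟨0, by simp, 1, by simp, by simpa using hxy⟩
  simpa using h

lemma rpow_mul_rpow_self {w x : ℝ} (hx : 0 ≤ x) : x ^ w * x ^ (1 - w) = x := by
  rcases hx.eq_or_lt with rfl | h
  · by_cases hw : w = 0
    · simp [hw]
    · simp [Real.zero_rpow hw]
  · rw [← Real.rpow_add h]; simp

/-- `edgeZ` in terms of the conditional maximizer. -/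
lemma amp_mul_factor (hΔ : 3 ≤ Δ) (hB₁ : 0 ≤ B₁) (hB₂ : 0 ≤ B₂) (hlam : 0 < lam) (α : ℝ) {p : ℝ}
    (hp : p ∈ Set.Icc (0 : ℝ) 1) :
    minusAmp Δ lam α * minusFactor B₁ p = treeTotal B₁ B₂ lam Δ p ^ (1 / (Δ : ℝ)) *
      (α ^ (((Δ - 1 : ℕ) : ℝ) / (Δ : ℝ)) *
        treeMap B₁ B₂ lam Δ p ^ (1 - ((Δ - 1 : ℕ) : ℝ) / (Δ : ℝ))) ∧
    plusAmp Δ α * plusFactor B₂ p = treeTotal B₁ B₂ lam Δ p ^ (1 / (Δ : ℝ)) *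
      ((1 - α) ^ (((Δ - 1 : ℕ) : ℝ) / (Δ : ℝ)) *
        (1 - treeMap B₁ B₂ lam Δ p) ^ (1 - ((Δ - 1 : ℕ) : ℝ) / (Δ : ℝ))) := by
  have hP := minusFactor_nonneg hB₁ hp
  have hQ := plusFactor_nonneg hB₂ hp
  have hS := treeTotal_pos hB₁ hB₂ hlam Δ hp
  have hS' := Real.rpow_pos_of_pos hS (1 / (Δ : ℝ))
  have hΔ0 : (Δ : ℝ) ≠ 0 := by exact_mod_cast (by omega : Δ ≠ 0)
  have hw : 1 - ((Δ - 1 : ℕ) : ℝ) / (Δ : ℝ) = 1 / (Δ : ℝ) := by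
    have := ampExponent_add hΔ; linarith
  rw [hw, one_sub_treeMap hB₁ hB₂ hlam Δ hp]
  unfold treeMap minusAmp plusAmp
  rw [Real.div_rpow (by positivity) hS.le, Real.div_rpow (by positivity) hS.le,
    Real.mul_rpow hlam.le (by positivity), ← Real.rpow_natCast (minusFactor B₁ p) Δ,
    ← Real.rpow_natCast (plusFactor B₂ p) Δ, ← Real.rpow_mul hP, ← Real.rpow_mul hQ,
    mul_one_div_cancel hΔ0, Real.rpow_one, Real.rpow_one]
  constructor <;> field_simp

/-- By `amp_mul_factor`, up to a positive factor independent of α the form is α^w r^(1-w) + (1-α)^w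
(1-r)^(1-w), with w = (Δ-1)/Δ and r the best response. Weighted AM-GM bounds this by 1, with
equality only at α = r. -/
lemma edgeZ_lt_edgeZ_bestResponse (hΔ : 3 ≤ Δ) (hB₁ : 0 ≤ B₁) (hB₂ : 0 ≤ B₂) (hlam : 0 < lam)
    {α β : ℝ} (hα : α ∈ Set.Icc (0 : ℝ) 1) (hβ : β ∈ Set.Icc (0 : ℝ) 1)
    (hne : α ≠ bestResponse Δ B₁ B₂ lam β) :
    edgeZ Δ B₁ B₂ lam α β < edgeZ Δ B₁ B₂ lam (bestResponse Δ B₁ B₂ lam β) β := by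
  have hp := message_mem_Icc (Δ := Δ) hlam hβ
  have hr : treeMap B₁ B₂ lam Δ (message Δ lam β) ∈ Set.Icc (0 : ℝ) 1 :=
    treeMap_mem_Icc hB₁ hB₂ hlam Δ hp
  have hw0 := ampExponent_pos hΔ
  have hw1 : (((Δ - 1 : ℕ) : ℝ) / (Δ : ℝ)) < 1 := by
    have h1 := ampExponent_add hΔ
    have : 0 < 1 / (Δ : ℝ) := by
      have : 0 < Δ := by omega
      positivity
    linarith
  unfold bestResponse at hne ⊢
  rw [edgeZ_eq hlam _ hβ, edgeZ_eq hlam _ hβ]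
  refine mul_lt_mul_of_pos_left ?_ (amp_add_pos hlam hβ)
  obtain ⟨h1, h2⟩ := amp_mul_factor hΔ hB₁ hB₂ hlam α hp
  obtain ⟨h3, h4⟩ := amp_mul_factor hΔ hB₁ hB₂ hlam (treeMap B₁ B₂ lam Δ (message Δ lam β)) hp
  rw [h1, h2, h3, h4, ← mul_add, ← mul_add, rpow_mul_rpow_self hr.1,
    rpow_mul_rpow_self (sub_nonneg.2 hr.2)]
  refine mul_lt_mul_of_pos_left ?_ (Real.rpow_pos_of_pos (treeTotal_pos hB₁ hB₂ hlam Δ hp) _)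
  have h5 := rpow_mul_rpow_lt hw0 hw1 hα.1 hr.1 hne
  have h6 := rpow_mul_rpow_lt hw0 hw1 (sub_nonneg.2 hα.2) (sub_nonneg.2 hr.2)
    (fun h => hne (by linarith))
  linarith

lemma bestResponse_mem_Icc (hB₁ : 0 ≤ B₁) (hB₂ : 0 ≤ B₂) (hlam : 0 < lam)
    {β : ℝ} (hβ : β ∈ Set.Icc (0 : ℝ) 1) : bestResponse Δ B₁ B₂ lam β ∈ Set.Icc (0 : ℝ) 1 :=
  treeMap_mem_Icc hB₁ hB₂ hlam Δ (message_mem_Icc hlam hβ)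

/-- The marginal of the edge distribution at a conditional maximizer. -/
lemma bestResponse_marginal (hΔ : 3 ≤ Δ) (hB₁ : 0 ≤ B₁) (hB₂ : 0 ≤ B₂) (hlam : 0 < lam)
    {α β : ℝ} (hβ : β ∈ Set.Icc (0 : ℝ) 1) (hα : α = bestResponse Δ B₁ B₂ lam β) :
    B₁ * (minusAmp Δ lam α * minusAmp Δ lam β) + minusAmp Δ lam α * plusAmp Δ β
      = α * edgeZ Δ B₁ B₂ lam α β := by
  have hp := message_mem_Icc (Δ := Δ) hlam hβ
  have hr : treeMap B₁ B₂ lam Δ (message Δ lam β) ∈ Set.Icc (0 : ℝ) 1 :=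
    treeMap_mem_Icc hB₁ hB₂ hlam Δ hp
  have hα' : α = treeMap B₁ B₂ lam Δ (message Δ lam β) := hα
  obtain ⟨h3, h4⟩ := amp_mul_factor hΔ hB₁ hB₂ hlam (treeMap B₁ B₂ lam Δ (message Δ lam β)) hp
  -- At the best response the two summands are α and 1 - α times a common factor, so the spin -1 has
  -- share α of `edgeZ`.
  rw [rpow_mul_rpow_self hr.1] at h3
  rw [rpow_mul_rpow_self (sub_nonneg.2 hr.2)] at h4
  rw [← hα'] at h3 h4
  have h5 : B₁ * (minusAmp Δ lam α * minusAmp Δ lam β) + minusAmp Δ lam α * plusAmp Δ β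
      = (minusAmp Δ lam β + plusAmp Δ β) *
        (minusAmp Δ lam α * minusFactor B₁ (message Δ lam β)) := by
    have h := (amp_add_pos (Δ := Δ) hlam hβ).ne'
    unfold minusFactor message
    field_simp
    ring
  rw [h5, edgeZ_eq hlam _ hβ, h3, h4]
  ring

lemma edgeZ_bestResponse_pos (hΔ : 3 ≤ Δ) (hB₁ : 0 ≤ B₁) (hB₂ : 0 ≤ B₂) (hlam : 0 < lam)
    {β : ℝ} (hβ : β ∈ Set.Icc (0 : ℝ) 1) :
    0 < edgeZ Δ B₁ B₂ lam (bestResponse Δ B₁ B₂ lam β) β := by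
  have hp := message_mem_Icc (Δ := Δ) hlam hβ
  have hr : treeMap B₁ B₂ lam Δ (message Δ lam β) ∈ Set.Icc (0 : ℝ) 1 :=
    treeMap_mem_Icc hB₁ hB₂ hlam Δ hp
  obtain ⟨h3, h4⟩ := amp_mul_factor hΔ hB₁ hB₂ hlam (treeMap B₁ B₂ lam Δ (message Δ lam β)) hp
  unfold bestResponse
  rw [edgeZ_eq hlam _ hβ, h3, h4, rpow_mul_rpow_self hr.1, rpow_mul_rpow_self (sub_nonneg.2 hr.2),
    ← mul_add, add_sub_cancel, mul_one]
  exact mul_pos (amp_add_pos hlam hβ)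
    (Real.rpow_pos_of_pos (treeTotal_pos hB₁ hB₂ hlam Δ hp) _)

lemma continuousOn_bestResponse (hΔ : 3 ≤ Δ) (hB₁ : 0 ≤ B₁) (hB₂ : 0 ≤ B₂) (hlam : 0 < lam) :
    ContinuousOn (bestResponse Δ B₁ B₂ lam) (Set.Icc 0 1) :=
  (continuousOn_treeMap hB₁ hB₂ hlam Δ).comp (continuousOn_message hΔ hlam)
    fun _ hβ => message_mem_Icc hlam hβ

/-- A maximizer of `edgeZ` on the square corresponds to a fixed point of the two-step recursion. -/
lemma exists_fixed_of_isMaxOn_edgeZ (hΔ : 3 ≤ Δ) (hB₁ : 0 ≤ B₁) (hB₂ : 0 ≤ B₂) (hlam : 0 < lam)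
    {α β : ℝ} (hα : α ∈ Set.Icc (0 : ℝ) 1) (hβ : β ∈ Set.Icc (0 : ℝ) 1)
    (hmax : ∀ α' ∈ Set.Icc (0 : ℝ) 1, ∀ β' ∈ Set.Icc (0 : ℝ) 1,
      edgeZ Δ B₁ B₂ lam α' β' ≤ edgeZ Δ B₁ B₂ lam α β) :
    α = bestResponse Δ B₁ B₂ lam β ∧ β = bestResponse Δ B₁ B₂ lam α := by
  constructor
  · by_contra hne
    exact absurd (hmax _ (bestResponse_mem_Icc hB₁ hB₂ hlam hβ) _ hβ)
      (not_le.2 (edgeZ_lt_edgeZ_bestResponse hΔ hB₁ hB₂ hlam hα hβ hne))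
  · by_contra hne
    have h := edgeZ_lt_edgeZ_bestResponse hΔ hB₁ hB₂ hlam hβ hα hne
    rw [edgeZ_comm, edgeZ_comm (bestResponse Δ B₁ B₂ lam α)] at h
    exact absurd (hmax _ hα _ (bestResponse_mem_Icc hB₁ hB₂ hlam hα)) (not_le.2 h)

lemma exists_isMaxOn_edgeZ (hΔ : 3 ≤ Δ) :
    ∃ α ∈ Set.Icc (0 : ℝ) 1, ∃ β ∈ Set.Icc (0 : ℝ) 1,
      ∀ α' ∈ Set.Icc (0 : ℝ) 1, ∀ β' ∈ Set.Icc (0 : ℝ) 1,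
        edgeZ Δ B₁ B₂ lam α' β' ≤ edgeZ Δ B₁ B₂ lam α β := by
  obtain ⟨x, hx, hmax⟩ := (isCompact_Icc.prod isCompact_Icc).exists_isMaxOn
    (s := Set.Icc (0 : ℝ) 1 ×ˢ Set.Icc (0 : ℝ) 1) ⟨(0, 0), by simp⟩
    (continuous_edgeZ (B₁ := B₁) (B₂ := B₂) (lam := lam) hΔ).continuousOn
  exact ⟨x.1, hx.1, x.2, hx.2, fun α' hα' β' hβ' => hmax (Set.mk_mem_prod hα' hβ')⟩

/-- By symmetry of the form, this is a second maximization in one coordinate, now replacing β. It is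
a strict gain unless β was optimal already. -/
lemma edgeZ_bestResponse_lt (hΔ : 3 ≤ Δ) (hB₁ : 0 ≤ B₁) (hB₂ : 0 ≤ B₂) (hlam : 0 < lam)
    {β : ℝ} (hβ : β ∈ Set.Icc (0 : ℝ) 1)
    (hne : β ≠ bestResponse Δ B₁ B₂ lam (bestResponse Δ B₁ B₂ lam β)) :
    edgeZ Δ B₁ B₂ lam (bestResponse Δ B₁ B₂ lam β) β
      < edgeZ Δ B₁ B₂ lam (bestResponse Δ B₁ B₂ lam (bestResponse Δ B₁ B₂ lam β))
          (bestResponse Δ B₁ B₂ lam β) := by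
  rw [edgeZ_comm]
  exact edgeZ_lt_edgeZ_bestResponse hΔ hB₁ hB₂ hlam hβ (bestResponse_mem_Icc hB₁ hB₂ hlam hβ) hne

lemma edgeZ_bestResponse_le (hΔ : 3 ≤ Δ) (hB₁ : 0 ≤ B₁) (hB₂ : 0 ≤ B₂) (hlam : 0 < lam)
    {β : ℝ} (hβ : β ∈ Set.Icc (0 : ℝ) 1) :
    edgeZ Δ B₁ B₂ lam (bestResponse Δ B₁ B₂ lam β) β
      ≤ edgeZ Δ B₁ B₂ lam (bestResponse Δ B₁ B₂ lam (bestResponse Δ B₁ B₂ lam β))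
          (bestResponse Δ B₁ B₂ lam β) := by
  by_cases h : β = bestResponse Δ B₁ B₂ lam (bestResponse Δ B₁ B₂ lam β)
  · rw [← h, edgeZ_comm]
  · exact (edgeZ_bestResponse_lt hΔ hB₁ hB₂ hlam hβ h).le

/-- If the two-step recursion moves away from its fixed point `b` to the left, then `b` does not
correspond to a maximizer of `edgeZ`. -/
lemma exists_edgeZ_gt_of_repelling (hΔ : 3 ≤ Δ) (hB₁ : 0 ≤ B₁) (hB₂ : 0 ≤ B₂) (hlam : 0 < lam)
    {a b : ℝ} (ha : 0 ≤ a) (hb : b ≤ 1) (hab : a < b) (hfix : bestResponse Δ B₁ B₂ lam b = b)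
    (hlt : ∀ β ∈ Set.Ioo a b,
      bestResponse Δ B₁ B₂ lam (bestResponse Δ B₁ B₂ lam β) < β) :
    ∃ α ∈ Set.Icc (0 : ℝ) 1, ∃ β ∈ Set.Icc (0 : ℝ) 1,
      edgeZ Δ B₁ B₂ lam b b < edgeZ Δ B₁ B₂ lam α β := by
  have hAm : ∀ β ∈ Set.Icc (0 : ℝ) 1, bestResponse Δ B₁ B₂ lam β ∈ Set.Icc (0 : ℝ) 1 :=
    fun β hβ => bestResponse_mem_Icc hB₁ hB₂ hlam hβ
  have hAc : ContinuousOn (bestResponse Δ B₁ B₂ lam) (Set.Icc 0 1) :=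
    continuousOn_bestResponse hΔ hB₁ hB₂ hlam
  have hAlt : ∀ β ∈ Set.Icc (0 : ℝ) 1,
      β ≠ bestResponse Δ B₁ B₂ lam (bestResponse Δ B₁ B₂ lam β) → _ := fun β hβ h =>
    edgeZ_bestResponse_lt hΔ hB₁ hB₂ hlam hβ h
  have hAle : ∀ β ∈ Set.Icc (0 : ℝ) 1, _ := fun β hβ =>
    edgeZ_bestResponse_le hΔ hB₁ hB₂ hlam hβ
  generalize bestResponse Δ B₁ B₂ lam = A at *
  have hsub : Set.Icc ((a + b) / 2) b ⊆ Set.Icc (0 : ℝ) 1 :=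
    Set.Icc_subset_Icc (by linarith) hb
  have hhc : ContinuousOn (fun β => edgeZ Δ B₁ B₂ lam (A β) β) (Set.Icc 0 1) := by
    have h := (continuous_edgeZ (B₁ := B₁) (B₂ := B₂) (lam := lam) hΔ).comp_continuousOn
      (hAc.prodMk continuousOn_id)
    simpa only [Function.comp_def, id_eq] using h
  -- Minimise β ↦ `edgeZ` (A β) β just to the left of b. A minimizer c < b would have a preimage
  -- under A ∘ A in (c, b), and the value there would be strictly smaller, because alternating
  -- maximization increases it on the way to c. So the minimum is at b.
  obtain ⟨c, hc, hmin⟩ := isCompact_Icc.exists_isMinOn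
    (Set.nonempty_Icc.2 (by linarith : (a + b) / 2 ≤ b)) (hhc.mono hsub)
  have hmid : (a + b) / 2 ∈ Set.Ioo a b := ⟨by linarith, by linarith⟩
  have hmid' : (a + b) / 2 ∈ Set.Icc ((a + b) / 2) b := ⟨le_rfl, by linarith⟩
  have hcb : c = b := by
    by_contra hne
    have hcb : c < b := lt_of_le_of_ne hc.2 hne
    have hc' : c ∈ Set.Ioo a b := ⟨by linarith [hc.1], hcb⟩
    have hg : ContinuousOn (fun β => A (A β)) (Set.Icc c b) :=
      (hAc.comp hAc fun β hβ => hAm β hβ).mono (Set.Icc_subset_Icc (by linarith [hc'.1]) hb)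
    obtain ⟨β, hβ, hβc⟩ := intermediate_value_Icc hcb.le hg
      (show c ∈ Set.Icc (A (A c)) (A (A b)) from
        ⟨(hlt c hc').le, by rw [hfix, hfix]; exact hcb.le⟩)
    simp only at hβc
    have hβb : β ≠ b := by rintro rfl; rw [hfix, hfix] at hβc; linarith
    have hβ' : β ∈ Set.Ioo a b := ⟨by linarith [hβ.1, hc'.1], lt_of_le_of_ne hβ.2 hβb⟩
    have h1 := hAlt _ (hsub ⟨by linarith [hβ.1, hc.1], hβ.2⟩)
      (hlt β hβ').ne'
    have h2 : edgeZ Δ B₁ B₂ lam (A c) c ≤ edgeZ Δ B₁ B₂ lam (A β) β :=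
      hmin (Set.mem_Icc.2 ⟨by linarith [hβ.1, hc.1], hβ.2⟩)
    have h3 := hAle _ (hAm _ (hsub ⟨by linarith [hβ.1, hc.1], hβ.2⟩))
    rw [hβc] at h3 h1
    linarith
  -- The value at b is at most the value at the midpoint, which one more maximization strictly
  -- exceeds.
  have h1 := hAlt _ (hsub hmid') (hlt _ hmid).ne'
  have h2 : edgeZ Δ B₁ B₂ lam (A c) c ≤ edgeZ Δ B₁ B₂ lam (A ((a + b) / 2)) ((a + b) / 2) :=
    hmin hmid'
  rw [hcb, hfix] at h2
  exact ⟨_, hAm _ (hAm _ (hsub hmid')), _, hAm _ (hsub hmid'), h2.trans_lt h1⟩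

end Norm

/-! ### Fixed points of the two-step recursion in logarithmic odds. -/

section TwoStep

variable {B₁ B₂ lam : ℝ} {d : ℕ}

/-- The tree recursion in terms of the odds of the spin `-1`. -/
noncomputable def oddsMap (B₁ B₂ lam : ℝ) (d : ℕ) (x : ℝ) : ℝ :=
  lam * ((B₁ * x + 1) / (x + B₂)) ^ d

/-- The negative of the logarithmic derivative of `oddsMap`. -/
noncomputable def oddsSlope (B₁ B₂ : ℝ) (d : ℕ) (x : ℝ) : ℝ :=
  d * (1 - B₁ * B₂) * x / ((B₁ * x + 1) * (x + B₂))

/-- The logarithmic derivative of `oddsSlope`. -/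
noncomputable def oddsCurv (B₁ B₂ x : ℝ) : ℝ := (B₂ - B₁ * x ^ 2) / ((B₁ * x + 1) * (x + B₂))

/-- The logarithmic displacement of the odds `x` under the two-step recursion. -/
noncomputable def logDisp (B₁ B₂ lam : ℝ) (d : ℕ) (x : ℝ) : ℝ :=
  Real.log (oddsMap B₁ B₂ lam d (oddsMap B₁ B₂ lam d x)) - Real.log x

lemma oddsMap_pos (hB₁ : 0 ≤ B₁) (hB₂ : 0 ≤ B₂) (hlam : 0 < lam) {x : ℝ} (hx : 0 < x) :
    0 < oddsMap B₁ B₂ lam d x := by unfold oddsMap; positivity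

lemma hasDerivAt_log_oddsMap (hB₁ : 0 ≤ B₁) (hB₂ : 0 ≤ B₂) (hlam : 0 < lam) {x : ℝ}
    (hx : 0 < x) :
    HasDerivAt (fun x => Real.log (oddsMap B₁ B₂ lam d x)) (-oddsSlope B₁ B₂ d x / x) x := by
  have h1 : 0 < B₁ * x + 1 := by positivity
  have h2 : 0 < x + B₂ := by positivity
  have hd1 : HasDerivAt (fun x => B₁ * x + 1) B₁ x := by
    simpa using ((hasDerivAt_id x).const_mul B₁).add_const 1
  have hd2 : HasDerivAt (fun x => x + B₂) 1 x := (hasDerivAt_id x).add_const B₂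
  have h : HasDerivAt (fun x => Real.log lam + d * (Real.log (B₁ * x + 1) - Real.log (x + B₂)))
      (d * (B₁ / (B₁ * x + 1) - 1 / (x + B₂))) x :=
    (((hd1.log h1.ne').sub (hd2.log h2.ne')).const_mul (d : ℝ)).const_add _
  have he : (d * (B₁ / (B₁ * x + 1) - 1 / (x + B₂)) : ℝ) = -oddsSlope B₁ B₂ d x / x := by
    unfold oddsSlope; field_simp; ring
  rw [he] at h
  refine h.congr_of_eventuallyEq ?_
  filter_upwards [lt_mem_nhds hx] with y hy
  have h1 : 0 < B₁ * y + 1 := by positivity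
  have h2 : 0 < y + B₂ := by positivity
  unfold oddsMap
  rw [Real.log_mul hlam.ne' (by positivity), Real.log_pow, Real.log_div h1.ne' h2.ne']

lemma hasDerivAt_oddsMap (hB₁ : 0 ≤ B₁) (hB₂ : 0 ≤ B₂) (hlam : 0 < lam) {x : ℝ}
    (hx : 0 < x) : HasDerivAt (oddsMap B₁ B₂ lam d)
      (oddsMap B₁ B₂ lam d x * (-oddsSlope B₁ B₂ d x / x)) x := by
  have h := (hasDerivAt_log_oddsMap (d := d) hB₁ hB₂ hlam hx).exp
  rw [Real.exp_log (oddsMap_pos hB₁ hB₂ hlam hx)] at h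
  refine h.congr_of_eventuallyEq ?_
  filter_upwards [lt_mem_nhds hx] with y hy
  rw [Real.exp_log (oddsMap_pos hB₁ hB₂ hlam hy)]

/-- In the coordinate log x the slope of a composition is the product of the slopes, and the two
minus signs cancel. -/
lemma hasDerivAt_logDisp (hB₁ : 0 ≤ B₁) (hB₂ : 0 ≤ B₂) (hlam : 0 < lam) {x : ℝ}
    (hx : 0 < x) : HasDerivAt (logDisp B₁ B₂ lam d)
      ((oddsSlope B₁ B₂ d x * oddsSlope B₁ B₂ d (oddsMap B₁ B₂ lam d x) - 1) / x) x := by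
  have hF := oddsMap_pos (d := d) hB₁ hB₂ hlam hx
  have h := ((hasDerivAt_log_oddsMap (d := d) hB₁ hB₂ hlam hF).comp x
    (hasDerivAt_oddsMap hB₁ hB₂ hlam hx)).sub (Real.hasDerivAt_log hx.ne')
  refine h.congr_deriv ?_
  field_simp

lemma oddsSlope_pos (hB₁ : 0 ≤ B₁) (hB₂ : 0 ≤ B₂) (hB : B₁ * B₂ < 1) (hd : 0 < d) {x : ℝ}
    (hx : 0 < x) : 0 < oddsSlope B₁ B₂ d x := by
  have : 0 < 1 - B₁ * B₂ := by linarith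
  unfold oddsSlope; positivity

lemma hasDerivAt_log_oddsSlope (hB₁ : 0 ≤ B₁) (hB₂ : 0 ≤ B₂) (hB : B₁ * B₂ < 1) (hd : 0 < d)
    {x : ℝ} (hx : 0 < x) :
    HasDerivAt (fun x => Real.log (oddsSlope B₁ B₂ d x)) (oddsCurv B₁ B₂ x / x) x := by
  have h0 : 0 < 1 - B₁ * B₂ := by linarith
  have h1 : 0 < B₁ * x + 1 := by positivity
  have h2 : 0 < x + B₂ := by positivity
  have hd1 : HasDerivAt (fun x => B₁ * x + 1) B₁ x := by
    simpa using ((hasDerivAt_id x).const_mul B₁).add_const 1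
  have hd2 : HasDerivAt (fun x => x + B₂) 1 x := (hasDerivAt_id x).add_const B₂
  have h : HasDerivAt (fun x => Real.log (d * (1 - B₁ * B₂)) + Real.log x
      - (Real.log (B₁ * x + 1) + Real.log (x + B₂)))
      (x⁻¹ - (B₁ / (B₁ * x + 1) + 1 / (x + B₂))) x :=
    ((Real.hasDerivAt_log hx.ne').const_add _).sub ((hd1.log h1.ne').add (hd2.log h2.ne'))
  have he : x⁻¹ - (B₁ / (B₁ * x + 1) + 1 / (x + B₂)) = oddsCurv B₁ B₂ x / x := by
    unfold oddsCurv; field_simp; ring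
  rw [he] at h
  refine h.congr_of_eventuallyEq ?_
  filter_upwards [lt_mem_nhds hx] with y hy
  have h1 : 0 < B₁ * y + 1 := by positivity
  have h2 : 0 < y + B₂ := by positivity
  unfold oddsSlope
  rw [Real.log_div (by positivity) (by positivity), Real.log_mul (by positivity) hy.ne',
    Real.log_mul h1.ne' h2.ne']

lemma hasDerivAt_log_oddsSlope_mul (hB₁ : 0 ≤ B₁) (hB₂ : 0 ≤ B₂) (hlam : 0 < lam)
    (hB : B₁ * B₂ < 1) (hd : 0 < d) {x : ℝ} (hx : 0 < x) :
    HasDerivAt (fun x => Real.log (oddsSlope B₁ B₂ d x)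
        + Real.log (oddsSlope B₁ B₂ d (oddsMap B₁ B₂ lam d x)))
      ((oddsCurv B₁ B₂ x - oddsSlope B₁ B₂ d x * oddsCurv B₁ B₂ (oddsMap B₁ B₂ lam d x)) / x)
      x := by
  have hF := oddsMap_pos (d := d) hB₁ hB₂ hlam hx
  have h := (hasDerivAt_log_oddsSlope hB₁ hB₂ hB hd hx).add
    ((hasDerivAt_log_oddsSlope hB₁ hB₂ hB hd hF).comp x (hasDerivAt_oddsMap hB₁ hB₂ hlam hx))
  refine h.congr_deriv ?_
  field_simp
  ring

lemma oddsMap_le (hB₁ : 0 ≤ B₁) (hB₂ : 0 ≤ B₂) (hlam : 0 < lam) (hB : B₁ * B₂ < 1) {x y : ℝ}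
    (hx : 0 < x) (hxy : x ≤ y) : oddsMap B₁ B₂ lam d y ≤ oddsMap B₁ B₂ lam d x := by
  have hy : 0 < y := hx.trans_le hxy
  unfold oddsMap
  have h : (B₁ * y + 1) / (y + B₂) ≤ (B₁ * x + 1) / (x + B₂) := by
    rw [div_le_div_iff₀ (by positivity) (by positivity)]
    nlinarith
  gcongr

lemma oddsCurv_le (hB₁ : 0 ≤ B₁) (hB₂ : 0 ≤ B₂) {x y : ℝ} (hx : 0 < x) (hxy : x ≤ y) :
    oddsCurv B₁ B₂ y ≤ oddsCurv B₁ B₂ x := by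
  have he : ∀ z : ℝ, 0 < z → oddsCurv B₁ B₂ z = 1 / (B₁ * z + 1) + B₂ / (z + B₂) - 1 := by
    intro z hz
    unfold oddsCurv
    have h1 : 0 < B₁ * z + 1 := by positivity
    have h2 : 0 < z + B₂ := by positivity
    field_simp; ring
  have hy : 0 < y := hx.trans_le hxy
  rw [he x hx, he y hy]
  gcongr

/-- The common denominator cancels and leaves a positive multiple of B₂/x - B₁x, which is strictly
decreasing as soon as B₁ and B₂ are not both zero. -/
lemma oddsCurv_div_oddsSlope_lt (hB₁ : 0 ≤ B₁) (hB₂ : 0 ≤ B₂) (hB : B₁ * B₂ < 1)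
    (h0 : 0 < B₁ + B₂) (hd : 0 < d) {x y : ℝ} (hx : 0 < x) (hxy : x < y) :
    oddsCurv B₁ B₂ y / oddsSlope B₁ B₂ d y < oddsCurv B₁ B₂ x / oddsSlope B₁ B₂ d x := by
  have hB' : 0 < 1 - B₁ * B₂ := by linarith
  have he : ∀ z : ℝ, 0 < z → oddsCurv B₁ B₂ z / oddsSlope B₁ B₂ d z
      = (B₂ / z - B₁ * z) / (d * (1 - B₁ * B₂)) := by
    intro z hz
    unfold oddsCurv oddsSlope
    have h1 : 0 < B₁ * z + 1 := by positivity
    have h2 : 0 < z + B₂ := by positivity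
    field_simp
  have hy : 0 < y := hx.trans hxy
  rw [he x hx, he y hy]
  refine div_lt_div_of_pos_right ?_ (by positivity)
  rcases hB₁.eq_or_lt with rfl | hB₁
  · have : 0 < B₂ := by linarith
    simpa using div_lt_div_of_pos_left this hx hxy
  · have h1 : B₂ / y ≤ B₂ / x := div_le_div_of_nonneg_left hB₂ hx hxy.le
    have h2 : B₁ * x < B₁ * y := mul_lt_mul_of_pos_left hxy hB₁
    linarith

/-- The logarithmic slope of the two-step recursion is `1` at most twice. -/
lemma oddsSlope_mul_ne_one (hB₁ : 0 ≤ B₁) (hB₂ : 0 ≤ B₂) (hlam : 0 < lam)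
    (hB : B₁ * B₂ < 1) (h0 : 0 < B₁ + B₂) (hd : 0 < d) {z : Fin 3 → ℝ} (hz : 0 < z 0)
    (h01 : z 0 < z 1) (h12 : z 1 < z 2)
    (h : ∀ i, oddsSlope B₁ B₂ d (z i) * oddsSlope B₁ B₂ d (oddsMap B₁ B₂ lam d (z i)) = 1) :
    False := by
  have hpos : ∀ i, 0 < z i := by
    intro i; fin_cases i
    · exact hz
    · exact hz.trans h01
    · exact (hz.trans h01).trans h12
  -- Between two points where the product of slopes is 1, its logarithm has a critical point.
  have hrolle : ∀ i j, z i < z j → ∃ w ∈ Set.Ioo (z i) (z j),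
      oddsCurv B₁ B₂ w = oddsSlope B₁ B₂ d w * oddsCurv B₁ B₂ (oddsMap B₁ B₂ lam d w) := by
    intro i j hij
    have hL : ∀ i, Real.log (oddsSlope B₁ B₂ d (z i))
        + Real.log (oddsSlope B₁ B₂ d (oddsMap B₁ B₂ lam d (z i))) = 0 := by
      intro i
      rw [← Real.log_mul (oddsSlope_pos hB₁ hB₂ hB hd (hpos i)).ne'
        (oddsSlope_pos hB₁ hB₂ hB hd (oddsMap_pos hB₁ hB₂ hlam (hpos i))).ne', h i, Real.log_one]
    obtain ⟨w, hw, hw0⟩ := exists_hasDerivAt_eq_zero hij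
      (fun x hx => (hasDerivAt_log_oddsSlope_mul hB₁ hB₂ hlam hB hd
        ((hpos i).trans_le hx.1)).continuousAt.continuousWithinAt)
      ((hL i).trans (hL j).symm)
      fun x hx => hasDerivAt_log_oddsSlope_mul hB₁ hB₂ hlam hB hd ((hpos i).trans hx.1)
    have hwpos : 0 < w := (hpos i).trans hw.1
    refine ⟨w, hw, ?_⟩
    rw [div_eq_zero_iff] at hw0
    rcases hw0 with hw0 | hw0 <;> linarith
  obtain ⟨v, hv, hve⟩ := hrolle 0 1 h01
  obtain ⟨w, hw, hwe⟩ := hrolle 1 2 h12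
  have hv0 : 0 < v := hz.trans hv.1
  have hvw : v < w := hv.2.trans hw.1
  have hw0 : 0 < w := hv0.trans hvw
  -- At a critical point w the quotient of `oddsCurv` by `oddsSlope` equals `oddsCurv` at the image
  -- of w. The quotient is strictly decreasing, whereas the other side, composed of two
  -- nonincreasing maps, is nondecreasing. Hence there are no two critical points.
  have h1 := oddsCurv_div_oddsSlope_lt hB₁ hB₂ hB h0 hd hv0 hvw
  rw [hve, hwe, mul_div_cancel_left₀ _ (oddsSlope_pos hB₁ hB₂ hB hd hv0).ne',
    mul_div_cancel_left₀ _ (oddsSlope_pos hB₁ hB₂ hB hd hw0).ne'] at h1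
  have h2 := oddsCurv_le hB₁ hB₂ (oddsMap_pos (d := d) hB₁ hB₂ hlam hw0)
    (oddsMap_le hB₁ hB₂ hlam hB hv0 hvw.le)
  linarith

lemma exists_oddsSlope_mul_eq_one (hB₁ : 0 ≤ B₁) (hB₂ : 0 ≤ B₂) (hlam : 0 < lam) {x y : ℝ}
    (hx : 0 < x) (hxy : x < y) (h : logDisp B₁ B₂ lam d x = logDisp B₁ B₂ lam d y) :
    ∃ z ∈ Set.Ioo x y,
      oddsSlope B₁ B₂ d z * oddsSlope B₁ B₂ d (oddsMap B₁ B₂ lam d z) = 1 := by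
  obtain ⟨w, hw, hw0⟩ := exists_hasDerivAt_eq_zero hxy
    (fun z hz => (hasDerivAt_logDisp hB₁ hB₂ hlam
      (hx.trans_le hz.1)).continuousAt.continuousWithinAt) h
    fun z hz => hasDerivAt_logDisp hB₁ hB₂ hlam (hx.trans hz.1)
  have hwpos : 0 < w := hx.trans hw.1
  refine ⟨w, hw, ?_⟩
  rw [div_eq_zero_iff] at hw0
  rcases hw0 with hw0 | hw0 <;> linarith

/-- The two-step recursion has at most three fixed points. -/
lemma not_four_zeros_logDisp (hB₁ : 0 ≤ B₁) (hB₂ : 0 ≤ B₂) (hlam : 0 < lam)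
    (hB : B₁ * B₂ < 1) (h0 : 0 < B₁ + B₂) (hd : 0 < d) {x₁ x₂ x₃ x₄ : ℝ} (hx : 0 < x₁)
    (h12 : x₁ < x₂) (h23 : x₂ < x₃) (h34 : x₃ < x₄)
    (h1 : logDisp B₁ B₂ lam d x₁ = 0) (h2 : logDisp B₁ B₂ lam d x₂ = 0)
    (h3 : logDisp B₁ B₂ lam d x₃ = 0) (h4 : logDisp B₁ B₂ lam d x₄ = 0) : False := by
  obtain ⟨u, hu, hue⟩ := exists_oddsSlope_mul_eq_one hB₁ hB₂ hlam hx h12 (h1.trans h2.symm)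
  obtain ⟨v, hv, hve⟩ := exists_oddsSlope_mul_eq_one hB₁ hB₂ hlam (hx.trans h12) h23
    (h2.trans h3.symm)
  obtain ⟨w, hw, hwe⟩ := exists_oddsSlope_mul_eq_one hB₁ hB₂ hlam ((hx.trans h12).trans h23) h34
    (h3.trans h4.symm)
  refine oddsSlope_mul_ne_one hB₁ hB₂ hlam hB h0 hd (z := ![u, v, w]) (hx.trans hu.1)
    (hu.2.trans hv.1) (hv.2.trans hw.1) ?_
  simp [Fin.forall_fin_succ, hue, hve, hwe]

/-- Of three fixed points of the two-step recursion, the smallest one is not semistable. -/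
lemma not_semistable_logDisp (hB₁ : 0 ≤ B₁) (hB₂ : 0 ≤ B₂) (hlam : 0 < lam)
    (hB : B₁ * B₂ < 1) (h0 : 0 < B₁ + B₂) (hd : 0 < d) {x₁ x₂ x₃ : ℝ} (hx : 0 < x₁)
    (h12 : x₁ < x₂) (h23 : x₂ < x₃)
    (h1 : logDisp B₁ B₂ lam d x₁ = 0) (h2 : logDisp B₁ B₂ lam d x₂ = 0)
    (h3 : logDisp B₁ B₂ lam d x₃ = 0)
    (hnonneg : ∀ x ∈ Set.Ioo 0 x₂, 0 ≤ logDisp B₁ B₂ lam d x) : False := by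
  obtain ⟨v, hv, hve⟩ := exists_oddsSlope_mul_eq_one hB₁ hB₂ hlam hx h12 (h1.trans h2.symm)
  obtain ⟨w, hw, hwe⟩ := exists_oddsSlope_mul_eq_one hB₁ hB₂ hlam (hx.trans h12) h23
    (h2.trans h3.symm)
  -- A displacement that is nonnegative around its zero x₁ has a local minimum there. So x₁ itself
  -- has slope product 1, in addition to the two points from Rolle's theorem.
  have hmin : IsLocalMin (logDisp B₁ B₂ lam d) x₁ := by
    filter_upwards [Ioo_mem_nhds hx h12] with x hx
    rw [h1]; exact hnonneg x hx
  have hue := hmin.hasDerivAt_eq_zero (hasDerivAt_logDisp hB₁ hB₂ hlam hx)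
  rw [div_eq_zero_iff] at hue
  have hue : oddsSlope B₁ B₂ d x₁ * oddsSlope B₁ B₂ d (oddsMap B₁ B₂ lam d x₁) = 1 := by
    rcases hue with h | h <;> linarith
  refine oddsSlope_mul_ne_one hB₁ hB₂ hlam hB h0 hd (z := ![x₁, v, w]) hx hv.1
    (hv.2.trans hw.1) ?_
  simp [Fin.forall_fin_succ, hue, hve, hwe]

lemma treeMap_mem_Ioo (hB₁ : 0 ≤ B₁) (hB₂ : 0 ≤ B₂) (hlam : 0 < lam) {p : ℝ}
    (hp : p ∈ Set.Ioo (0 : ℝ) 1) : treeMap B₁ B₂ lam d p ∈ Set.Ioo (0 : ℝ) 1 := by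
  have h3 : 0 < 1 - p := sub_pos.2 hp.2
  have h4 := hp.1
  have h1 : 0 < minusFactor B₁ p := by unfold minusFactor; positivity
  have h2 : 0 < plusFactor B₂ p := by unfold plusFactor; positivity
  have h := treeTotal_pos hB₁ hB₂ hlam d ⟨hp.1.le, hp.2.le⟩
  refine ⟨by unfold treeMap; positivity, ?_⟩
  rw [← sub_pos, one_sub_treeMap hB₁ hB₂ hlam d ⟨hp.1.le, hp.2.le⟩]
  positivity

lemma odds_treeMap (hB₁ : 0 ≤ B₁) (hB₂ : 0 ≤ B₂) (hlam : 0 < lam) {p : ℝ}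
    (hp : p ∈ Set.Ioo (0 : ℝ) 1) : treeMap B₁ B₂ lam d p / (1 - treeMap B₁ B₂ lam d p)
      = oddsMap B₁ B₂ lam d (p / (1 - p)) := by
  have h3 : 0 < 1 - p := sub_pos.2 hp.2
  have h4 := hp.1
  have h2 : 0 < plusFactor B₂ p := by unfold plusFactor; positivity
  have h := treeTotal_pos hB₁ hB₂ hlam d ⟨hp.1.le, hp.2.le⟩
  have he : (B₁ * (p / (1 - p)) + 1) / (p / (1 - p) + B₂) = minusFactor B₁ p / plusFactor B₂ p := by
    unfold minusFactor plusFactor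
    have : 0 < p + B₂ * (1 - p) := h2
    field_simp
  rw [one_sub_treeMap hB₁ hB₂ hlam d ⟨hp.1.le, hp.2.le⟩]
  unfold treeMap oddsMap
  rw [he, div_div_div_cancel_right₀ h.ne', div_pow, mul_div_assoc]

lemma odds_lt_odds {p q : ℝ} (hp : p < 1) (hq : q < 1) : p / (1 - p) < q / (1 - q) ↔ p < q := by
  rw [div_lt_div_iff₀ (sub_pos.2 hp) (sub_pos.2 hq)]
  constructor <;> intro h <;> nlinarith

lemma logDisp_odds (hB₁ : 0 ≤ B₁) (hB₂ : 0 ≤ B₂) (hlam : 0 < lam) {p : ℝ}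
    (hp : p ∈ Set.Ioo (0 : ℝ) 1) :
    (logDisp B₁ B₂ lam d (p / (1 - p)) < 0 ↔
      treeMap B₁ B₂ lam d (treeMap B₁ B₂ lam d p) < p) ∧
    (0 < logDisp B₁ B₂ lam d (p / (1 - p)) ↔
      p < treeMap B₁ B₂ lam d (treeMap B₁ B₂ lam d p)) := by
  have h1 := treeMap_mem_Ioo (d := d) hB₁ hB₂ hlam hp
  have h2 := treeMap_mem_Ioo (d := d) hB₁ hB₂ hlam h1
  have ho : ∀ q ∈ Set.Ioo (0 : ℝ) 1, 0 < q / (1 - q) := fun q hq =>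
    div_pos hq.1 (sub_pos.2 hq.2)
  unfold logDisp
  rw [← odds_treeMap hB₁ hB₂ hlam hp, ← odds_treeMap hB₁ hB₂ hlam h1, sub_neg, sub_pos,
    Real.log_lt_log_iff (ho _ h2) (ho _ hp), Real.log_lt_log_iff (ho _ hp) (ho _ h2),
    odds_lt_odds h2.2 hp.2, odds_lt_odds hp.2 h2.2]
  exact ⟨Iff.rfl, Iff.rfl⟩

lemma logDisp_odds_eq_zero (hB₁ : 0 ≤ B₁) (hB₂ : 0 ≤ B₂) (hlam : 0 < lam) {p : ℝ}
    (hp : p ∈ Set.Ioo (0 : ℝ) 1) :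
    logDisp B₁ B₂ lam d (p / (1 - p)) = 0 ↔
      treeMap B₁ B₂ lam d (treeMap B₁ B₂ lam d p) = p := by
  obtain ⟨h1, h2⟩ := logDisp_odds (d := d) hB₁ hB₂ hlam hp
  constructor
  · intro h
    rw [h] at h1 h2
    exact le_antisymm (not_lt.1 fun h' => lt_irrefl _ (h2.2 h'))
      (not_lt.1 fun h' => lt_irrefl _ (h1.2 h'))
  · intro h
    rw [h] at h1 h2
    exact le_antisymm (not_lt.1 fun h' => lt_irrefl _ (h2.1 h'))
      (not_lt.1 fun h' => lt_irrefl _ (h1.1 h'))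

lemma odds_div_one_add {x : ℝ} (hx : 0 < x) :
    x / (1 + x) ∈ Set.Ioo (0 : ℝ) 1 ∧ x / (1 + x) / (1 - x / (1 + x)) = x := by
  refine ⟨⟨by positivity, by rw [div_lt_one (by positivity)]; linarith⟩, ?_⟩
  field_simp
  ring

/-- The fixed points of the two-step recursion in the nondegenerate case. -/
lemma two_step_nondegenerate (hB₁ : 0 ≤ B₁) (hB₂ : 0 ≤ B₂) (hlam : 0 < lam)
    (hB : B₁ * B₂ < 1) (h0 : 0 < B₁ + B₂) (hd : 0 < d) {a s b : ℝ}
    (ha : 0 ≤ a) (hb : b ≤ 1) (has : a < s) (hsb : s < b)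
    (hTs : treeMap B₁ B₂ lam d s = s) (hTa : treeMap B₁ B₂ lam d a = b)
    (hTb : treeMap B₁ B₂ lam d b = a)
    (hext : ∀ p ∈ Set.Icc (0 : ℝ) 1, treeMap B₁ B₂ lam d (treeMap B₁ B₂ lam d p) = p →
      p ∈ Set.Icc a b) :
    (∀ p ∈ Set.Icc (0 : ℝ) 1, treeMap B₁ B₂ lam d (treeMap B₁ B₂ lam d p) = p →
      p = a ∨ p = s ∨ p = b) ∧
    ∀ p ∈ Set.Ioo a s, treeMap B₁ B₂ lam d (treeMap B₁ B₂ lam d p) < p := by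
  have haI : a ∈ Set.Icc (0 : ℝ) 1 := ⟨ha, by linarith⟩
  have hbI : b ∈ Set.Icc (0 : ℝ) 1 := ⟨by linarith, hb⟩
  have hdne : d ≠ 0 := hd.ne'
  -- Passing to odds requires 0 < a and b < 1. Either equality would force the cycle to be {0, 1},
  -- which happens only for B₁ = B₂ = 0.
  have hends : ¬ (a = 0 ∧ b = 1) := by
    rintro ⟨rfl, rfl⟩
    have h1 : B₁ = 0 := by
      have := hTb
      unfold treeMap at this
      rw [div_eq_zero_iff] at this
      rcases this with h | h
      · simpa [minusFactor, hlam.ne', hdne] using h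
      · exact absurd h (treeTotal_pos hB₁ hB₂ hlam d hbI).ne'
    have h2 : B₂ = 0 := by
      have := one_sub_treeMap hB₁ hB₂ hlam d haI
      rw [hTa, sub_self, eq_comm, div_eq_zero_iff] at this
      rcases this with h | h
      · simpa [plusFactor, hdne] using h
      · exact absurd h (treeTotal_pos hB₁ hB₂ hlam d haI).ne'
    linarith
  have ha0 : 0 < a := by
    refine lt_of_le_of_ne ha fun h => hends ⟨h.symm, ?_⟩
    have := hTb
    unfold treeMap at this
    rw [← h, div_eq_zero_iff] at this
    rcases this with h | h
    · have h' : minusFactor B₁ b = 0 := by simpa [hlam.ne', hdne] using h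
      unfold minusFactor at h'
      have := mul_nonneg hB₁ hbI.1
      linarith
    · exact absurd h (treeTotal_pos hB₁ hB₂ hlam d hbI).ne'
  have hb1 : b < 1 := by
    refine lt_of_le_of_ne hb fun h => ?_
    have := one_sub_treeMap hB₁ hB₂ hlam d haI
    rw [hTa, h, sub_self, eq_comm, div_eq_zero_iff] at this
    rcases this with h | h
    · have h' : plusFactor B₂ a = 0 := by simpa [hdne] using h
      unfold plusFactor at h'
      have := mul_nonneg hB₂ (sub_nonneg.2 haI.2)
      linarith
    · exact absurd h (treeTotal_pos hB₁ hB₂ hlam d haI).ne'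
  have haO : a ∈ Set.Ioo (0 : ℝ) 1 := ⟨ha0, by linarith⟩
  have hsO : s ∈ Set.Ioo (0 : ℝ) 1 := ⟨by linarith, by linarith⟩
  have hbO : b ∈ Set.Ioo (0 : ℝ) 1 := ⟨by linarith, hb1⟩
  have hkz : ∀ p ∈ Set.Ioo (0 : ℝ) 1, treeMap B₁ B₂ lam d (treeMap B₁ B₂ lam d p) = p →
      logDisp B₁ B₂ lam d (p / (1 - p)) = 0 := fun p hp h =>
    (logDisp_odds_eq_zero hB₁ hB₂ hlam hp).2 h
  have hka := hkz a haO (by rw [hTa, hTb])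
  have hks := hkz s hsO (by rw [hTs, hTs])
  have hkb := hkz b hbO (by rw [hTb, hTa])
  have ho : ∀ q ∈ Set.Ioo (0 : ℝ) 1, 0 < q / (1 - q) := fun q hq =>
    div_pos hq.1 (sub_pos.2 hq.2)
  have hfix : ∀ p ∈ Set.Icc (0 : ℝ) 1, treeMap B₁ B₂ lam d (treeMap B₁ B₂ lam d p) = p →
      p = a ∨ p = s ∨ p = b := by
    intro p hp hTp
    by_contra! hne
    obtain ⟨h1, h2⟩ := hext p hp hTp
    have h1 : a < p := lt_of_le_of_ne h1 hne.1.symm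
    have h2 : p < b := lt_of_le_of_ne h2 hne.2.2
    have hpO : p ∈ Set.Ioo (0 : ℝ) 1 := ⟨by linarith, by linarith⟩
    have hkp := hkz p hpO hTp
    rcases lt_or_gt_of_ne hne.2.1 with h | h
    · exact not_four_zeros_logDisp hB₁ hB₂ hlam hB h0 hd (ho a haO)
        ((odds_lt_odds haO.2 hpO.2).2 h1) ((odds_lt_odds hpO.2 hsO.2).2 h)
        ((odds_lt_odds hsO.2 hbO.2).2 hsb) hka hkp hks hkb
    · exact not_four_zeros_logDisp hB₁ hB₂ hlam hB h0 hd (ho a haO)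
        ((odds_lt_odds haO.2 hsO.2).2 has) ((odds_lt_odds hsO.2 hpO.2).2 h)
        ((odds_lt_odds hpO.2 hbO.2).2 h2) hka hks hkp hkb
  refine ⟨hfix, fun p hp => ?_⟩
  have hTTc : ContinuousOn (fun p => treeMap B₁ B₂ lam d (treeMap B₁ B₂ lam d p) - p)
      (Set.Icc 0 1) :=
    ((continuousOn_treeMap hB₁ hB₂ hlam d).comp (continuousOn_treeMap hB₁ hB₂ hlam d)
      fun q hq => treeMap_mem_Icc hB₁ hB₂ hlam d hq).sub continuousOn_id
  -- If one p in (a, s) does not move left, then the displacement is nonnegative at every point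
  -- below s. Indeed, a negative value below a gives a fixed point below a, and one in (a, s) gives
  -- a fixed point between it and p. This contradicts `not_semistable_logDisp`.
  by_contra! hle
  refine not_semistable_logDisp hB₁ hB₂ hlam hB h0 hd (ho a haO)
    ((odds_lt_odds haO.2 hsO.2).2 has) ((odds_lt_odds hsO.2 hbO.2).2 hsb) hka hks hkb ?_
  intro x hx
  obtain ⟨hq, hqx⟩ := odds_div_one_add hx.1
  set q := x / (1 + x) with hqdef
  rw [← hqx] at hx ⊢
  have hqs : q < s := (odds_lt_odds hq.2 hsO.2).1 hx.2
  by_contra! hneg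
  have hTq := (logDisp_odds hB₁ hB₂ hlam hq).1.1 hneg
  rcases lt_trichotomy q a with hqa | hqa | hqa
  · obtain ⟨r, hr, hr0⟩ := intermediate_value_Icc' hq.1.le
      (hTTc.mono (Set.Icc_subset_Icc le_rfl hq.2.le))
      (show (0 : ℝ) ∈ Set.Icc _ _ from ⟨by simpa using hTq.le, by
        simpa using (treeMap_mem_Icc hB₁ hB₂ hlam d
          (treeMap_mem_Icc hB₁ hB₂ hlam d (p := 0) (by simp))).1⟩)
    have := (hext r ⟨hr.1, hr.2.trans hq.2.le⟩ (sub_eq_zero.1 hr0)).1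
    linarith [hr.2]
  · rw [hqa, hTa, hTb] at hTq
    exact lt_irrefl _ hTq
  · have h0mem : (0 : ℝ) ∈ Set.uIcc (treeMap B₁ B₂ lam d (treeMap B₁ B₂ lam d p) - p)
        (treeMap B₁ B₂ lam d (treeMap B₁ B₂ lam d q) - q) :=
      Set.mem_uIcc.2 (Or.inr ⟨by linarith, by linarith⟩)
    have hsub : Set.uIcc p q ⊆ Set.Ioo a s := (convex_Ioo a s).ordConnected.uIcc_subset hp ⟨hqa, hqs⟩
    obtain ⟨r, hr, hr0⟩ := intermediate_value_uIcc
      (hTTc.mono (hsub.trans (Set.Ioo_subset_Icc_self.trans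
        (Set.Icc_subset_Icc ha hsO.2.le)))) h0mem
    have hr' := hsub hr
    rcases hfix r ⟨by linarith [hr'.1], by linarith [hr'.2, hsO.2]⟩ (sub_eq_zero.1 hr0)
      with h | h | h
    · linarith [hr'.1]
    · linarith [hr'.2]
    · linarith [hr'.2]

/-- The fixed points of the two-step recursion in the case of two hard constraints. -/
lemma two_step_degenerate (hlam : 0 < lam) (hd : 2 ≤ d) {a s b : ℝ}
    (ha : 0 ≤ a) (hb : b ≤ 1) (has : a < s) (hsb : s < b)
    (hTs : treeMap 0 0 lam d s = s)
    (hext : ∀ p ∈ Set.Icc (0 : ℝ) 1, treeMap 0 0 lam d (treeMap 0 0 lam d p) = p →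
      p ∈ Set.Icc a b) :
    (∀ p ∈ Set.Icc (0 : ℝ) 1, treeMap 0 0 lam d (treeMap 0 0 lam d p) = p →
      p = a ∨ p = s ∨ p = b) ∧
    ∀ p ∈ Set.Ioo a s, treeMap 0 0 lam d (treeMap 0 0 lam d p) < p := by
  have hdne : d ≠ 0 := by omega
  have hT0 : treeMap 0 0 lam d 0 = 1 := by
    simp [treeMap, treeTotal, minusFactor, plusFactor, hdne, hlam.ne']
  have hT1 : treeMap 0 0 lam d 1 = 0 := by
    simp [treeMap, treeTotal, minusFactor, plusFactor, hdne]
  have ha0 : a = 0 := le_antisymm (hext 0 (by simp) (by rw [hT0, hT1])).1 ha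
  have hb1 : b = 1 := le_antisymm hb (hext 1 (by simp) (by rw [hT1, hT0])).2
  subst ha0 hb1
  have hsO : s ∈ Set.Ioo (0 : ℝ) 1 := ⟨has, hsb⟩
  -- Here the slope is constantly d, so the displacement has derivative (d² - 1)/x, positive because
  -- d ≥ 2. It therefore vanishes only at the odds of s.
  have hmono : StrictMonoOn (logDisp 0 0 lam d) (Set.Ioi 0) := by
    refine strictMonoOn_of_deriv_pos (convex_Ioi 0)
      (fun x hx => (hasDerivAt_logDisp le_rfl le_rfl hlam hx).continuousAt.continuousWithinAt)
      fun x hx => ?_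
    rw [interior_Ioi] at hx
    have hx : 0 < x := hx
    rw [(hasDerivAt_logDisp le_rfl le_rfl hlam hx).deriv]
    have hsl : ∀ y : ℝ, 0 < y → oddsSlope 0 0 d y = d := by
      intro y hy; unfold oddsSlope; field_simp; ring
    rw [hsl x hx, hsl _ (oddsMap_pos le_rfl le_rfl hlam hx)]
    have hd' : (2 : ℝ) ≤ d := by exact_mod_cast hd
    have : 0 < (d : ℝ) * d - 1 := by nlinarith
    positivity
  have hks := (logDisp_odds_eq_zero le_rfl le_rfl hlam hsO).2 (by rw [hTs, hTs])
  have ho : ∀ q ∈ Set.Ioo (0 : ℝ) 1, q / (1 - q) ∈ Set.Ioi (0 : ℝ) := fun q hq =>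
    div_pos hq.1 (sub_pos.2 hq.2)
  have hlt : ∀ p ∈ Set.Ioo (0 : ℝ) s, treeMap 0 0 lam d (treeMap 0 0 lam d p) < p := by
    intro p hp
    have hpO : p ∈ Set.Ioo (0 : ℝ) 1 := ⟨hp.1, hp.2.trans hsO.2⟩
    exact (logDisp_odds le_rfl le_rfl hlam hpO).1.1
      ((hmono (ho p hpO) (ho s hsO) ((odds_lt_odds hpO.2 hsO.2).2 hp.2)).trans_eq hks)
  refine ⟨fun p hp hTp => ?_, hlt⟩
  by_contra! hne
  have hpO : p ∈ Set.Ioo (0 : ℝ) 1 :=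
    ⟨lt_of_le_of_ne hp.1 hne.1.symm, lt_of_le_of_ne hp.2 hne.2.2⟩
  have hkp := (logDisp_odds_eq_zero le_rfl le_rfl hlam hpO).2 hTp
  have := hmono.injOn (ho p hpO) (ho s hsO) (hkp.trans hks.symm)
  rcases lt_or_gt_of_ne hne.2.1 with h | h
  · exact absurd this ((odds_lt_odds hpO.2 hsO.2).2 h).ne
  · exact absurd this ((odds_lt_odds hsO.2 hpO.2).2 h).ne'

/-- The case B₁ = B₂ = 0 is separate: the cycle is then {0, 1}, where the odds degenerate, and
`oddsCurv` vanishes identically, so the strict monotonicity behind the Rolle argument is lost. -/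
lemma two_step_fixed_points (hB₁ : 0 ≤ B₁) (hB₂ : 0 ≤ B₂) (hlam : 0 < lam)
    (hB : B₁ * B₂ < 1) (hd : 2 ≤ d) {a s b : ℝ}
    (ha : 0 ≤ a) (hb : b ≤ 1) (has : a < s) (hsb : s < b)
    (hTs : treeMap B₁ B₂ lam d s = s) (hTa : treeMap B₁ B₂ lam d a = b)
    (hTb : treeMap B₁ B₂ lam d b = a)
    (hext : ∀ p ∈ Set.Icc (0 : ℝ) 1, treeMap B₁ B₂ lam d (treeMap B₁ B₂ lam d p) = p →
      p ∈ Set.Icc a b) :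
    (∀ p ∈ Set.Icc (0 : ℝ) 1, treeMap B₁ B₂ lam d (treeMap B₁ B₂ lam d p) = p →
      p = a ∨ p = s ∨ p = b) ∧
    ∀ p ∈ Set.Ioo a s, treeMap B₁ B₂ lam d (treeMap B₁ B₂ lam d p) < p := by
  rcases (add_nonneg hB₁ hB₂).eq_or_lt with h0 | h0
  · obtain rfl : B₁ = 0 := by linarith
    obtain rfl : B₂ = 0 := by linarith
    exact two_step_degenerate hlam hd ha hb has hsb hTs hext
  · exact two_step_nondegenerate hB₁ hB₂ hlam hB h0 (by omega) ha hb has hsb hTs hTa hTb hext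

end TwoStep

/-! ### The first moment as an explicit sum. -/

section FirstMoment

variable {B₁ B₂ lam : ℝ} {Δ n : ℕ}

/-- The factor contributed to the weight by an edge. -/
def edgeFactor (B₁ B₂ : ℝ) (s t : Spin) : ℝ :=
  if s = true ∧ t = true then B₁ else if s = false ∧ t = false then B₂ else 1

/-- The factor contributed to the weight by a vertex. -/
def vertexFactor (lam : ℝ) (s : Spin) : ℝ := if s = true then lam else 1

lemma weight_eq_prod {V E : Type*} [Fintype V] [Fintype E] (ends : E → V × V) (σ : V → Spin) :
    weight B₁ B₂ lam ends σ
      = (∏ v, vertexFactor lam (σ v)) * ∏ e, edgeFactor B₁ B₂ (σ (ends e).1) (σ (ends e).2) := by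
  have h : ∀ s t : Spin, edgeFactor B₁ B₂ s t
      = (if s = true ∧ t = true then B₁ else 1) * if s = false ∧ t = false then B₂ else 1 := by
    intro s t; cases s <;> cases t <;> simp [edgeFactor]
  simp only [weight, h, vertexFactor, Finset.prod_mul_distrib, Finset.prod_ite, Finset.prod_const,
    one_pow, mul_one, mul_assoc]

/-- The number of vertices of spin `-1`. -/
def minusCount {V : Type*} [Fintype V] (x : V → Spin) : ℕ :=
  (Finset.univ.filter fun i => x i = true).card

lemma prod_vertexFactor {V : Type*} [Fintype V] (x : V → Spin) :
    ∏ v, vertexFactor lam (x v) = lam ^ minusCount x := by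
  simp only [vertexFactor, Finset.prod_ite, Finset.prod_const, one_pow, mul_one, minusCount]

/-- The sum over all placements of `b` spins `-1` opposite to `a` given ones among `n`. -/
def overlapSum (B₁ B₂ : ℝ) (n a b : ℕ) : ℝ :=
  ∑ m ∈ Finset.range (b + 1),
    (a.choose m : ℝ) * ((n - a).choose (b - m) : ℝ) * (B₁ ^ m * B₂ ^ (n - a - (b - m)))

open Polynomial in
-- The exponent of X records the number of spins -1, so fixing that number extracts a coefficient of
-- a product over the vertices.
lemma sum_prod_eq_coeff (f : Fin n → Spin → ℝ) (b : ℕ) :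
    ∑ y : Fin n → Spin with minusCount y = b, ∏ i, f i (y i)
      = (∏ i, (C (f i true) * X + C (f i false)) : ℝ[X]).coeff b := by
  have h : (∏ i, (C (f i true) * X + C (f i false)) : ℝ[X])
      = ∑ y : Fin n → Spin, C (∏ i, f i (y i)) * X ^ minusCount y := by
    have h1 : ∀ i, (C (f i true) * X + C (f i false) : ℝ[X])
        = ∑ s : Spin, C (f i s) * (if s = true then X else 1) := by
      intro i; simp
    simp only [h1]
    rw [Finset.prod_univ_sum, Fintype.piFinset_univ]
    refine Finset.sum_congr rfl fun y _ => ?_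
    rw [Finset.prod_mul_distrib, map_prod, Finset.prod_ite, Finset.prod_const,
      Finset.prod_const_one, mul_one, minusCount]
  rw [h, finsetSum_coeff, Finset.sum_filter]
  refine Finset.sum_congr rfl fun y _ => ?_
  rw [coeff_C_mul_X_pow]
  simp only [eq_comm]

lemma card_minusCount (a : ℕ) :
    (Finset.univ.filter fun x : Fin n → Spin => minusCount x = a).card = n.choose a := by
  have h := sum_prod_eq_coeff (n := n) (fun _ _ => 1) a
  simp only [Finset.prod_const_one, Finset.sum_const, nsmul_eq_mul, mul_one, map_one, one_mul,
    Finset.prod_const, Finset.card_univ, Fintype.card_fin, Polynomial.coeff_X_add_one_pow] at h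
  exact_mod_cast h

open Polynomial in
-- Vertices opposite to a spin -1 contribute B₁X + 1 and the others X + B₂. The index m of the
-- convolution counts the edges with both ends of spin -1.
lemma sum_prod_edgeFactor (x : Fin n → Spin) (b : ℕ) :
    ∑ y : Fin n → Spin with minusCount y = b, ∏ i, edgeFactor B₁ B₂ (x i) (y i)
      = overlapSum B₁ B₂ n (minusCount x) b := by
  rw [sum_prod_eq_coeff]
  have hcompl : (Finset.univ.filter fun i => ¬ x i = true).card = n - minusCount x := by
    rw [Finset.filter_not, Finset.card_sdiff_of_subset (Finset.filter_subset _ _),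
      Finset.card_univ, Fintype.card_fin, minusCount]
  have h1 : (∏ i, (C (edgeFactor B₁ B₂ (x i) true) * X + C (edgeFactor B₁ B₂ (x i) false)) : ℝ[X])
      = (C B₁ * X + 1) ^ minusCount x * (X + C B₂) ^ (n - minusCount x) := by
    have h2 : ∀ i, (C (edgeFactor B₁ B₂ (x i) true) * X + C (edgeFactor B₁ B₂ (x i) false) : ℝ[X])
        = if x i = true then C B₁ * X + 1 else X + C B₂ := by
      intro i; cases x i <;> simp [edgeFactor]
    simp only [h2]
    rw [Finset.prod_ite, Finset.prod_const, Finset.prod_const, hcompl, minusCount]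
  have h3 : ∀ a m : ℕ, ((C B₁ * X + 1) ^ a : ℝ[X]).coeff m = B₁ ^ m * a.choose m := by
    intro a m
    have : ((C B₁ * X + 1) ^ a : ℝ[X]) = ((X + 1) ^ a : ℝ[X]).comp (C B₁ * X) := by simp
    rw [this, comp_C_mul_X_coeff, coeff_X_add_one_pow, mul_comm]
  rw [h1, coeff_mul, Finset.Nat.sum_antidiagonal_eq_sum_range_succ_mk, overlapSum]
  refine Finset.sum_congr rfl fun m _ => ?_
  rw [h3, coeff_X_add_C_pow]
  ring

lemma exists_perm_of_minusCount_eq {y y' : Fin n → Spin} (h : minusCount y = minusCount y') :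
    ∃ τ : Equiv.Perm (Fin n), y' ∘ τ = y := by
  have h1 : Fintype.card {i // y i = true} = Fintype.card {i // y' i = true} := by
    rw [Fintype.card_subtype, Fintype.card_subtype]; exact h
  have h2 : Fintype.card {i // ¬ y i = true} = Fintype.card {i // ¬ y' i = true} := by
    rw [Fintype.card_subtype_compl, Fintype.card_subtype_compl, h1]
  refine ⟨Equiv.subtypeCongr (Fintype.equivOfCardEq h1) (Fintype.equivOfCardEq h2), ?_⟩
  funext i
  by_cases hi : y i = true
  · simpa [Equiv.subtypeCongr, hi] using (Fintype.equivOfCardEq h1 ⟨i, hi⟩).2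
  · simpa [Equiv.subtypeCongr, hi] using (Fintype.equivOfCardEq h2 ⟨i, hi⟩).2

/-- The sum over all perfect matchings. -/
def matchingSum (B₁ B₂ : ℝ) (x y : Fin n → Spin) : ℝ :=
  ∑ π : Equiv.Perm (Fin n), ∏ i, edgeFactor B₁ B₂ (x i) (y (π i))

lemma minusCount_comp_perm (y : Fin n → Spin) (τ : Equiv.Perm (Fin n)) :
    minusCount (y ∘ τ) = minusCount y := by
  unfold minusCount
  exact Finset.card_equiv τ (by simp)

lemma matchingSum_comp_perm (x y : Fin n → Spin) (τ : Equiv.Perm (Fin n)) :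
    matchingSum B₁ B₂ x (y ∘ τ) = matchingSum B₁ B₂ x y := by
  unfold matchingSum
  exact Fintype.sum_equiv (Equiv.mulLeft τ) _ _ fun π => by simp

/-- Double counting of pairs formed by a matching and a configuration y' with as many spins -1 as y.
The sum over matchings does not depend on y', and for a fixed matching the sum over y' becomes
`overlapSum` after relabelling. -/
lemma choose_mul_matchingSum (x y : Fin n → Spin) :
    (n.choose (minusCount y) : ℝ) * matchingSum B₁ B₂ x y
      = n.factorial * overlapSum B₁ B₂ n (minusCount x) (minusCount y) := by
  have h1 : ∑ y' : Fin n → Spin with minusCount y' = minusCount y, matchingSum B₁ B₂ x y'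
      = n.choose (minusCount y) * matchingSum B₁ B₂ x y := by
    rw [← card_minusCount, ← nsmul_eq_mul]
    refine Finset.sum_eq_card_nsmul fun y' hy' => ?_
    obtain ⟨τ, rfl⟩ := exists_perm_of_minusCount_eq (Finset.mem_filter.1 hy').2
    exact matchingSum_comp_perm x y τ
  have h2 : ∑ y' : Fin n → Spin with minusCount y' = minusCount y, matchingSum B₁ B₂ x y'
      = n.factorial * overlapSum B₁ B₂ n (minusCount x) (minusCount y) := by
    unfold matchingSum
    rw [Finset.sum_comm]
    have h3 : ∀ π : Equiv.Perm (Fin n),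
        ∑ y' : Fin n → Spin with minusCount y' = minusCount y,
          ∏ i, edgeFactor B₁ B₂ (x i) (y' (π i))
        = overlapSum B₁ B₂ n (minusCount x) (minusCount y) := by
      intro π
      rw [← sum_prod_edgeFactor]
      refine Finset.sum_equiv (Equiv.arrowCongr π.symm (Equiv.refl _)) (fun y' => ?_)
        fun y' _ => ?_
      · have : Equiv.arrowCongr π.symm (Equiv.refl Spin) y' = y' ∘ π := rfl
        simp only [Finset.mem_filter, Finset.mem_univ, true_and, this, minusCount_comp_perm]
      · rfl
    simp only [h3]
    rw [Finset.sum_const, Finset.card_univ, Fintype.card_perm, Fintype.card_fin, nsmul_eq_mul]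
  rw [← h1, h2]

/-- The edge weight factorises over the Δ matchings, which range independently, so the sum over
tuples is a Δ-th power. -/
lemma sum_weight_matchingEnds (σ : Fin n ⊕ Fin n → Spin) :
    ∑ M : Fin Δ → Equiv.Perm (Fin n), weight B₁ B₂ lam (matchingEnds M) σ
      = lam ^ (minusCount (σ ∘ Sum.inl) + minusCount (σ ∘ Sum.inr))
        * matchingSum B₁ B₂ (σ ∘ Sum.inl) (σ ∘ Sum.inr) ^ Δ := by
  unfold matchingSum
  rw [Fintype.sum_pow, Finset.mul_sum]
  refine Finset.sum_congr rfl fun M _ => ?_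
  rw [weight_eq_prod, Fintype.prod_sum_type, pow_add, ← prod_vertexFactor, ← prod_vertexFactor,
    Fintype.prod_prod_type]
  rfl

lemma sum_restrictedZ (a b : ℕ) :
    ∑ M : Fin Δ → Equiv.Perm (Fin n), restrictedZ B₁ B₂ lam M a b
      = n.choose a * n.choose b * lam ^ (a + b) *
        (n.factorial * overlapSum B₁ B₂ n a b / n.choose b) ^ Δ := by
  unfold restrictedZ
  rw [Finset.sum_comm]
  have h : ∀ σ ∈ Finset.univ.filter (fun σ : Fin n ⊕ Fin n → Spin =>
      (Finset.univ.filter fun i => σ (Sum.inl i) = true).card = a ∧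
      (Finset.univ.filter fun j => σ (Sum.inr j) = true).card = b),
      ∑ M : Fin Δ → Equiv.Perm (Fin n), weight B₁ B₂ lam (matchingEnds M) σ
        = lam ^ (a + b) * (n.factorial * overlapSum B₁ B₂ n a b / n.choose b) ^ Δ := by
    intro σ hσ
    obtain ⟨ha, hb⟩ := (Finset.mem_filter.1 hσ).2
    have ha' : minusCount (σ ∘ Sum.inl) = a := ha
    have hb' : minusCount (σ ∘ Sum.inr) = b := hb
    have hbn : b ≤ n := by
      rw [← hb]; exact (Finset.card_le_univ _).trans (by simp)
    have hc : (n.choose b : ℝ) ≠ 0 := by exact_mod_cast (Nat.choose_pos hbn).ne'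
    have := choose_mul_matchingSum (B₁ := B₁) (B₂ := B₂) (σ ∘ Sum.inl) (σ ∘ Sum.inr)
    rw [ha', hb'] at this
    rw [sum_weight_matchingEnds, ha', hb', ← this, mul_div_cancel_left₀ _ hc]
  rw [Finset.sum_congr rfl h, Finset.sum_const, nsmul_eq_mul, ← mul_assoc]
  congr 2
  rw [← Nat.cast_mul, ← card_minusCount (n := n) a, ← card_minusCount (n := n) b,
    ← Finset.card_product]
  congr 1
  refine Finset.card_equiv (Equiv.sumArrowEquivProdArrow _ _ _) fun σ => ?_
  simp only [Finset.mem_filter, Finset.mem_univ, true_and, Finset.mem_product]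
  rfl

lemma expectedZ_eq (a b : ℕ) :
    expectedZ Δ B₁ B₂ lam n a b = n.choose a * n.choose b * lam ^ (a + b) *
      (overlapSum B₁ B₂ n a b / n.choose b) ^ Δ := by
  unfold expectedZ
  rw [sum_restrictedZ, Fintype.card_fun, Fintype.card_perm, Fintype.card_fin, Fintype.card_fin,
    mul_div_assoc (n.factorial : ℝ), mul_pow]
  have : ((n.factorial : ℝ)) ^ Δ ≠ 0 := by positivity
  push_cast
  field_simp

end FirstMoment

/-! ### Stirling asymptotics of binomial coefficients. -/

section Asymptotics

variable {ι : Type*} {l : Filter ι} {N : ι → ℕ}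

lemma tendsto_log_add_one_div (hN : Tendsto N l atTop) :
    Tendsto (fun i => Real.log ((N i : ℝ) + 1) / (N i : ℝ)) l (𝓝 0) := by
  have h := (Real.tendsto_pow_log_div_mul_add_atTop 1 (-1) 1 one_ne_zero).comp
    (tendsto_atTop_add_const_right l (1 : ℝ) (tendsto_natCast_atTop_atTop.comp hN))
  refine h.congr fun i => ?_
  simp

/-- For k ≥ 1 the Stirling sequence is at most its value at 1. The crude error log (k + 1) + 1 also
covers k = 0 and is negligible on the scale of n. -/
lemma log_factorial_le (k : ℕ) :
    Real.log k.factorial ≤ k * Real.log k - k + (Real.log (k + 1) + 1) := by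
  rcases Nat.eq_zero_or_pos k with rfl | hk
  · simp
  · have h1 : Real.log (Stirling.stirlingSeq k) ≤ Real.log (Stirling.stirlingSeq 1) := by
      obtain ⟨j, rfl⟩ : ∃ j, k = j + 1 := ⟨k - 1, by omega⟩
      exact Stirling.log_stirlingSeq'_antitone (Nat.zero_le j)
    rw [Stirling.log_stirlingSeq_formula, Stirling.log_stirlingSeq_formula] at h1
    have hk' : (1 : ℝ) ≤ k := by exact_mod_cast hk
    rw [Real.log_mul two_ne_zero (by positivity), Real.log_div (by positivity) (Real.exp_ne_zero 1),
      Real.log_exp] at h1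
    simp only [Nat.factorial_one, Nat.cast_one, Real.log_one, mul_one, one_div, Real.log_inv,
      Real.log_exp] at h1
    have h2 : 0 ≤ Real.log k := Real.log_nonneg hk'
    have h3 : Real.log k ≤ Real.log (k + 1) := Real.log_le_log (by positivity) (by linarith)
    linarith

lemma le_log_factorial (k : ℕ) : k * Real.log k - k ≤ Real.log k.factorial := by
  rcases Nat.eq_zero_or_pos k with rfl | hk
  · simp
  · have h := Stirling.le_log_factorial_stirling hk.ne'
    have h1 : 0 ≤ Real.log k := Real.log_nonneg (by exact_mod_cast hk)
    have h2 : 0 ≤ Real.log (2 * Real.pi) := Real.log_nonneg (by linarith [Real.pi_gt_three])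
    linarith

/-- The function `x ↦ x log x`. -/
noncomputable def xlog (x : ℝ) : ℝ := x * Real.log x

lemma continuous_xlog : Continuous xlog := Real.continuous_mul_log

/-- Comparing k with the scale N keeps the limit valid for κ = 0, where x log x is still continuous.
-/
lemma tendsto_log_factorial {k : ι → ℕ} {κ : ℝ} (hN : Tendsto N l atTop)
    (hkN : ∀ᶠ i in l, k i ≤ N i) (hk : Tendsto (fun i => (k i : ℝ) / N i) l (𝓝 κ)) :
    Tendsto (fun i => (Real.log (k i).factorial - k i * Real.log (N i)) / N i) l
      (𝓝 (xlog κ - κ)) := by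
  have h1 : Tendsto (fun i => xlog ((k i : ℝ) / N i) - (k i : ℝ) / N i) l (𝓝 (xlog κ - κ)) :=
    ((continuous_xlog.tendsto κ).comp hk).sub hk
  have h2 : Tendsto (fun i => Real.log ((N i : ℝ) + 1) / (N i : ℝ) + 1 / (N i : ℝ)) l (𝓝 0) := by
    have := (tendsto_one_div_atTop_nhds_zero_nat (𝕜 := ℝ)).comp hN
    simpa using (tendsto_log_add_one_div hN).add this
  have h3 := h1.add h2
  rw [add_zero] at h3
  have hx : ∀ᶠ i in l, xlog ((k i : ℝ) / N i)
      = (k i * Real.log (k i) - k i * Real.log (N i)) / N i := by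
    filter_upwards [hN.eventually_gt_atTop 0] with i hi
    have hi' : (N i : ℝ) ≠ 0 := by exact_mod_cast hi.ne'
    unfold xlog
    rcases Nat.eq_zero_or_pos (k i) with h | h
    · simp [h]
    · rw [Real.log_div (by exact_mod_cast h.ne') hi']
      ring
  refine tendsto_of_tendsto_of_tendsto_of_le_of_le' h1 h3 ?_ ?_
  · filter_upwards [hx] with i hx
    rw [hx, ← sub_div]
    have := le_log_factorial (k i)
    exact div_le_div_of_nonneg_right (by linarith) (by positivity)
  · filter_upwards [hx, hkN] with i hx hki
    rw [hx, ← sub_div, ← add_div, ← add_div]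
    have h4 := log_factorial_le (k i)
    have h5 : Real.log ((k i : ℝ) + 1) ≤ Real.log ((N i : ℝ) + 1) := by
      have : (k i : ℝ) ≤ N i := by exact_mod_cast hki
      exact Real.log_le_log (by positivity) (by linarith)
    exact div_le_div_of_nonneg_right (by linarith) (by positivity)

lemma tendsto_log_choose {M k : ι → ℕ} {μ κ : ℝ} (hN : Tendsto N l atTop)
    (hMN : ∀ᶠ i in l, M i ≤ N i) (hkM : ∀ᶠ i in l, k i ≤ M i)
    (hM : Tendsto (fun i => (M i : ℝ) / N i) l (𝓝 μ))
    (hk : Tendsto (fun i => (k i : ℝ) / N i) l (𝓝 κ)) :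
    Tendsto (fun i => Real.log ((M i).choose (k i)) / N i) l
      (𝓝 (xlog μ - xlog κ - xlog (μ - κ))) := by
  have hsub : Tendsto (fun i => ((M i - k i : ℕ) : ℝ) / N i) l (𝓝 (μ - κ)) := by
    refine (hM.sub hk).congr' ?_
    filter_upwards [hkM] with i hi
    rw [Nat.cast_sub hi, sub_div]
  have h := ((tendsto_log_factorial hN hMN hM).sub (tendsto_log_factorial hN
    (hMN.and hkM |>.mono fun i hi => hi.2.trans hi.1) hk)).sub (tendsto_log_factorial hN
    (hMN.mono fun i hi => (Nat.sub_le _ _).trans hi) hsub)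
  have he : xlog μ - μ - (xlog κ - κ) - (xlog (μ - κ) - (μ - κ))
      = xlog μ - xlog κ - xlog (μ - κ) := by ring
  rw [he] at h
  refine h.congr' ?_
  filter_upwards [hkM] with i hi
  rw [Nat.choose_eq_factorial_div_factorial hi, Nat.cast_div (Nat.factorial_mul_factorial_dvd_factorial hi)
    (by positivity), Nat.cast_mul, Real.log_div (by positivity) (by positivity),
    Real.log_mul (by positivity) (by positivity), Nat.cast_sub hi]
  ring

end Asymptotics

/-! ### The limit of the first moment. -/

section Rate

variable {B₁ B₂ lam : ℝ} {Δ : ℕ}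

/-- The binary entropy, as the limit of binomial coefficients. -/
noncomputable def entropyFn (α : ℝ) : ℝ := -xlog α - xlog (1 - α)

/-- The contribution to `(1 / n) * log E[Z]` of the configurations in which a matching has `γ n`
edges with both endpoints of spin `-1`. -/
noncomputable def rateFn (Δ : ℕ) (B₁ B₂ lam α β γ : ℝ) : ℝ :=
  entropyFn α + entropyFn β + (α + β) * Real.log lam
    + Δ * ((xlog α - xlog γ - xlog (α - γ))
        + (xlog (1 - α) - xlog (β - γ) - xlog (1 - α - (β - γ)))
        + (γ * Real.log B₁ + (1 - α - (β - γ)) * Real.log B₂) - entropyFn β)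

/-- The admissible fractions of edges with both endpoints of spin `-1`. -/
def feasible (B₁ B₂ α β : ℝ) : Set ℝ :=
  {γ | 0 ≤ γ ∧ γ ≤ α ∧ γ ≤ β ∧ 0 ≤ 1 - α - (β - γ) ∧ (B₁ = 0 → γ = 0) ∧
    (B₂ = 0 → 1 - α - (β - γ) = 0)}

/-- The first moment rate. -/
noncomputable def firstMomentRate (Δ : ℕ) (B₁ B₂ lam : ℝ) (x : ℝ × ℝ) : EReal :=
  ⨆ γ ∈ feasible B₁ B₂ x.1 x.2, ((rateFn Δ B₁ B₂ lam x.1 x.2 γ : ℝ) : EReal)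

/-- A term of `overlapSum`. -/
def overlapTerm (B₁ B₂ : ℝ) (n a b m : ℕ) : ℝ :=
  (a.choose m : ℝ) * ((n - a).choose (b - m) : ℝ) * (B₁ ^ m * B₂ ^ (n - a - (b - m)))

/-- The indices of the positive terms of `overlapSum`. -/
def Admissible (B₁ B₂ : ℝ) (n a b m : ℕ) : Prop :=
  m ≤ a ∧ m ≤ b ∧ b - m ≤ n - a ∧ (B₁ = 0 → m = 0) ∧ (B₂ = 0 → n - a - (b - m) = 0)

/-- `expectedZ` with a single term of `overlapSum`. -/
noncomputable def singleZ (Δ : ℕ) (B₁ B₂ lam : ℝ) (n a b m : ℕ) : ℝ :=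
  n.choose a * n.choose b * lam ^ (a + b) * (overlapTerm B₁ B₂ n a b m / n.choose b) ^ Δ

lemma overlapTerm_nonneg (hB₁ : 0 ≤ B₁) (hB₂ : 0 ≤ B₂) (n a b m : ℕ) :
    0 ≤ overlapTerm B₁ B₂ n a b m := by unfold overlapTerm; positivity

lemma overlapTerm_pos (hB₁ : 0 ≤ B₁) (hB₂ : 0 ≤ B₂) {n a b m : ℕ}
    (h : Admissible B₁ B₂ n a b m) : 0 < overlapTerm B₁ B₂ n a b m := by
  obtain ⟨h1, -, h2, h3, h4⟩ := h
  have h5 : 0 < a.choose m := Nat.choose_pos h1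
  have h6 : 0 < (n - a).choose (b - m) := Nat.choose_pos h2
  have h7 : 0 < B₁ ^ m := by
    rcases hB₁.eq_or_lt with h | h
    · simp [h3 h.symm]
    · positivity
  have h8 : 0 < B₂ ^ (n - a - (b - m)) := by
    rcases hB₂.eq_or_lt with h | h
    · simp [h4 h.symm]
    · positivity
  unfold overlapTerm; positivity

lemma admissible_of_overlapTerm_pos {n a b m : ℕ} (hm : m ≤ b)
    (h : 0 < overlapTerm B₁ B₂ n a b m) : Admissible B₁ B₂ n a b m := by
  unfold overlapTerm at h
  refine ⟨?_, hm, ?_, ?_, ?_⟩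
  · by_contra! hlt
    simp [Nat.choose_eq_zero_of_lt hlt] at h
  · by_contra! hlt
    simp [Nat.choose_eq_zero_of_lt hlt] at h
  · intro h0
    by_contra hne
    simp [h0, hne] at h
  · intro h0
    by_contra hne
    simp [h0, hne] at h

lemma singleZ_pos (hB₁ : 0 ≤ B₁) (hB₂ : 0 ≤ B₂) (hlam : 0 < lam) {n a b m : ℕ} (ha : a ≤ n)
    (hb : b ≤ n) (h : Admissible B₁ B₂ n a b m) : 0 < singleZ Δ B₁ B₂ lam n a b m := by
  have h1 := overlapTerm_pos hB₁ hB₂ h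
  have h2 : 0 < n.choose a := Nat.choose_pos ha
  have h3 : 0 < n.choose b := Nat.choose_pos hb
  unfold singleZ; positivity

lemma singleZ_le_expectedZ (hB₁ : 0 ≤ B₁) (hB₂ : 0 ≤ B₂) (hlam : 0 < lam) {n a b m : ℕ}
    (hm : m ≤ b) : singleZ Δ B₁ B₂ lam n a b m ≤ expectedZ Δ B₁ B₂ lam n a b := by
  rw [expectedZ_eq, singleZ]
  have h : overlapTerm B₁ B₂ n a b m ≤ overlapSum B₁ B₂ n a b :=
    Finset.single_le_sum (f := overlapTerm B₁ B₂ n a b)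
      (fun m _ => overlapTerm_nonneg hB₁ hB₂ n a b m) (Finset.mem_range.2 (by omega))
  have := overlapTerm_nonneg hB₁ hB₂ n a b m
  gcongr

/-- `overlapSum` has at most n + 1 terms, so keeping only the largest one costs a factor (n + 1)^Δ,
which is invisible on the exponential scale. -/
lemma exists_expectedZ_le_singleZ (hB₁ : 0 ≤ B₁) (hB₂ : 0 ≤ B₂) (hlam : 0 < lam) (hΔ : Δ ≠ 0)
    {n a b : ℕ} (hb : b ≤ n) : ∃ m ≤ n, 0 < expectedZ Δ B₁ B₂ lam n a b →
      Admissible B₁ B₂ n a b m ∧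
      expectedZ Δ B₁ B₂ lam n a b ≤ ((n : ℝ) + 1) ^ Δ * singleZ Δ B₁ B₂ lam n a b m := by
  obtain ⟨m, hm, hmax⟩ := Finset.exists_max_image (Finset.range (b + 1))
    (overlapTerm B₁ B₂ n a b) ⟨0, by simp⟩
  have hmb : m ≤ b := by have := Finset.mem_range.1 hm; omega
  have hle : overlapSum B₁ B₂ n a b ≤ ((n : ℝ) + 1) * overlapTerm B₁ B₂ n a b m := by
    have h1 := Finset.sum_le_card_nsmul _ _ _ hmax
    rw [Finset.card_range, nsmul_eq_mul] at h1
    refine h1.trans (mul_le_mul_of_nonneg_right ?_ (overlapTerm_nonneg hB₁ hB₂ n a b m))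
    exact_mod_cast Nat.succ_le_succ hb
  have h0 : 0 ≤ overlapSum B₁ B₂ n a b :=
    Finset.sum_nonneg fun m _ => overlapTerm_nonneg hB₁ hB₂ n a b m
  refine ⟨m, hmb.trans hb, fun hpos => ⟨admissible_of_overlapTerm_pos hmb ?_, ?_⟩⟩
  · refine lt_of_le_of_ne (overlapTerm_nonneg hB₁ hB₂ n a b m) fun h => ?_
    rw [← h, mul_zero] at hle
    rw [expectedZ_eq, le_antisymm hle h0] at hpos
    simp [hΔ] at hpos
  · rw [expectedZ_eq, singleZ]
    calc (n.choose a : ℝ) * n.choose b * lam ^ (a + b) * (overlapSum B₁ B₂ n a b / n.choose b) ^ Δ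
        ≤ n.choose a * n.choose b * lam ^ (a + b)
          * (((n : ℝ) + 1) * overlapTerm B₁ B₂ n a b m / n.choose b) ^ Δ := by gcongr
      _ = _ := by rw [mul_div_assoc ((n : ℝ) + 1), mul_pow]; ring

variable {ι : Type*} {l : Filter ι} {N a b m : ι → ℕ} {α β γ : ℝ}

/-- Admissibility makes every factor positive, since a vanishing B₁ or B₂ then has exponent 0. The
logarithm thus splits into binomial coefficients and powers. -/
lemma tendsto_log_singleZ (hB₁ : 0 ≤ B₁) (hB₂ : 0 ≤ B₂) (hlam : 0 < lam)
    (hN : Tendsto N l atTop) (hab : ∀ᶠ i in l, a i ≤ N i ∧ b i ≤ N i)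
    (hadm : ∀ᶠ i in l, Admissible B₁ B₂ (N i) (a i) (b i) (m i))
    (ha : Tendsto (fun i => (a i : ℝ) / N i) l (𝓝 α))
    (hb : Tendsto (fun i => (b i : ℝ) / N i) l (𝓝 β))
    (hm : Tendsto (fun i => (m i : ℝ) / N i) l (𝓝 γ)) :
    Tendsto (fun i => Real.log (singleZ Δ B₁ B₂ lam (N i) (a i) (b i) (m i)) / N i) l
      (𝓝 (rateFn Δ B₁ B₂ lam α β γ)) := by
  have hone : Tendsto (fun i => (N i : ℝ) / N i) l (𝓝 1) := by
    refine tendsto_const_nhds.congr' ?_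
    filter_upwards [hN.eventually_gt_atTop 0] with i hi
    rw [div_self (by exact_mod_cast hi.ne')]
  have hna : Tendsto (fun i => ((N i - a i : ℕ) : ℝ) / N i) l (𝓝 (1 - α)) := by
    refine (hone.sub ha).congr' ?_
    filter_upwards [hab] with i hi
    rw [Nat.cast_sub hi.1, sub_div]
  have hbm : Tendsto (fun i => ((b i - m i : ℕ) : ℝ) / N i) l (𝓝 (β - γ)) := by
    refine (hb.sub hm).congr' ?_
    filter_upwards [hadm] with i hi
    rw [Nat.cast_sub hi.2.1, sub_div]
  have hrest : Tendsto (fun i => ((N i - a i - (b i - m i) : ℕ) : ℝ) / N i) l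
      (𝓝 (1 - α - (β - γ))) := by
    refine (hna.sub hbm).congr' ?_
    filter_upwards [hadm] with i hi
    rw [Nat.cast_sub hi.2.2.1, sub_div]
  have hle : ∀ᶠ i in l, N i ≤ N i := Eventually.of_forall fun _ => le_rfl
  have h1 := tendsto_log_choose hN hle (hab.mono fun i h => h.1) hone ha
  have h2 := tendsto_log_choose hN hle (hab.mono fun i h => h.2) hone hb
  have h3 := tendsto_log_choose hN (hab.mono fun i h => h.1) (hadm.mono fun i h => h.1) ha hm
  have h4 := tendsto_log_choose hN (hab.mono fun i h => Nat.sub_le _ _)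
    (hadm.mono fun i h => h.2.2.1) hna hbm
  have h := ((h1.add h2).add ((ha.add hb).mul_const (Real.log lam))).add
    ((((h3.add h4).add ((hm.mul_const (Real.log B₁)).add
      (hrest.mul_const (Real.log B₂)))).sub h2).const_mul (Δ : ℝ))
  have hx1 : xlog 1 = 0 := by simp [xlog]
  have he : ∀ x : ℝ, xlog 1 - xlog x - xlog (1 - x) = entropyFn x := by
    intro x; rw [hx1, entropyFn]; ring
  rw [he, he] at h
  refine h.congr' ?_
  filter_upwards [hab, hadm] with i hab hadm
  have hT := overlapTerm_pos hB₁ hB₂ hadm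
  have hc1 : ((N i).choose (a i) : ℝ) ≠ 0 := by exact_mod_cast (Nat.choose_pos hab.1).ne'
  have hc2 : ((N i).choose (b i) : ℝ) ≠ 0 := by exact_mod_cast (Nat.choose_pos hab.2).ne'
  have hlogT : Real.log (overlapTerm B₁ B₂ (N i) (a i) (b i) (m i))
      = Real.log ((a i).choose (m i)) + Real.log ((N i - a i).choose (b i - m i))
        + (m i * Real.log B₁ + (N i - a i - (b i - m i) : ℕ) * Real.log B₂) := by
    unfold overlapTerm at hT ⊢
    have hz := hT.ne'
    rw [mul_ne_zero_iff, mul_ne_zero_iff, mul_ne_zero_iff] at hz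
    rw [Real.log_mul (mul_ne_zero hz.1.1 hz.1.2) (mul_ne_zero hz.2.1 hz.2.2),
      Real.log_mul hz.1.1 hz.1.2, Real.log_mul hz.2.1 hz.2.2, Real.log_pow, Real.log_pow]
  unfold singleZ
  rw [Real.log_mul (mul_ne_zero (mul_ne_zero hc1 hc2) (by positivity))
      (pow_ne_zero _ (div_ne_zero hT.ne' hc2)), Real.log_mul (mul_ne_zero hc1 hc2) (by positivity),
    Real.log_mul hc1 hc2, Real.log_pow, Real.log_pow, Real.log_div hT.ne' hc2, hlogT]
  push_cast
  ring

lemma mem_feasible_of_tendsto [l.NeBot]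
    (hN : Tendsto N l atTop) (hab : ∀ᶠ i in l, a i ≤ N i ∧ b i ≤ N i)
    (hadm : ∀ᶠ i in l, Admissible B₁ B₂ (N i) (a i) (b i) (m i))
    (ha : Tendsto (fun i => (a i : ℝ) / N i) l (𝓝 α))
    (hb : Tendsto (fun i => (b i : ℝ) / N i) l (𝓝 β))
    (hm : Tendsto (fun i => (m i : ℝ) / N i) l (𝓝 γ)) : γ ∈ feasible B₁ B₂ α β := by
  have hrest : Tendsto (fun i => ((N i - a i - (b i - m i) : ℕ) : ℝ) / N i) l
      (𝓝 (1 - α - (β - γ))) := by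
    refine ((ha.const_sub 1).sub (hb.sub hm)).congr' ?_
    filter_upwards [hab, hadm, hN.eventually_gt_atTop 0] with i hi hadm hi0
    have : (N i : ℝ) ≠ 0 := by exact_mod_cast hi0.ne'
    rw [Nat.cast_sub hadm.2.2.1, Nat.cast_sub hi.1, Nat.cast_sub hadm.2.1]
    field_simp
  refine ⟨ge_of_tendsto' hm fun i => by positivity, le_of_tendsto_of_tendsto hm ha ?_,
    le_of_tendsto_of_tendsto hm hb ?_, ge_of_tendsto' hrest fun i => by positivity,
    fun h0 => ?_, fun h0 => ?_⟩
  · filter_upwards [hadm] with i hi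
    have : (m i : ℝ) ≤ a i := by exact_mod_cast hi.1
    gcongr
  · filter_upwards [hadm] with i hi
    have : (m i : ℝ) ≤ b i := by exact_mod_cast hi.2.1
    gcongr
  · refine tendsto_nhds_unique hm (tendsto_const_nhds.congr' ?_)
    filter_upwards [hadm] with i hi
    simp [hi.2.2.2.1 h0]
  · refine tendsto_nhds_unique hrest (tendsto_const_nhds.congr' ?_)
    filter_upwards [hadm] with i hi
    simp [hi.2.2.2.2 h0]

lemma logRate_of_pos {n a b : ℕ} (h : 0 < expectedZ Δ B₁ B₂ lam n a b) :
    logRate Δ B₁ B₂ lam n a b = ((Real.log (expectedZ Δ B₁ B₂ lam n a b) / n : ℝ) : EReal) := by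
  rw [logRate, ENNReal.log_ofReal, if_neg (not_le.2 h), ← EReal.coe_mul]
  congr 1
  ring

lemma logRate_of_not_pos {n a b : ℕ} (hn : 0 < n) (h : ¬ 0 < expectedZ Δ B₁ B₂ lam n a b) :
    logRate Δ B₁ B₂ lam n a b = ⊥ := by
  rw [logRate, ENNReal.log_ofReal, if_pos (not_lt.1 h), EReal.coe_mul_bot_of_pos (by positivity)]

/-- Every admissible fraction is the limit of admissible integers. -/
lemma exists_admissible_of_mem_feasible (hγ : γ ∈ feasible B₁ B₂ α β)
    {a b : ℕ → ℕ} (hab : ∀ n, a n ≤ n ∧ b n ≤ n)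
    (ha : Tendsto (fun n => (a n : ℝ) / n) atTop (𝓝 α))
    (hb : Tendsto (fun n => (b n : ℝ) / n) atTop (𝓝 β))
    (hline : B₁ * B₂ = 0 → α + β = 1 → ∀ n, a n + b n = n) :
    ∃ m : ℕ → ℕ, (∀ᶠ n in atTop, Admissible B₁ B₂ n (a n) (b n) (m n)) ∧
      Tendsto (fun n => (m n : ℝ) / n) atTop (𝓝 γ) := by
  obtain ⟨h1, h2, h3, h4, h5, h6⟩ := hγ
  have hsub : Tendsto (fun n => ((a n + b n - n : ℕ) : ℝ) / n) atTop (𝓝 (max (α + β - 1) 0)) := by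
    refine (((ha.add hb).sub_const 1).max tendsto_const_nhds).congr' ?_
    filter_upwards [eventually_gt_atTop 0] with n hn
    have hn' : (0 : ℝ) < n := by exact_mod_cast hn
    rcases le_total (a n + b n) n with h | h
    · have h' : ((a n : ℝ) + b n) ≤ n := by exact_mod_cast h
      rw [Nat.sub_eq_zero_of_le h, Nat.cast_zero, zero_div, max_eq_right]
      rw [← add_div, sub_nonpos, div_le_one hn']; exact h'
    · have h' : (n : ℝ) ≤ (a n : ℝ) + b n := by exact_mod_cast h
      rw [Nat.cast_sub h, max_eq_left]
      · push_cast; field_simp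
      · rw [← add_div, sub_nonneg, one_le_div hn']; exact h'
  by_cases hBB : B₁ * B₂ = 0
  · refine ⟨fun n => a n + b n - n, ?_, ?_⟩
    · have hlt : B₁ = 0 → ∀ᶠ n in atTop, a n + b n ≤ n := by
        intro h0
        rw [h5 h0] at h4
        rcases eq_or_lt_of_le (show α + β ≤ 1 by linarith) with h | h
        · exact Eventually.of_forall fun n => (hline hBB h n).le
        · filter_upwards [(ha.add hb).eventually_lt_const h, eventually_gt_atTop 0] with n hn hn0
          rw [← add_div, div_lt_one (by exact_mod_cast hn0)] at hn
          exact_mod_cast hn.le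
      have hgt : B₂ = 0 → ∀ᶠ n in atTop, n ≤ a n + b n := by
        intro h0
        have h6 := h6 h0
        rcases eq_or_lt_of_le (show 1 ≤ α + β by linarith) with h | h
        · exact Eventually.of_forall fun n => (hline hBB h.symm n).ge
        · filter_upwards [(ha.add hb).eventually_const_lt h, eventually_gt_atTop 0] with n hn hn0
          rw [← add_div, one_lt_div (by exact_mod_cast hn0)] at hn
          exact_mod_cast hn.le
      have hlt' : ∀ᶠ n in atTop, B₁ = 0 → a n + b n ≤ n := by
        by_cases h0 : B₁ = 0
        · filter_upwards [hlt h0] with n hn _ using hn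
        · exact Eventually.of_forall fun n h => absurd h h0
      have hgt' : ∀ᶠ n in atTop, B₂ = 0 → n ≤ a n + b n := by
        by_cases h0 : B₂ = 0
        · filter_upwards [hgt h0] with n hn _ using hn
        · exact Eventually.of_forall fun n h => absurd h h0
      filter_upwards [hlt', hgt'] with n hl hg
      have := hab n
      refine ⟨by omega, by omega, by omega, fun h0 => ?_, fun h0 => ?_⟩
      · have := hl h0; omega
      · have := hg h0; omega
    · have hγ' : max (α + β - 1) 0 = γ := by
        rcases mul_eq_zero.1 hBB with h0 | h0
        · have h5 := h5 h0
          rw [max_eq_right (by linarith), h5]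
        · have h6 := h6 h0
          rw [max_eq_left (by linarith)]
          linarith
      rwa [hγ'] at hsub
  · refine ⟨fun n => max (a n + b n - n) (min (min (a n) (b n)) ⌊γ * n⌋₊), ?_, ?_⟩
    · refine Eventually.of_forall fun n => ?_
      have := hab n
      dsimp only
      refine ⟨by omega, by omega, by omega, fun h0 => ?_, fun h0 => ?_⟩
      · exact absurd (by rw [h0, zero_mul]) hBB
      · exact absurd (by rw [h0, mul_zero]) hBB
    · have hfl : Tendsto (fun n : ℕ => ((⌊γ * n⌋₊ : ℕ) : ℝ) / n) atTop (𝓝 γ) :=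
        (tendsto_nat_floor_mul_div_atTop h1).comp tendsto_natCast_atTop_atTop
      have h := hsub.max ((ha.min hb).min hfl)
      have he : max (max (α + β - 1) 0) (min (min α β) γ) = γ := by
        rw [min_eq_right (le_min h2 h3), max_eq_right]
        exact max_le (by linarith) h1
      rw [he] at h
      refine h.congr' ?_
      filter_upwards [eventually_gt_atTop 0] with n hn
      have hn' : (0 : ℝ) ≤ n := by positivity
      push_cast
      rw [min_div_div_right hn', min_div_div_right hn', max_div_div_right hn']

/-- Lower bound: each feasible γ is approached by single terms of the sum. Upper bound: if the rate
were at least some c above the supremum infinitely often, then along an ultrafilter of such n the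
indices of the largest terms would have a limiting fraction. That fraction is feasible and has rate
at least c. -/
theorem isFirstMomentRate_firstMomentRate (hB₁ : 0 ≤ B₁) (hB₂ : 0 ≤ B₂) (hlam : 0 < lam)
    (hΔ : Δ ≠ 0) (α β : ℝ) :
    IsFirstMomentRate Δ B₁ B₂ lam α β (firstMomentRate Δ B₁ B₂ lam (α, β)) := by
  intro a b hab ha hb hline
  refine tendsto_order.2 ⟨fun c hc => ?_, fun c hc => ?_⟩
  · simp only [firstMomentRate, lt_iSup_iff] at hc
    obtain ⟨γ, hγ, hc⟩ := hc
    obtain ⟨m, hadm, hm⟩ := exists_admissible_of_mem_feasible hγ hab ha hb hline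
    have h := tendsto_log_singleZ (Δ := Δ) hB₁ hB₂ hlam tendsto_id (Eventually.of_forall hab)
      hadm ha hb hm
    have h' := (continuous_coe_real_ereal.tendsto _).comp h
    filter_upwards [h'.eventually_const_lt hc, hadm] with n hn hadm
    have hpos := singleZ_pos (Δ := Δ) hB₁ hB₂ hlam (hab n).1 (hab n).2 hadm
    have hle := singleZ_le_expectedZ (Δ := Δ) (n := n) (a := a n) hB₁ hB₂ hlam hadm.2.1
    rw [logRate_of_pos (hpos.trans_le hle)]
    refine lt_of_lt_of_le hn (EReal.coe_le_coe_iff.2 ?_)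
    have := Real.log_le_log hpos hle
    simp only [id]
    gcongr
  · by_contra hcon
    have hfreq : ∃ᶠ n in atTop, c ≤ logRate Δ B₁ B₂ lam n (a n) (b n) := by
      simpa [Filter.Frequently, not_le] using hcon
    choose m hmn hm using fun n =>
      exists_expectedZ_le_singleZ (Δ := Δ) (n := n) (a := a n) hB₁ hB₂ hlam hΔ (hab n).2
    have : (atTop ⊓ 𝓟 {n | c ≤ logRate Δ B₁ B₂ lam n (a n) (b n)} : Filter ℕ).NeBot :=
      frequently_mem_iff_neBot.1 hfreq
    set U := Ultrafilter.of (atTop ⊓ 𝓟 {n | c ≤ logRate Δ B₁ B₂ lam n (a n) (b n)}) with hU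
    have hUle : (U : Filter ℕ) ≤ atTop ⊓ 𝓟 {n | c ≤ logRate Δ B₁ B₂ lam n (a n) (b n)} :=
      Ultrafilter.of_le _
    have hUtop : (U : Filter ℕ) ≤ atTop := hUle.trans inf_le_left
    have hUc : ∀ᶠ n in (U : Filter ℕ), c ≤ logRate Δ B₁ B₂ lam n (a n) (b n) :=
      hUle.trans inf_le_right (mem_principal_self _)
    -- A rate of -∞ cannot be at least c, which exceeds the supremum strictly.
    have hUpos : ∀ᶠ n in (U : Filter ℕ), 0 < expectedZ Δ B₁ B₂ lam n (a n) (b n) := by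
      filter_upwards [hUc, hUtop (eventually_gt_atTop 0)] with n hn hn0
      by_contra hpos
      rw [logRate_of_not_pos hn0 hpos, le_bot_iff] at hn
      rw [hn] at hc
      exact not_lt_bot hc
    obtain ⟨γ, -, hγ⟩ := isCompact_Icc.ultrafilter_le_nhds (s := Set.Icc (0 : ℝ) 1)
      (U.map fun n => (m n : ℝ) / n) (le_principal_iff.2 (Ultrafilter.mem_map.2 (univ_mem' fun n =>
        ⟨div_nonneg (Nat.cast_nonneg _) (Nat.cast_nonneg _),
          div_le_one_of_le₀ (Nat.cast_le.2 (hmn n)) (Nat.cast_nonneg _)⟩)))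
    have hγ' : Tendsto (fun n => (m n : ℝ) / n) U (𝓝 γ) := hγ
    have hadm : ∀ᶠ n in (U : Filter ℕ), Admissible B₁ B₂ n (a n) (b n) (m n) :=
      hUpos.mono fun n hn => (hm n hn).1
    have hid : Tendsto (fun n : ℕ => n) (U : Filter ℕ) atTop := tendsto_id.mono_left hUtop
    have hfeas := mem_feasible_of_tendsto hid (Eventually.of_forall hab) hadm
      (ha.mono_left hUtop) (hb.mono_left hUtop) hγ'
    have hlim := tendsto_log_singleZ (Δ := Δ) hB₁ hB₂ hlam hid (Eventually.of_forall hab) hadm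
      (ha.mono_left hUtop) (hb.mono_left hUtop) hγ'
    have hlim' := ((tendsto_log_add_one_div hid).const_mul (Δ : ℝ)).add hlim
    rw [mul_zero, zero_add] at hlim'
    have hle : c ≤ ((rateFn Δ B₁ B₂ lam α β γ : ℝ) : EReal) := by
      refine ge_of_tendsto ((continuous_coe_real_ereal.tendsto _).comp hlim') ?_
      filter_upwards [hUc, hUpos] with n hn hpos
      refine hn.trans ?_
      rw [logRate_of_pos hpos]
      refine EReal.coe_le_coe_iff.2 ?_
      have hs := singleZ_pos (Δ := Δ) hB₁ hB₂ hlam (hab n).1 (hab n).2 (hm n hpos).1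
      have h1 := Real.log_le_log hpos (hm n hpos).2
      rw [Real.log_mul (by positivity) hs.ne', Real.log_pow] at h1
      dsimp only
      rw [mul_div_assoc', ← add_div]
      gcongr
    exact absurd (hle.trans (le_iSup₂ (f := fun γ _ =>
      ((rateFn Δ B₁ B₂ lam α β γ : ℝ) : EReal)) γ hfeas)) (not_le.2 hc)

end Rate

/-! ### Maximizers of the first moment rate. -/

section Maximizers

variable {B₁ B₂ lam : ℝ} {Δ : ℕ} {α β γ : ℝ}

/-- The logarithm of the amplitude of spin `-1`, at a positive marginal. -/
lemma log_minusAmp (hlam : 0 < lam) (hα : 0 < α) : Real.log (minusAmp Δ lam α)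
    = Real.log lam / Δ + ((Δ - 1 : ℕ) : ℝ) / Δ * Real.log α := by
  unfold minusAmp
  rw [Real.log_mul (Real.rpow_pos_of_pos hlam _).ne' (Real.rpow_pos_of_pos hα _).ne',
    Real.log_rpow hlam, Real.log_rpow hα]
  ring

lemma log_plusAmp (hα : α < 1) : Real.log (plusAmp Δ α)
    = ((Δ - 1 : ℕ) : ℝ) / Δ * Real.log (1 - α) := by
  unfold plusAmp
  rw [Real.log_rpow (sub_pos.2 hα)]

/-- The Gibbs inequality for one term, from log t ≤ t - 1 at t = x/(S q). The corrections x/S - q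
cancel in a sum where the weights x add up to S and the fractions q to 1. -/
lemma mul_log_le {q x S : ℝ} (hq : 0 ≤ q) (hx : 0 ≤ x) (hS : 0 < S) (hqx : 0 < q → 0 < x) :
    q * Real.log x - xlog q ≤ q * Real.log S + (x / S - q) := by
  unfold xlog
  rcases hq.eq_or_lt with rfl | hq
  · simp; positivity
  · have hx := hqx hq
    have h := Real.log_le_sub_one_of_pos (x := x / (S * q)) (by positivity)
    rw [Real.log_div hx.ne' (by positivity), Real.log_mul hS.ne' hq.ne'] at h
    have h2 := mul_le_mul_of_nonneg_left h hq.le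
    have h3 : q * (x / (S * q) - 1) = x / S - q := by field_simp
    rw [h3] at h2
    linarith

lemma mul_log_eq {q x S : ℝ} (hS : 0 < S) (hx : 0 ≤ x) (hq : q = x / S) :
    q * Real.log x - xlog q = q * Real.log S := by
  unfold xlog
  rcases hx.eq_or_lt with rfl | hx
  · simp [hq]
  · rw [hq, Real.log_div hx.ne' hS.ne']; ring

/-- An edge type of positive fraction has positive weight. This allows logarithms to be split on the
boundary of the square, where amplitudes may vanish. -/
lemma feasible_pos (hlam : 0 < lam) (hγ : γ ∈ feasible B₁ B₂ α β) (hB₁ : 0 ≤ B₁) (hB₂ : 0 ≤ B₂) :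
    (0 < γ → 0 < B₁ ∧ 0 < minusAmp Δ lam α ∧ 0 < minusAmp Δ lam β) ∧
    (0 < α - γ → 0 < minusAmp Δ lam α ∧ 0 < plusAmp Δ β) ∧
    (0 < β - γ → 0 < plusAmp Δ α ∧ 0 < minusAmp Δ lam β) ∧
    (0 < 1 - α - (β - γ) → 0 < B₂ ∧ 0 < plusAmp Δ α ∧ 0 < plusAmp Δ β) := by
  obtain ⟨h1, h2, h3, h4, h5, h6⟩ := hγ
  refine ⟨fun h => ⟨lt_of_le_of_ne hB₁ fun h0 => ?_, minusAmp_pos hlam (by linarith),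
    minusAmp_pos hlam (by linarith)⟩, fun h => ⟨minusAmp_pos hlam (by linarith),
    plusAmp_pos (by linarith)⟩, fun h => ⟨plusAmp_pos (by linarith),
    minusAmp_pos hlam (by linarith)⟩, fun h => ⟨lt_of_le_of_ne hB₂ fun h0 => ?_,
    plusAmp_pos (by linarith), plusAmp_pos (by linarith)⟩⟩
  · exact h.ne' (h5 h0.symm)
  · exact h.ne' (h6 h0.symm)

/-- The rate function in terms of relative entropies. -/
lemma rateFn_eq (hΔ : 3 ≤ Δ) (hB₁ : 0 ≤ B₁) (hB₂ : 0 ≤ B₂) (hlam : 0 < lam)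
    (hγ : γ ∈ feasible B₁ B₂ α β) :
    rateFn Δ B₁ B₂ lam α β γ = Δ *
      ((γ * Real.log (B₁ * (minusAmp Δ lam α * minusAmp Δ lam β)) - xlog γ)
        + ((α - γ) * Real.log (minusAmp Δ lam α * plusAmp Δ β) - xlog (α - γ))
        + ((β - γ) * Real.log (plusAmp Δ α * minusAmp Δ lam β) - xlog (β - γ))
        + ((1 - α - (β - γ)) * Real.log (B₂ * (plusAmp Δ α * plusAmp Δ β))
            - xlog (1 - α - (β - γ)))) := by
  obtain ⟨p1, p2, p3, p4⟩ := feasible_pos (Δ := Δ) hlam hγ hB₁ hB₂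
  obtain ⟨h1, h2, h3, h4, -, -⟩ := hγ
  set w : ℝ := ((Δ - 1 : ℕ) : ℝ) / Δ with hw
  have hΔ0 : (Δ : ℝ) ≠ 0 := by exact_mod_cast (by omega : Δ ≠ 0)
  have hΔw : Δ * w = Δ - 1 := by
    rw [hw, Nat.cast_sub (by omega)]; field_simp; simp
  have e1 : γ * Real.log (B₁ * (minusAmp Δ lam α * minusAmp Δ lam β))
      = γ * (Real.log B₁ + (Real.log lam / Δ + w * Real.log α)
        + (Real.log lam / Δ + w * Real.log β)) := by
    rcases h1.eq_or_lt with h | h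
    · simp [← h]
    · obtain ⟨q1, q2, q3⟩ := p1 h
      rw [Real.log_mul q1.ne' (by positivity), Real.log_mul q2.ne' q3.ne',
        log_minusAmp hlam (by linarith), log_minusAmp hlam (by linarith)]
      ring
  have e2 : (α - γ) * Real.log (minusAmp Δ lam α * plusAmp Δ β)
      = (α - γ) * ((Real.log lam / Δ + w * Real.log α) + w * Real.log (1 - β)) := by
    rcases (sub_nonneg.2 h2).eq_or_lt with h | h
    · simp [← h]
    · obtain ⟨q1, q2⟩ := p2 h
      rw [Real.log_mul q1.ne' q2.ne', log_minusAmp hlam (by linarith), log_plusAmp (by linarith)]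
  have e3 : (β - γ) * Real.log (plusAmp Δ α * minusAmp Δ lam β)
      = (β - γ) * (w * Real.log (1 - α) + (Real.log lam / Δ + w * Real.log β)) := by
    rcases (sub_nonneg.2 h3).eq_or_lt with h | h
    · simp [← h]
    · obtain ⟨q1, q2⟩ := p3 h
      rw [Real.log_mul q1.ne' q2.ne', log_minusAmp hlam (by linarith), log_plusAmp (by linarith)]
  have e4 : (1 - α - (β - γ)) * Real.log (B₂ * (plusAmp Δ α * plusAmp Δ β))
      = (1 - α - (β - γ)) * (Real.log B₂ + w * Real.log (1 - α) + w * Real.log (1 - β)) := by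
    rcases h4.eq_or_lt with h | h
    · simp [← h]
    · obtain ⟨q1, q2, q3⟩ := p4 h
      rw [Real.log_mul q1.ne' (by positivity), Real.log_mul q2.ne' q3.ne',
        log_plusAmp (by linarith), log_plusAmp (by linarith)]
      ring
  rw [e1, e2, e3, e4]
  have hl : Δ * (Real.log lam / Δ) = Real.log lam := mul_div_cancel₀ _ hΔ0
  unfold rateFn entropyFn
  have f : ∀ x : ℝ, xlog x = x * Real.log x := fun _ => rfl
  rw [f α, f (1 - α), f β, f (1 - β)]
  -- The four edge fractions have marginals α and β, so the amplitudes contribute Δw = Δ - 1 copies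
  -- of the vertex terms x log x, and λ contributes Δ times (log λ)/Δ for each spin -1.
  linear_combination (-(α + β)) * hl - (α * Real.log α + (1 - α) * Real.log (1 - α)
    + β * Real.log β + (1 - β) * Real.log (1 - β)) * hΔw

lemma edgeZ_pos_of_feasible (hB₁ : 0 ≤ B₁) (hB₂ : 0 ≤ B₂) (hlam : 0 < lam)
    (hα : α ∈ Set.Icc (0 : ℝ) 1) (hβ : β ∈ Set.Icc (0 : ℝ) 1)
    (hγ : γ ∈ feasible B₁ B₂ α β) : 0 < edgeZ Δ B₁ B₂ lam α β := by
  obtain ⟨p1, p2, p3, p4⟩ := feasible_pos (Δ := Δ) hlam hγ hB₁ hB₂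
  obtain ⟨h1, h2, h3, h4, -, -⟩ := hγ
  have m1 := minusAmp_nonneg (Δ := Δ) hlam hα
  have m2 := minusAmp_nonneg (Δ := Δ) hlam hβ
  have m3 := plusAmp_nonneg (Δ := Δ) hα
  have m4 := plusAmp_nonneg (Δ := Δ) hβ
  unfold edgeZ
  rcases h1.eq_or_lt with h | h
  · rcases (sub_nonneg.2 h2).eq_or_lt with h' | h'
    · rcases (sub_nonneg.2 h3).eq_or_lt with h'' | h''
      · obtain ⟨q1, q2, q3⟩ := p4 (by linarith)
        positivity
      · obtain ⟨q1, q2⟩ := p3 h''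
        positivity
    · obtain ⟨q1, q2⟩ := p2 h'
      positivity
  · obtain ⟨q1, q2, q3⟩ := p1 h
    positivity

/-- The rate is Δ log `edgeZ` minus Δ times the relative entropy of the edge fractions with respect
to the normalised summands of `edgeZ`. -/
lemma rateFn_le (hΔ : 3 ≤ Δ) (hB₁ : 0 ≤ B₁) (hB₂ : 0 ≤ B₂) (hlam : 0 < lam)
    (hα : α ∈ Set.Icc (0 : ℝ) 1) (hβ : β ∈ Set.Icc (0 : ℝ) 1)
    (hγ : γ ∈ feasible B₁ B₂ α β) :
    rateFn Δ B₁ B₂ lam α β γ ≤ Δ * Real.log (edgeZ Δ B₁ B₂ lam α β) := by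
  have hS := edgeZ_pos_of_feasible (Δ := Δ) hB₁ hB₂ hlam hα hβ hγ
  obtain ⟨p1, p2, p3, p4⟩ := feasible_pos (Δ := Δ) hlam hγ hB₁ hB₂
  have m1 := minusAmp_nonneg (Δ := Δ) hlam hα
  have m2 := minusAmp_nonneg (Δ := Δ) hlam hβ
  have m3 := plusAmp_nonneg (Δ := Δ) hα
  have m4 := plusAmp_nonneg (Δ := Δ) hβ
  rw [rateFn_eq hΔ hB₁ hB₂ hlam hγ]
  obtain ⟨h1, h2, h3, h4, -, -⟩ := hγ
  have i1 := mul_log_le h1 (mul_nonneg hB₁ (mul_nonneg m1 m2)) hS fun h => by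
    obtain ⟨q1, q2, q3⟩ := p1 h; positivity
  have i2 := mul_log_le (sub_nonneg.2 h2) (mul_nonneg m1 m4) hS fun h => by
    obtain ⟨q1, q2⟩ := p2 h; positivity
  have i3 := mul_log_le (sub_nonneg.2 h3) (mul_nonneg m3 m2) hS fun h => by
    obtain ⟨q1, q2⟩ := p3 h; positivity
  have i4 := mul_log_le h4 (mul_nonneg hB₂ (mul_nonneg m3 m4)) hS fun h => by
    obtain ⟨q1, q2, q3⟩ := p4 h; positivity
  have hsum : B₁ * (minusAmp Δ lam α * minusAmp Δ lam β) / edgeZ Δ B₁ B₂ lam α β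
      + minusAmp Δ lam α * plusAmp Δ β / edgeZ Δ B₁ B₂ lam α β
      + plusAmp Δ α * minusAmp Δ lam β / edgeZ Δ B₁ B₂ lam α β
      + B₂ * (plusAmp Δ α * plusAmp Δ β) / edgeZ Δ B₁ B₂ lam α β = 1 := by
    rw [← add_div, ← add_div, ← add_div]
    exact div_self hS.ne'
  refine mul_le_mul_of_nonneg_left ?_ (Nat.cast_nonneg _)
  linarith

/-- At a fixed point of the alternating maximization the bound by `edgeZ` is attained. -/
lemma exists_rateFn_eq (hΔ : 3 ≤ Δ) (hB₁ : 0 ≤ B₁) (hB₂ : 0 ≤ B₂) (hlam : 0 < lam)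
    (hα : α ∈ Set.Icc (0 : ℝ) 1) (hβ : β ∈ Set.Icc (0 : ℝ) 1)
    (hαβ : α = bestResponse Δ B₁ B₂ lam β) (hβα : β = bestResponse Δ B₁ B₂ lam α) :
    ∃ γ ∈ feasible B₁ B₂ α β,
      rateFn Δ B₁ B₂ lam α β γ = Δ * Real.log (edgeZ Δ B₁ B₂ lam α β) := by
  have hS : 0 < edgeZ Δ B₁ B₂ lam α β := by
    rw [hαβ]; exact edgeZ_bestResponse_pos hΔ hB₁ hB₂ hlam hβ
  have m1 := minusAmp_nonneg (Δ := Δ) hlam hα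
  have m2 := minusAmp_nonneg (Δ := Δ) hlam hβ
  have m3 := plusAmp_nonneg (Δ := Δ) hα
  have m4 := plusAmp_nonneg (Δ := Δ) hβ
  have k1 := bestResponse_marginal hΔ hB₁ hB₂ hlam hβ hαβ
  have k2 := bestResponse_marginal hΔ hB₁ hB₂ hlam hα hβα
  rw [edgeZ_comm] at k2
  have hdef : edgeZ Δ B₁ B₂ lam α β = B₁ * (minusAmp Δ lam α * minusAmp Δ lam β)
    + minusAmp Δ lam α * plusAmp Δ β
    + plusAmp Δ α * minusAmp Δ lam β + B₂ * (plusAmp Δ α * plusAmp Δ β) := rfl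
  set S := edgeZ Δ B₁ B₂ lam α β with hSdef
  -- The distribution proportional to the four summands of `edgeZ` gives equality in the Gibbs
  -- inequality. Its marginals are α and β because these are mutual best responses, so this γ is
  -- feasible.
  set γ := B₁ * (minusAmp Δ lam α * minusAmp Δ lam β) / S with hγdef
  have g1 : γ = B₁ * (minusAmp Δ lam α * minusAmp Δ lam β) / S := hγdef
  have gS : γ * S = B₁ * (minusAmp Δ lam α * minusAmp Δ lam β) := by
    rw [g1, div_mul_cancel₀ _ hS.ne']
  have g2 : α - γ = minusAmp Δ lam α * plusAmp Δ β / S := by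
    rw [eq_div_iff hS.ne', sub_mul, gS]; linarith
  have g3 : β - γ = plusAmp Δ α * minusAmp Δ lam β / S := by
    rw [eq_div_iff hS.ne', sub_mul, gS]; linarith
  have g4 : 1 - α - (β - γ) = B₂ * (plusAmp Δ α * plusAmp Δ β) / S := by
    rw [eq_div_iff hS.ne', g3, sub_mul, sub_mul, div_mul_cancel₀ _ hS.ne']; linarith
  have n1 : 0 ≤ B₁ * (minusAmp Δ lam α * minusAmp Δ lam β) := mul_nonneg hB₁ (mul_nonneg m1 m2)
  have n2 := mul_nonneg m1 m4
  have n3 := mul_nonneg m3 m2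
  have n4 : 0 ≤ B₂ * (plusAmp Δ α * plusAmp Δ β) := mul_nonneg hB₂ (mul_nonneg m3 m4)
  have hfeas : γ ∈ feasible B₁ B₂ α β := by
    refine ⟨by rw [g1]; positivity, ?_, ?_, by rw [g4]; positivity, fun h0 => ?_, fun h0 => ?_⟩
    · rw [← sub_nonneg, g2]; positivity
    · rw [← sub_nonneg, g3]; positivity
    · rw [g1, h0, zero_mul, zero_div]
    · rw [g4, h0, zero_mul, zero_div]
  refine ⟨γ, hfeas, ?_⟩
  rw [rateFn_eq hΔ hB₁ hB₂ hlam hfeas, mul_log_eq hS n1 g1, mul_log_eq hS n2 g2,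
    mul_log_eq hS n3 g3, mul_log_eq hS n4 g4]
  ring

lemma firstMomentRate_le {c : ℝ} (hΔ : 3 ≤ Δ) (hB₁ : 0 ≤ B₁) (hB₂ : 0 ≤ B₂) (hlam : 0 < lam)
    (hα : α ∈ Set.Icc (0 : ℝ) 1) (hβ : β ∈ Set.Icc (0 : ℝ) 1)
    (hc : edgeZ Δ B₁ B₂ lam α β ≤ c) :
    firstMomentRate Δ B₁ B₂ lam (α, β) ≤ ((Δ * Real.log c : ℝ) : EReal) := by
  refine iSup₂_le fun γ hγ => EReal.coe_le_coe_iff.2 ((rateFn_le hΔ hB₁ hB₂ hlam hα hβ hγ).trans ?_)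
  exact mul_le_mul_of_nonneg_left
    (Real.log_le_log (edgeZ_pos_of_feasible hB₁ hB₂ hlam hα hβ hγ) hc) (Nat.cast_nonneg _)

/-- The upper bound holds on the whole square; equality is needed only at these pairs, since every
maximizer of `edgeZ` is one of them. -/
lemma firstMomentRate_eq (hΔ : 3 ≤ Δ) (hB₁ : 0 ≤ B₁) (hB₂ : 0 ≤ B₂) (hlam : 0 < lam)
    (hα : α ∈ Set.Icc (0 : ℝ) 1) (hβ : β ∈ Set.Icc (0 : ℝ) 1)
    (hαβ : α = bestResponse Δ B₁ B₂ lam β) (hβα : β = bestResponse Δ B₁ B₂ lam α) :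
    firstMomentRate Δ B₁ B₂ lam (α, β)
      = ((Δ * Real.log (edgeZ Δ B₁ B₂ lam α β) : ℝ) : EReal) := by
  refine le_antisymm (firstMomentRate_le hΔ hB₁ hB₂ hlam hα hβ le_rfl) ?_
  obtain ⟨γ, hγ, he⟩ := exists_rateFn_eq hΔ hB₁ hB₂ hlam hα hβ hαβ hβα
  rw [← he]
  exact le_iSup₂ (f := fun γ _ => ((rateFn Δ B₁ B₂ lam α β γ : ℝ) : EReal)) γ hγ

/-- The first moment rate and `edgeZ` have the same maximizers. -/
theorem mem_maximizers_iff (hΔ : 3 ≤ Δ) (hB₁ : 0 ≤ B₁) (hB₂ : 0 ≤ B₂) (hlam : 0 < lam) :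
    (α, β) ∈ maximizers (firstMomentRate Δ B₁ B₂ lam) ↔
      α ∈ Set.Icc (0 : ℝ) 1 ∧ β ∈ Set.Icc (0 : ℝ) 1 ∧
      ∀ α' ∈ Set.Icc (0 : ℝ) 1, ∀ β' ∈ Set.Icc (0 : ℝ) 1,
        edgeZ Δ B₁ B₂ lam α' β' ≤ edgeZ Δ B₁ B₂ lam α β := by
  constructor
  · rintro ⟨⟨hα, hβ⟩, hmax⟩
    refine ⟨hα, hβ, ?_⟩
    obtain ⟨a, ha, b, hb, hab⟩ := exists_isMaxOn_edgeZ (B₁ := B₁) (B₂ := B₂) (lam := lam) hΔ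
    obtain ⟨h1, h2⟩ := exists_fixed_of_isMaxOn_edgeZ hΔ hB₁ hB₂ hlam ha hb hab
    have hle : firstMomentRate Δ B₁ B₂ lam (a, b) ≤ firstMomentRate Δ B₁ B₂ lam (α, β) :=
      hmax (Set.mk_mem_prod ha hb)
    rw [firstMomentRate_eq hΔ hB₁ hB₂ hlam ha hb h1 h2] at hle
    -- The rate is finite at a maximizer of `edgeZ`, hence also at (α, β), whose feasible set is
    -- therefore nonempty.
    have hpos : 0 < edgeZ Δ B₁ B₂ lam α β := by
      by_contra hneg
      have hempty : firstMomentRate Δ B₁ B₂ lam (α, β) ≤ ⊥ := iSup₂_le fun γ hγ =>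
        absurd (edgeZ_pos_of_feasible hB₁ hB₂ hlam hα hβ hγ) hneg
      exact EReal.coe_ne_bot _ (le_bot_iff.1 (hle.trans hempty))
    have hpos' : 0 < edgeZ Δ B₁ B₂ lam a b := by
      rw [h1]; exact edgeZ_bestResponse_pos hΔ hB₁ hB₂ hlam hb
    have h := EReal.coe_le_coe_iff.1
      (hle.trans (firstMomentRate_le hΔ hB₁ hB₂ hlam hα hβ le_rfl))
    have hΔ0 : (0 : ℝ) < Δ := by exact_mod_cast (by omega : 0 < Δ)
    have h := (Real.log_le_log_iff hpos' hpos).1 (le_of_mul_le_mul_left h hΔ0)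
    exact fun a' ha' b' hb' => (hab a' ha' b' hb').trans h
  · rintro ⟨hα, hβ, hmax⟩
    obtain ⟨h1, h2⟩ := exists_fixed_of_isMaxOn_edgeZ hΔ hB₁ hB₂ hlam hα hβ hmax
    refine ⟨⟨hα, hβ⟩, fun x hx => ?_⟩
    change firstMomentRate Δ B₁ B₂ lam x ≤ firstMomentRate Δ B₁ B₂ lam (α, β)
    rw [firstMomentRate_eq hΔ hB₁ hB₂ hlam hα hβ h1 h2]
    exact firstMomentRate_le hΔ hB₁ hB₂ hlam hx.1 hx.2 (hmax _ hx.1 _ hx.2)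

lemma message_bestResponse (hΔ : 3 ≤ Δ) (hB₁ : 0 ≤ B₁) (hB₂ : 0 ≤ B₂) (hlam : 0 < lam)
    (hβ : β ∈ Set.Icc (0 : ℝ) 1) : message Δ lam (bestResponse Δ B₁ B₂ lam β)
      = treeMap B₁ B₂ lam (Δ - 1) (message Δ lam β) :=
  message_treeMap hΔ hB₁ hB₂ hlam (message_mem_Icc hlam hβ)

/-- A maximizer of `edgeZ` in terms of a fixed point of the two-step tree recursion. -/
lemma exists_treeMap_of_max (hΔ : 3 ≤ Δ) (hB₁ : 0 ≤ B₁) (hB₂ : 0 ≤ B₂) (hlam : 0 < lam)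
    (hα : α ∈ Set.Icc (0 : ℝ) 1) (hβ : β ∈ Set.Icc (0 : ℝ) 1)
    (hmax : ∀ α' ∈ Set.Icc (0 : ℝ) 1, ∀ β' ∈ Set.Icc (0 : ℝ) 1,
      edgeZ Δ B₁ B₂ lam α' β' ≤ edgeZ Δ B₁ B₂ lam α β) :
    ∃ p ∈ Set.Icc (0 : ℝ) 1,
      treeMap B₁ B₂ lam (Δ - 1) (treeMap B₁ B₂ lam (Δ - 1) p) = p ∧
      α = treeMap B₁ B₂ lam Δ p ∧ β = treeMap B₁ B₂ lam Δ (treeMap B₁ B₂ lam (Δ - 1) p) := by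
  obtain ⟨h1, h2⟩ := exists_fixed_of_isMaxOn_edgeZ hΔ hB₁ hB₂ hlam hα hβ hmax
  have hma : message Δ lam α = treeMap B₁ B₂ lam (Δ - 1) (message Δ lam β) := by
    rw [h1, message_bestResponse hΔ hB₁ hB₂ hlam hβ]
  have hmb : message Δ lam β = treeMap B₁ B₂ lam (Δ - 1) (message Δ lam α) := by
    conv_lhs => rw [h2, message_bestResponse hΔ hB₁ hB₂ hlam hα]
  refine ⟨message Δ lam β, message_mem_Icc hlam hβ, ?_, h1, ?_⟩
  · rw [← hma, ← hmb]
  · rw [← hma]; exact h2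

/-- If the two-step tree recursion has a single fixed point, then the first moment rate has a
single maximizer. -/
theorem maximizers_of_unique (hΔ : 3 ≤ Δ) (hB₁ : 0 ≤ B₁) (hB₂ : 0 ≤ B₂) (hlam : 0 < lam)
    {s : ℝ} (hTs : treeMap B₁ B₂ lam (Δ - 1) s = s)
    (huniq : ∀ p ∈ Set.Icc (0 : ℝ) 1,
      treeMap B₁ B₂ lam (Δ - 1) (treeMap B₁ B₂ lam (Δ - 1) p) = p → p = s) :
    maximizers (firstMomentRate Δ B₁ B₂ lam)
      = {(treeMap B₁ B₂ lam Δ s, treeMap B₁ B₂ lam Δ s)} := by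
  have key : ∀ α ∈ Set.Icc (0 : ℝ) 1, ∀ β ∈ Set.Icc (0 : ℝ) 1,
      (∀ α' ∈ Set.Icc (0 : ℝ) 1, ∀ β' ∈ Set.Icc (0 : ℝ) 1,
        edgeZ Δ B₁ B₂ lam α' β' ≤ edgeZ Δ B₁ B₂ lam α β) →
      α = treeMap B₁ B₂ lam Δ s ∧ β = treeMap B₁ B₂ lam Δ s := by
    intro α hα β hβ hmax
    obtain ⟨p, hp, hTp, h1, h2⟩ := exists_treeMap_of_max hΔ hB₁ hB₂ hlam hα hβ hmax
    obtain rfl := huniq p hp hTp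
    rw [hTs] at h2
    exact ⟨h1, h2⟩
  obtain ⟨a, ha, b, hb, hab⟩ := exists_isMaxOn_edgeZ (B₁ := B₁) (B₂ := B₂) (lam := lam) hΔ
  ext ⟨α, β⟩
  rw [mem_maximizers_iff hΔ hB₁ hB₂ hlam, Set.mem_singleton_iff, Prod.mk.injEq]
  constructor
  · rintro ⟨hα, hβ, hmax⟩
    exact key α hα β hβ hmax
  · rintro ⟨h1, h2⟩
    obtain ⟨h3, h4⟩ := key a ha b hb hab
    rw [← h1] at h3
    rw [← h2] at h4
    subst h3 h4
    exact ⟨ha, hb, hab⟩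

/-- The maximizers of the first moment rate when the two-step tree recursion has fixed points
other than that of the tree recursion, in the antiferromagnetic case. -/
theorem maximizers_of_not_unique (hΔ : 3 ≤ Δ) (hB₁ : 0 ≤ B₁) (hB₂ : 0 ≤ B₂) (hlam : 0 < lam)
    (hB : B₁ * B₂ < 1) {a s b : ℝ}
    (ha : 0 ≤ a) (hb : b ≤ 1) (has : a < s) (hsb : s < b)
    (hTs : treeMap B₁ B₂ lam (Δ - 1) s = s) (hTa : treeMap B₁ B₂ lam (Δ - 1) a = b)
    (hTb : treeMap B₁ B₂ lam (Δ - 1) b = a)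
    (hext : ∀ p ∈ Set.Icc (0 : ℝ) 1,
      treeMap B₁ B₂ lam (Δ - 1) (treeMap B₁ B₂ lam (Δ - 1) p) = p → p ∈ Set.Icc a b) :
    maximizers (firstMomentRate Δ B₁ B₂ lam)
      = {(treeMap B₁ B₂ lam Δ a, treeMap B₁ B₂ lam Δ b),
         (treeMap B₁ B₂ lam Δ b, treeMap B₁ B₂ lam Δ a)} := by
  obtain ⟨hfix, hrep⟩ := two_step_fixed_points hB₁ hB₂ hlam hB (by omega) ha hb has hsb hTs hTa
    hTb hext
  have haI : a ∈ Set.Icc (0 : ℝ) 1 := ⟨ha, by linarith⟩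
  have hsI : s ∈ Set.Icc (0 : ℝ) 1 := ⟨by linarith, by linarith⟩
  have hbI : b ∈ Set.Icc (0 : ℝ) 1 := ⟨by linarith, hb⟩
  have hRsI := treeMap_mem_Icc hB₁ hB₂ hlam Δ hsI
  have hRbI := treeMap_mem_Icc hB₁ hB₂ hlam Δ hbI
  have hms : message Δ lam (treeMap B₁ B₂ lam Δ s) = s := by
    rw [message_treeMap hΔ hB₁ hB₂ hlam hsI, hTs]
  have hmb : message Δ lam (treeMap B₁ B₂ lam Δ b) = a := by
    rw [message_treeMap hΔ hB₁ hB₂ hlam hbI, hTb]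
  have hmono := strictMonoOn_message (Δ := Δ) hΔ hlam
  have hlt : treeMap B₁ B₂ lam Δ b < treeMap B₁ B₂ lam Δ s := by
    rw [← hmono.lt_iff_lt hRbI hRsI, hms, hmb]; exact has
  -- The increasing map `message` conjugates the best response to the tree recursion and sends the
  -- root marginals of b and s to a and s. The leftward motion on (a, s) thus makes the root
  -- marginal of s repelling.
  obtain ⟨x, hx, y, hy, hxy⟩ := exists_edgeZ_gt_of_repelling hΔ hB₁ hB₂ hlam hRbI.1 hRsI.2 hlt
    (by unfold bestResponse; rw [hms]) (by
      intro β hβ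
      have hβI : β ∈ Set.Icc (0 : ℝ) 1 := ⟨by linarith [hβ.1, hRbI.1], by linarith [hβ.2, hRsI.2]⟩
      have hβ' := bestResponse_mem_Icc (Δ := Δ) hB₁ hB₂ hlam hβI
      have hβ'' := bestResponse_mem_Icc (Δ := Δ) hB₁ hB₂ hlam hβ'
      rw [← hmono.lt_iff_lt hβ'' hβI, message_bestResponse hΔ hB₁ hB₂ hlam hβ',
        message_bestResponse hΔ hB₁ hB₂ hlam hβI]
      refine hrep _ ⟨?_, ?_⟩
      · rw [← hmb]; exact hmono hRbI hβI hβ.1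
      · rw [← hms]; exact hmono hβI hRsI hβ.2)
  have key : ∀ α ∈ Set.Icc (0 : ℝ) 1, ∀ β ∈ Set.Icc (0 : ℝ) 1,
      (∀ α' ∈ Set.Icc (0 : ℝ) 1, ∀ β' ∈ Set.Icc (0 : ℝ) 1,
        edgeZ Δ B₁ B₂ lam α' β' ≤ edgeZ Δ B₁ B₂ lam α β) →
      (α = treeMap B₁ B₂ lam Δ a ∧ β = treeMap B₁ B₂ lam Δ b) ∨
      (α = treeMap B₁ B₂ lam Δ b ∧ β = treeMap B₁ B₂ lam Δ a) := by
    intro α hα β hβ hmax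
    obtain ⟨p, hp, hTp, h1, h2⟩ := exists_treeMap_of_max hΔ hB₁ hB₂ hlam hα hβ hmax
    rcases hfix p hp hTp with rfl | rfl | rfl
    · rw [hTa] at h2; exact Or.inl ⟨h1, h2⟩
    · rw [hTs] at h2
      subst h1 h2
      exact absurd (hmax x hx y hy) (not_le.2 hxy)
    · rw [hTb] at h2; exact Or.inr ⟨h1, h2⟩
  obtain ⟨a', ha', b', hb', hab⟩ := exists_isMaxOn_edgeZ (B₁ := B₁) (B₂ := B₂) (lam := lam) hΔ
  -- By symmetry the swapped pair is a maximizer too, so both orders of the cycle occur.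
  have hab' : ∀ α' ∈ Set.Icc (0 : ℝ) 1, ∀ β' ∈ Set.Icc (0 : ℝ) 1,
      edgeZ Δ B₁ B₂ lam α' β' ≤ edgeZ Δ B₁ B₂ lam b' a' := fun α' hα' β' hβ' => by
    rw [edgeZ_comm b' a']; exact hab α' hα' β' hβ'
  ext ⟨α, β⟩
  rw [mem_maximizers_iff hΔ hB₁ hB₂ hlam, Set.mem_insert_iff, Set.mem_singleton_iff,
    Prod.mk.injEq, Prod.mk.injEq]
  constructor
  · rintro ⟨hα, hβ, hmax⟩
    exact key α hα β hβ hmax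
  · rintro (⟨rfl, rfl⟩ | ⟨rfl, rfl⟩) <;> rcases key a' ha' b' hb' hab with ⟨rfl, rfl⟩ | ⟨rfl, rfl⟩
    · exact ⟨ha', hb', hab⟩
    · exact ⟨hb', ha', hab'⟩
    · exact ⟨hb', ha', hab'⟩
    · exact ⟨ha', hb', hab⟩

end Maximizers

/-! ### Summing out the tree level by level. -/

section Tree

variable {B₁ B₂ lam : ℝ} {Δ : ℕ}

/-- The vertices at distance `k` from the root. -/
abbrev Level (Δ k : ℕ) : Type := {v : TreeVertex Δ // v.1.length = k}

noncomputable instance instFintypeLevel (Δ k : ℕ) : Fintype (Level Δ k) :=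
  haveI : Finite (Level Δ k) :=
    Finite.of_injective (fun v : Level Δ k => (⟨v.1, v.2.le⟩ : Ball Δ k))
      fun _ _ huv => Subtype.ext (by simpa using huv)
  Fintype.ofFinite _

/-- The part of the weight of a configuration that belongs to a vertex and the edge to its
parent. -/
def localFactor (B₁ B₂ lam : ℝ) (η : Config Δ) (v : TreeVertex Δ) : ℝ :=
  vertexFactor lam (η v) * if v = root Δ then 1 else edgeFactor B₁ B₂ (η v) (η (parent v))

lemma extend_of_le {h : ℕ} (σ : Ball Δ h → Spin) {v : TreeVertex Δ} (hv : v.1.length ≤ h) :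
    extend σ v = σ ⟨v, hv⟩ := dif_pos hv

lemma parent_length_le {h : ℕ} {v : TreeVertex Δ} (hv : v.1.length ≤ h) :
    (parent v).1.length ≤ h := le_trans (by simp [parent]) hv

lemma weight_ballEnds {h : ℕ} (σ : Ball Δ h → Spin) :
    weight B₁ B₂ lam (ballEnds Δ h) σ = ∏ v : Ball Δ h, localFactor B₁ B₂ lam (extend σ) v.1 := by
  rw [weight_eq_prod]
  unfold localFactor
  rw [Finset.prod_mul_distrib]
  congr 1
  · exact Finset.prod_congr rfl fun v _ => by rw [extend_of_le σ v.2]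
  · rw [Finset.prod_ite, Finset.prod_const_one, one_mul,
      Finset.prod_subtype (p := fun v : Ball Δ h => v.1 ≠ root Δ) _ (by simp)]
    refine Finset.prod_congr rfl fun e _ => ?_
    rw [extend_of_le σ e.1.2, extend_of_le σ (parent_length_le e.1.2)]
    rfl

/-- The sum of the weights of the configurations on the ball of radius `k`, with extra factors `m`
for the vertices at level `k`. -/
noncomputable def msgZ (B₁ B₂ lam : ℝ) (k : ℕ) (m : TreeVertex Δ → Spin → ℝ)
    (g : Config Δ → ℝ) : ℝ :=
  ∑ σ : Ball Δ k → Spin, (∏ v : Ball Δ k, localFactor B₁ B₂ lam (extend σ) v.1)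
    * g (extend σ) * ∏ u : Level Δ k, m u.1 (extend σ u.1)

/-- The children of a vertex. -/
abbrev Child {Δ : ℕ} (w : TreeVertex Δ) : Type := {i : Fin Δ // (i :: w.1).IsChain (· ≠ ·)}

/-- A child, as a vertex. -/
def childVertex {w : TreeVertex Δ} (i : Child w) : TreeVertex Δ := ⟨i.1 :: w.1, i.2⟩

/-- The factor contributed to the spin `s` by a neighbour with message `c`. -/
def transfer (B₁ B₂ lam : ℝ) (c : Spin → ℝ) (s : Spin) : ℝ :=
  ∑ t : Spin, vertexFactor lam t * edgeFactor B₁ B₂ t s * c t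

/-- The messages of the vertices, given those of their children. -/
def pushMsg (B₁ B₂ lam : ℝ) (m : TreeVertex Δ → Spin → ℝ) (w : TreeVertex Δ) (s : Spin) : ℝ :=
  ∏ i : Child w, transfer B₁ B₂ lam (m (childVertex i)) s

/-- The vertices at level `k + 1` are the children of the vertices at level `k`. -/
def levelSuccEquiv (Δ k : ℕ) : (Σ w : Level Δ k, Child w.1) ≃ Level Δ (k + 1) where
  toFun c := ⟨childVertex c.2, by simp [childVertex, c.1.2]⟩
  invFun v := ⟨⟨parent v.1, by simp [parent, v.2]⟩, ⟨v.1.1.head (by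
    intro h; have := v.2; simp [h] at this), by
      have : v.1.1 ≠ [] := by intro h; have := v.2; simp [h] at this
      simp only [parent, List.cons_head_tail]; exact v.1.2⟩⟩
  left_inv := by rintro ⟨⟨⟨w, hw⟩, hk⟩, ⟨i, hi⟩⟩; rfl
  right_inv v := Subtype.ext (Subtype.ext (by simp [childVertex, parent]))

/-- The ball of radius `k + 1` is the union of the ball of radius `k` and level `k + 1`. -/
def ballSuccEquiv (Δ k : ℕ) : Ball Δ k ⊕ Level Δ (k + 1) ≃ Ball Δ (k + 1) where
  toFun := Sum.elim (fun v => ⟨v.1, v.2.trans (Nat.le_succ k)⟩) fun v => ⟨v.1, v.2.le⟩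
  invFun v := if h : v.1.1.length ≤ k then Sum.inl ⟨v.1, h⟩
    else Sum.inr ⟨v.1, le_antisymm v.2 (by omega)⟩
  left_inv := by
    rintro (v | v)
    · simp [v.2]
    · simp [v.2]
  right_inv v := by
    by_cases h : v.1.1.length ≤ k <;> simp [h]

/-- Configurations on the ball of radius `k + 1` are pairs of configurations. -/
def ballConfigEquiv (Δ k : ℕ) :
    (Ball Δ k → Spin) × (Level Δ (k + 1) → Spin) ≃ (Ball Δ (k + 1) → Spin) :=
  (Equiv.sumArrowEquivProdArrow _ _ _).symm.trans
    (Equiv.arrowCongr (ballSuccEquiv Δ k) (Equiv.refl _))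

lemma extend_ballConfigEquiv_of_le {k : ℕ} (x : Ball Δ k → Spin) (y : Level Δ (k + 1) → Spin)
    {v : TreeVertex Δ} (hv : v.1.length ≤ k) :
    extend (ballConfigEquiv Δ k (x, y)) v = extend x v := by
  rw [extend_of_le x hv, extend_of_le _ (hv.trans (Nat.le_succ k))]
  simp [ballConfigEquiv, ballSuccEquiv, Equiv.sumArrowEquivProdArrow, hv]

lemma extend_ballConfigEquiv_of_eq {k : ℕ} (x : Ball Δ k → Spin) (y : Level Δ (k + 1) → Spin)
    {v : TreeVertex Δ} (hv : v.1.length = k + 1) :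
    extend (ballConfigEquiv Δ k (x, y)) v = y ⟨v, hv⟩ := by
  rw [extend_of_le _ hv.le]
  simp [ballConfigEquiv, ballSuccEquiv, Equiv.sumArrowEquivProdArrow, hv]

/-- The function `g` depends only on the spins in the ball of radius `k`. -/
def IsLocal (k : ℕ) (g : Config Δ → ℝ) : Prop :=
  ∀ η η' : Config Δ, (∀ v : TreeVertex Δ, v.1.length ≤ k → η v = η' v) → g η = g η'

lemma IsLocal.mono {k k' : ℕ} {g : Config Δ → ℝ} (hg : IsLocal k g) (hk : k ≤ k') :
    IsLocal k' g := fun η η' h => hg η η' fun v hv => h v (hv.trans hk)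

lemma isLocal_const (k : ℕ) (c : ℝ) : IsLocal (Δ := Δ) k fun _ => c := fun _ _ _ => rfl

/-- Summing over the spins of the outermost level. -/
theorem msgZ_succ {k : ℕ} (m : TreeVertex Δ → Spin → ℝ) {g : Config Δ → ℝ} (hg : IsLocal k g) :
    msgZ B₁ B₂ lam (k + 1) m g = msgZ B₁ B₂ lam k (pushMsg B₁ B₂ lam m) g := by
  unfold msgZ
  rw [← (ballConfigEquiv Δ k).sum_comp, Fintype.sum_prod_type]
  refine Finset.sum_congr rfl fun x _ => ?_
  have hterm : ∀ y : Level Δ (k + 1) → Spin,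
      (∏ v : Ball Δ (k + 1), localFactor B₁ B₂ lam (extend (ballConfigEquiv Δ k (x, y))) v.1)
        * g (extend (ballConfigEquiv Δ k (x, y)))
        * ∏ u : Level Δ (k + 1), m u.1 (extend (ballConfigEquiv Δ k (x, y)) u.1)
      = (∏ v : Ball Δ k, localFactor B₁ B₂ lam (extend x) v.1) * g (extend x)
        * ∏ u : Level Δ (k + 1), vertexFactor lam (y u)
            * edgeFactor B₁ B₂ (y u) (extend x (parent u.1)) * m u.1 (y u) := by
    intro y
    rw [← (ballSuccEquiv Δ k).prod_comp, Fintype.prod_sum_type,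
      hg _ (extend x) fun v hv => extend_ballConfigEquiv_of_le x y hv]
    have h1 : ∀ v : Ball Δ k, localFactor B₁ B₂ lam (extend (ballConfigEquiv Δ k (x, y)))
        (ballSuccEquiv Δ k (Sum.inl v)).1 = localFactor B₁ B₂ lam (extend x) v.1 := by
      intro v
      have : (ballSuccEquiv Δ k (Sum.inl v)).1 = v.1 := rfl
      rw [this]
      unfold localFactor
      rw [extend_ballConfigEquiv_of_le x y v.2,
        extend_ballConfigEquiv_of_le x y (parent_length_le v.2)]
    have h2 : ∀ u : Level Δ (k + 1),
        localFactor B₁ B₂ lam (extend (ballConfigEquiv Δ k (x, y)))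
          (ballSuccEquiv Δ k (Sum.inr u)).1
        = vertexFactor lam (y u) * edgeFactor B₁ B₂ (y u) (extend x (parent u.1)) := by
      intro u
      have hu : (ballSuccEquiv Δ k (Sum.inr u)).1 = u.1 := rfl
      have hroot : u.1 ≠ root Δ := by
        intro h; have := u.2; rw [h] at this; simp [root] at this
      rw [hu]
      unfold localFactor
      rw [if_neg hroot, extend_ballConfigEquiv_of_eq x y u.2,
        extend_ballConfigEquiv_of_le x y (by simp [parent, u.2])]
    simp only [h1, h2]
    have h3 : ∀ u : Level Δ (k + 1), m u.1 (extend (ballConfigEquiv Δ k (x, y)) u.1)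
        = m u.1 (y u) := fun u => by rw [extend_ballConfigEquiv_of_eq x y u.2]
    simp only [h3]
    rw [Finset.prod_mul_distrib (f := fun u : Level Δ (k + 1) => vertexFactor lam (y u)
            * edgeFactor B₁ B₂ (y u) (extend x (parent u.1)))]
    ring
  rw [Finset.sum_congr rfl fun y _ => hterm y, ← Finset.mul_sum]
  congr 1
  -- Given the inner spins, the spins of the outer level are independent: the sum of products is a
  -- product of sums, regrouped by parent.
  have hprod := Finset.prod_univ_sum (fun _ : Level Δ (k + 1) => (Finset.univ : Finset Spin))
    fun u t => vertexFactor lam t * edgeFactor B₁ B₂ t (extend x (parent u.1)) * m u.1 t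
  rw [Fintype.piFinset_univ] at hprod
  rw [← hprod, ← (levelSuccEquiv Δ k).prod_comp, Fintype.prod_sigma]
  rfl

lemma msgZ_zero (m : TreeVertex Δ → Spin → ℝ) (g : Config Δ → ℝ) (G : Spin → ℝ)
    (hg : ∀ η, g η = G (η (root Δ))) :
    msgZ B₁ B₂ lam 0 m g = lam * m (root Δ) true * G true + m (root Δ) false * G false := by
  have hroot : ∀ v : TreeVertex Δ, v.1.length ≤ 0 → v = root Δ := fun v hv =>
    Subtype.ext (List.length_eq_zero_iff.1 (Nat.le_zero.1 hv))
  let _ : Unique (Ball Δ 0) := ⟨⟨⟨root Δ, by simp [root]⟩⟩, fun v => Subtype.ext (hroot v.1 v.2)⟩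
  let _ : Unique (Level Δ 0) :=
    ⟨⟨⟨root Δ, by simp [root]⟩⟩, fun v => Subtype.ext (hroot v.1 v.2.le)⟩
  have hd : (default : Ball Δ 0).1 = root Δ := rfl
  have hl : (default : Level Δ 0).1 = root Δ := rfl
  unfold msgZ
  rw [← (Equiv.funUnique (Ball Δ 0) Spin).symm.sum_comp]
  have h : ∀ t : Spin, extend ((Equiv.funUnique (Ball Δ 0) Spin).symm t) (root Δ) = t := by
    intro t
    rw [extend_of_le _ (by simp [root])]
    rfl
  simp only [Fintype.prod_unique, hd, hl, h, hg, Fintype.sum_bool, localFactor, vertexFactor]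
  simp
  ring

lemma msgZ_congr {k : ℕ} {m m' : TreeVertex Δ → Spin → ℝ} (g : Config Δ → ℝ)
    (h : ∀ u : TreeVertex Δ, u.1.length = k → m u = m' u) :
    msgZ B₁ B₂ lam k m g = msgZ B₁ B₂ lam k m' g := by
  unfold msgZ
  refine Finset.sum_congr rfl fun σ _ => ?_
  have h' : ∀ u : Level Δ k, m u.1 = m' u.1 := fun u => h u.1 u.2
  simp only [h']

lemma msgZ_smul {k : ℕ} (r : ℝ) (m : TreeVertex Δ → Spin → ℝ) (g : Config Δ → ℝ) :
    msgZ B₁ B₂ lam k (fun u t => r * m u t) g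
      = r ^ Fintype.card (Level Δ k) * msgZ B₁ B₂ lam k m g := by
  unfold msgZ
  rw [Finset.mul_sum]
  refine Finset.sum_congr rfl fun σ _ => ?_
  rw [Finset.prod_mul_distrib, Finset.prod_const, Finset.card_univ]
  ring

open Classical in
lemma sum_boundary {h : ℕ} (τ : Config Δ) (f : Config Δ → ℝ) :
    ∑ σ ∈ Finset.univ.filter (fun σ => σ ∈ boundary Δ h τ),
      weight B₁ B₂ lam (ballEnds Δ h) σ * f (extend σ)
      = msgZ B₁ B₂ lam h (fun u t => if t = τ u then 1 else 0) f := by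
  unfold msgZ
  rw [Finset.sum_filter]
  refine Finset.sum_congr rfl fun σ _ => ?_
  rw [Fintype.prod_boole, weight_ballEnds]
  have : (σ ∈ boundary Δ h τ) ↔ ∀ u : Level Δ h, extend σ u.1 = τ u.1 := by
    constructor
    · intro hσ u
      rw [extend_of_le σ u.2.le]
      exact hσ _ u.2
    · intro hσ v hv
      have := hσ ⟨v.1, hv⟩
      rwa [extend_of_le σ v.2] at this
  by_cases hσ : σ ∈ boundary Δ h τ
  · rw [if_pos hσ, if_pos (this.1 hσ), mul_one]
  · rw [if_neg hσ, if_neg (fun h => hσ (this.2 h)), mul_zero]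

lemma ballZ_boundary {h : ℕ} (τ : Config Δ) : ballZ B₁ B₂ lam (boundary Δ h τ)
    = msgZ B₁ B₂ lam h (fun u t => if t = τ u then 1 else 0) fun _ => 1 := by
  rw [← sum_boundary]
  simp [ballZ]

lemma ballExp_boundary {h : ℕ} (τ : Config Δ) (f : Config Δ → ℝ) :
    ballExp B₁ B₂ lam (boundary Δ h τ) f
      = msgZ B₁ B₂ lam h (fun u t => if t = τ u then 1 else 0) f
        / msgZ B₁ B₂ lam h (fun u t => if t = τ u then 1 else 0) fun _ => 1 := by
  rw [ballExp, ballZ_boundary, sum_boundary]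

lemma ballExp_univ {h : ℕ} (f : Config Δ → ℝ) :
    ballExp B₁ B₂ lam (Set.univ : Set (Ball Δ h → Spin)) f
      = msgZ B₁ B₂ lam h (fun _ _ => 1) f / msgZ (Δ := Δ) B₁ B₂ lam h (fun _ _ => 1) fun _ => 1 := by
  simp [ballExp, ballZ, msgZ, weight_ballEnds]

/-- The message of a vertex whose spin is `-1` with probability `p`. -/
noncomputable def probMsg (lam p : ℝ) (t : Spin) : ℝ := if t = true then p / lam else 1 - p

lemma transfer_eq (c : Spin → ℝ) : transfer B₁ B₂ lam c true = B₁ * (lam * c true) + c false ∧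
    transfer B₁ B₂ lam c false = lam * c true + B₂ * c false := by
  constructor
  · simp [transfer, vertexFactor, edgeFactor]; ring
  · simp [transfer, vertexFactor, edgeFactor]

lemma card_child_root : Fintype.card (Child (root Δ)) = Δ := by
  have : Fintype.card (Child (root Δ)) = Fintype.card (Fin Δ) :=
    Fintype.card_congr (Equiv.subtypeUnivEquiv fun i => by simp [root])
  rw [this, Fintype.card_fin]

lemma card_child {w : TreeVertex Δ} (hw : w.1.length ≠ 0) : Fintype.card (Child w) = Δ - 1 := by
  obtain ⟨w, hchain⟩ := w
  match w, hchain, hw with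
  | j :: w, hchain, _ =>
    have h : ∀ i : Fin Δ, (i :: (j :: w)).IsChain (· ≠ ·) ↔ i ≠ j := fun i => by
      rw [List.isChain_cons_cons]
      exact and_iff_left hchain
    have : Fintype.card (Child (⟨j :: w, hchain⟩ : TreeVertex Δ))
        = Fintype.card {i : Fin Δ // i ≠ j} :=
      Fintype.card_congr (Equiv.subtypeEquivRight h)
    rw [this, Fintype.card_subtype_compl, Fintype.card_fin, Fintype.card_subtype_eq]

/-- The division by λ in `probMsg` cancels the vertex factor inside `transfer`, so p enters as a
true probability and one step is `treeMap` up to normalisation. -/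
lemma pushMsg_probMsg (hB₁ : 0 ≤ B₁) (hB₂ : 0 ≤ B₂) (hlam : 0 < lam) {p : ℝ}
    (hp : p ∈ Set.Icc (0 : ℝ) 1) (w : TreeVertex Δ) {k : ℕ} (hk : Fintype.card (Child w) = k) :
    pushMsg B₁ B₂ lam (fun _ => probMsg lam p) w
      = fun t => treeTotal B₁ B₂ lam k p * probMsg lam (treeMap B₁ B₂ lam k p) t := by
  have htot := (treeTotal_pos hB₁ hB₂ hlam k hp).ne'
  obtain ⟨h1, h2⟩ := transfer_eq (B₁ := B₁) (B₂ := B₂) (lam := lam) (probMsg lam p)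
  have hlp : lam * (p / lam) = p := mul_div_cancel₀ _ hlam.ne'
  simp only [probMsg, if_true, hlp, Bool.false_eq_true, if_false] at h1 h2
  funext t
  cases t
  · simp only [pushMsg, Finset.prod_const, Finset.card_univ, hk, probMsg, Bool.false_eq_true,
      if_false]
    rw [one_sub_treeMap hB₁ hB₂ hlam k hp, mul_div_cancel₀ _ htot]
    exact congrArg (· ^ k) h2
  · simp only [pushMsg, Finset.prod_const, Finset.card_univ, hk, probMsg, if_true]
    rw [treeMap, mul_div_assoc', mul_div_cancel₀ _ htot, mul_div_cancel_left₀ _ hlam.ne']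
    exact congrArg (· ^ k) h1

/-- `msgZ` with the message `(p, 1 - p)` at all vertices of level `k`. -/
noncomputable def homZ (B₁ B₂ lam : ℝ) (k : ℕ) (p : ℝ) (g : Config Δ → ℝ) : ℝ :=
  msgZ B₁ B₂ lam k (fun _ => probMsg lam p) g

/-- The expectation on the ball of radius `k` with the message `(p, 1 - p)` at all vertices of
level `k`. -/
noncomputable def homExp (B₁ B₂ lam : ℝ) (k : ℕ) (p : ℝ) (g : Config Δ → ℝ) : ℝ :=
  homZ B₁ B₂ lam k p g / homZ (Δ := Δ) B₁ B₂ lam k p fun _ => 1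

lemma homZ_succ (hB₁ : 0 ≤ B₁) (hB₂ : 0 ≤ B₂) (hlam : 0 < lam) {p : ℝ}
    (hp : p ∈ Set.Icc (0 : ℝ) 1) {k : ℕ} {g : Config Δ → ℝ} (hg : IsLocal k g) {c : ℕ}
    (hc : ∀ w : TreeVertex Δ, w.1.length = k → Fintype.card (Child w) = c) :
    homZ B₁ B₂ lam (k + 1) p g = treeTotal B₁ B₂ lam c p ^ Fintype.card (Level Δ k)
      * homZ B₁ B₂ lam k (treeMap B₁ B₂ lam c p) g := by
  unfold homZ
  rw [msgZ_succ _ hg, ← msgZ_smul]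
  exact msgZ_congr g fun w hw => pushMsg_probMsg hB₁ hB₂ hlam hp w (hc w hw)

/-- The number of children of a vertex of level `k`. -/
def childCount (Δ k : ℕ) : ℕ := if k = 0 then Δ else Δ - 1

lemma card_child_eq {k : ℕ} (w : TreeVertex Δ) (hw : w.1.length = k) :
    Fintype.card (Child w) = childCount Δ k := by
  unfold childCount
  split_ifs with h
  · have : w = root Δ := Subtype.ext (List.length_eq_zero_iff.1 (hw.trans h))
    rw [this, card_child_root]
  · exact card_child (by omega)

lemma homZ_zero (hlam : 0 < lam) (p : ℝ) (g : Config Δ → ℝ) (G : Spin → ℝ)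
    (hg : ∀ η, g η = G (η (root Δ))) :
    homZ B₁ B₂ lam 0 p g = p * G true + (1 - p) * G false := by
  rw [homZ, msgZ_zero _ g G hg]
  simp [probMsg, mul_div_cancel₀ p hlam.ne']

lemma homZ_one_pos (hB₁ : 0 ≤ B₁) (hB₂ : 0 ≤ B₂) (hlam : 0 < lam) (k : ℕ) {p : ℝ}
    (hp : p ∈ Set.Icc (0 : ℝ) 1) : 0 < homZ (Δ := Δ) B₁ B₂ lam k p fun _ => 1 := by
  induction k generalizing p with
  | zero => rw [homZ_zero hlam p (fun _ => 1) (fun _ => 1) fun _ => rfl]; simp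
  | succ k ih =>
    rw [homZ_succ hB₁ hB₂ hlam hp (isLocal_const k 1) card_child_eq]
    exact mul_pos (pow_pos (treeTotal_pos hB₁ hB₂ hlam _ hp) _)
      (ih (treeMap_mem_Icc hB₁ hB₂ hlam _ hp))

lemma homExp_succ (hB₁ : 0 ≤ B₁) (hB₂ : 0 ≤ B₂) (hlam : 0 < lam) {p : ℝ}
    (hp : p ∈ Set.Icc (0 : ℝ) 1) {k : ℕ} {g : Config Δ → ℝ} (hg : IsLocal k g) :
    homExp B₁ B₂ lam (k + 1) p g
      = homExp B₁ B₂ lam k (treeMap B₁ B₂ lam (childCount Δ k) p) g := by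
  unfold homExp
  rw [homZ_succ hB₁ hB₂ hlam hp hg card_child_eq,
    homZ_succ hB₁ hB₂ hlam hp (isLocal_const k 1) card_child_eq,
    mul_div_mul_left _ _ (pow_pos (treeTotal_pos hB₁ hB₂ hlam _ hp) _).ne']

/-- The normalisations cancel in the quotient. The condition k ≠ 0 keeps the root, with its Δ
instead of Δ - 1 children, out of the iteration. -/
lemma homExp_add (hB₁ : 0 ≤ B₁) (hB₂ : 0 ≤ B₂) (hlam : 0 < lam) {p : ℝ}
    (hp : p ∈ Set.Icc (0 : ℝ) 1) {k : ℕ} (hk : k ≠ 0) (j : ℕ) {g : Config Δ → ℝ}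
    (hg : IsLocal k g) : homExp B₁ B₂ lam (k + j) p g
      = homExp B₁ B₂ lam k ((treeMap B₁ B₂ lam (Δ - 1))^[j] p) g := by
  induction j generalizing p with
  | zero => rfl
  | succ j ih =>
    rw [← add_assoc, homExp_succ hB₁ hB₂ hlam hp (hg.mono (Nat.le_add_right k j)),
      show childCount Δ (k + j) = Δ - 1 from if_neg (by omega),
      ih (treeMap_mem_Icc hB₁ hB₂ hlam _ hp), Function.iterate_succ_apply]

/-- The indicator of the spin `-1` at the root. -/
def rootInd (Δ : ℕ) (σ : Config Δ) : ℝ := if σ (root Δ) = true then 1 else 0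

lemma isLocal_rootInd (k : ℕ) : IsLocal (Δ := Δ) k (rootInd Δ) := fun η η' h => by
  unfold rootInd; rw [h (root Δ) (by simp [root])]

lemma homExp_rootInd (hB₁ : 0 ≤ B₁) (hB₂ : 0 ≤ B₂) (hlam : 0 < lam) {p : ℝ}
    (hp : p ∈ Set.Icc (0 : ℝ) 1) :
    homExp B₁ B₂ lam 1 p (rootInd Δ) = treeMap B₁ B₂ lam Δ p := by
  rw [homExp_succ hB₁ hB₂ hlam hp (isLocal_rootInd 0), homExp,
    homZ_zero hlam _ (rootInd Δ) (fun t => if t = true then 1 else 0) fun _ => rfl,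
    homZ_zero hlam _ (fun _ => 1) (fun _ => 1) fun _ => rfl]
  simp [childCount]

lemma continuous_homZ (k : ℕ) (g : Config Δ → ℝ) :
    Continuous fun p => homZ B₁ B₂ lam k p g := by
  have h : ∀ t : Spin, Continuous fun p => probMsg lam p t := by
    intro t; unfold probMsg; split_ifs <;> fun_prop
  unfold homZ msgZ
  fun_prop

lemma continuousOn_homExp (hB₁ : 0 ≤ B₁) (hB₂ : 0 ≤ B₂) (hlam : 0 < lam) (k : ℕ)
    (g : Config Δ → ℝ) : ContinuousOn (fun p => homExp B₁ B₂ lam k p g) (Set.Icc 0 1) :=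
  (continuous_homZ k g).continuousOn.div (continuous_homZ k _).continuousOn
    fun _ hp => (homZ_one_pos hB₁ hB₂ hlam k hp).ne'

lemma msgZ_div_eq_homExp {k : ℕ} {m : TreeVertex Δ → Spin → ℝ} {r p : ℝ} (hr : r ≠ 0)
    (hm : m = fun _ t => r * probMsg lam p t) (f : Config Δ → ℝ) :
    msgZ B₁ B₂ lam k m f / msgZ B₁ B₂ lam k m (fun _ => 1) = homExp B₁ B₂ lam k p f := by
  rw [hm, msgZ_smul r (fun _ => probMsg lam p), msgZ_smul r (fun _ => probMsg lam p),
    mul_div_mul_left _ _ (pow_ne_zero _ hr)]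
  rfl

lemma boundary_true_msg (hlam : 0 < lam) : (fun (_ : TreeVertex Δ) (t : Spin) =>
    if t = true then (1 : ℝ) else 0) = fun _ t => lam * probMsg lam 1 t := by
  funext u t
  cases t <;> simp [probMsg, hlam.ne']

lemma boundary_false_msg : (fun (_ : TreeVertex Δ) (t : Spin) =>
    if t = false then (1 : ℝ) else 0) = fun _ t => 1 * probMsg lam 0 t := by
  funext u t
  cases t <;> simp [probMsg]

lemma ballExp_boundary_true (hlam : 0 < lam) {h : ℕ} (f : Config Δ → ℝ) :
    ballExp B₁ B₂ lam (boundary Δ h fun _ => true) f = homExp B₁ B₂ lam h 1 f := by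
  rw [ballExp_boundary]
  exact msgZ_div_eq_homExp hlam.ne' (boundary_true_msg hlam) f

lemma ballExp_boundary_false {h : ℕ} (f : Config Δ → ℝ) :
    ballExp B₁ B₂ lam (boundary Δ h fun _ => false) f = homExp B₁ B₂ lam h 0 f := by
  rw [ballExp_boundary]
  exact msgZ_div_eq_homExp one_ne_zero boundary_false_msg f

/-- With free boundary, a vertex of the last level without its edge to the parent has spin -1 with
probability λ/(1 + λ). -/
lemma ballExp_univ_eq (hlam : 0 < lam) {h : ℕ} (f : Config Δ → ℝ) :
    ballExp B₁ B₂ lam (Set.univ : Set (Ball Δ h → Spin)) f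
      = homExp B₁ B₂ lam h (lam / (1 + lam)) f := by
  rw [ballExp_univ]
  refine msgZ_div_eq_homExp (r := 1 + lam) (by positivity) ?_ f
  funext u t
  have h : 1 + lam ≠ 0 := by positivity
  cases t
  · simp [probMsg]; field_simp; ring
  · simp [probMsg]; field_simp

lemma ballZ_boundary_true_pos (hB₁ : 0 ≤ B₁) (hB₂ : 0 ≤ B₂) (hlam : 0 < lam) (h : ℕ) :
    0 < ballZ B₁ B₂ lam (boundary Δ h fun _ => true) := by
  rw [ballZ_boundary, boundary_true_msg hlam, msgZ_smul lam (fun _ => probMsg lam 1)]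
  exact mul_pos (pow_pos hlam _) (homZ_one_pos hB₁ hB₂ hlam h (by simp))

lemma ballZ_boundary_false_pos (hB₁ : 0 ≤ B₁) (hB₂ : 0 ≤ B₂) (hlam : 0 < lam) (h : ℕ) :
    0 < ballZ B₁ B₂ lam (boundary Δ h fun _ => false) := by
  rw [ballZ_boundary, boundary_false_msg (lam := lam), msgZ_smul 1 (fun _ => probMsg lam 0)]
  exact mul_pos (pow_pos one_pos _) (homZ_one_pos hB₁ hB₂ hlam h (by simp))

lemma rootProb_eq (h : ℕ) (τ : Config Δ) :
    rootProb Δ B₁ B₂ lam h τ = ballExp B₁ B₂ lam (boundary Δ h τ) (rootInd Δ) := rfl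

lemma homExp_rootInd_succ (hB₁ : 0 ≤ B₁) (hB₂ : 0 ≤ B₂) (hlam : 0 < lam) (j : ℕ) {p : ℝ}
    (hp : p ∈ Set.Icc (0 : ℝ) 1) : homExp B₁ B₂ lam (j + 1) p (rootInd Δ)
      = treeMap B₁ B₂ lam Δ ((treeMap B₁ B₂ lam (Δ - 1))^[j] p) := by
  rw [add_comm, homExp_add hB₁ hB₂ hlam hp one_ne_zero j (isLocal_rootInd 1),
    homExp_rootInd hB₁ hB₂ hlam (iterate_treeMap_mem_Icc hB₁ hB₂ hlam _ j hp)]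

end Tree

/-! ### Arbitrary boundary conditions between the two constant ones. -/

section Bounds

variable {B₁ B₂ lam : ℝ} {Δ : ℕ}

/-- The message `c` gives the spin `-1` a probability between `lo` and `hi`. -/
def MsgBounded (lam lo hi : ℝ) (c : Spin → ℝ) : Prop :=
  (∀ t, 0 ≤ c t) ∧ lam * c true * (1 - hi) ≤ c false * hi ∧ c false * lo ≤ lam * c true * (1 - lo)

lemma prod_cross_le {ι : Type*} [Fintype ι] {f g : ι → ℝ} {x y : ℝ} (hf : ∀ i, 0 ≤ f i)
    (hx : 0 ≤ x) (h : ∀ i, f i * x ≤ g i * y) :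
    (∏ i, f i) * x ^ Fintype.card ι ≤ (∏ i, g i) * y ^ Fintype.card ι := by
  rw [← Finset.card_univ, ← Finset.prod_const, ← Finset.prod_const, ← Finset.prod_mul_distrib,
    ← Finset.prod_mul_distrib]
  exact Finset.prod_le_prod (fun i _ => mul_nonneg (hf i) hx) fun i _ => h i

/-- Each cross difference is 1 - B₁B₂ times an assumed one. The multiplied form needs no
normalisation and tolerates messages that vanish. -/
lemma MsgBounded.transfer_cross (hB : B₁ * B₂ ≤ 1) {lo hi : ℝ} {c : Spin → ℝ}
    (hc : MsgBounded lam lo hi c) :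
    transfer B₁ B₂ lam c true * plusFactor B₂ lo ≤ transfer B₁ B₂ lam c false * minusFactor B₁ lo ∧
    transfer B₁ B₂ lam c false * minusFactor B₁ hi ≤ transfer B₁ B₂ lam c true * plusFactor B₂ hi := by
  obtain ⟨-, h1, h2⟩ := hc
  obtain ⟨e1, e2⟩ := transfer_eq (B₁ := B₁) (B₂ := B₂) (lam := lam) c
  rw [e1, e2]
  unfold minusFactor plusFactor
  have hB' : 0 ≤ 1 - B₁ * B₂ := by linarith
  have k1 := mul_nonneg hB' (sub_nonneg.2 h1)
  have k2 := mul_nonneg hB' (sub_nonneg.2 h2)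
  constructor <;> nlinarith

lemma transfer_nonneg (hB₁ : 0 ≤ B₁) (hB₂ : 0 ≤ B₂) (hlam : 0 < lam) {c : Spin → ℝ}
    (hc : ∀ t, 0 ≤ c t) (s : Spin) : 0 ≤ transfer B₁ B₂ lam c s := by
  obtain ⟨e1, e2⟩ := transfer_eq (B₁ := B₁) (B₂ := B₂) (lam := lam) c
  have h1 := hc true
  have h2 := hc false
  cases s
  · rw [e2]; positivity
  · rw [e1]; positivity

/-- The recursion is antitone, so an upper bound on the children is a lower bound on the parent, and
conversely. -/
lemma msgBounded_pushMsg (hB₁ : 0 ≤ B₁) (hB₂ : 0 ≤ B₂) (hlam : 0 < lam) (hB : B₁ * B₂ ≤ 1)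
    {lo hi : ℝ} (hlo : lo ∈ Set.Icc (0 : ℝ) 1) (hhi : hi ∈ Set.Icc (0 : ℝ) 1)
    {m : TreeVertex Δ → Spin → ℝ} {w : TreeVertex Δ} {k : ℕ} (hk : Fintype.card (Child w) = k)
    (hm : ∀ i : Child w, MsgBounded lam lo hi (m (childVertex i))) :
    MsgBounded lam (treeMap B₁ B₂ lam k hi) (treeMap B₁ B₂ lam k lo) (pushMsg B₁ B₂ lam m w) := by
  have hnn : ∀ (i : Child w) (s : Spin), 0 ≤ transfer B₁ B₂ lam (m (childVertex i)) s :=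
    fun i s => transfer_nonneg hB₁ hB₂ hlam (hm i).1 s
  have c1 := prod_cross_le (fun i => hnn i true) (plusFactor_nonneg hB₂ hlo)
    fun i => ((hm i).transfer_cross hB).1
  have c2 := prod_cross_le (fun i => hnn i false) (minusFactor_nonneg hB₁ hhi)
    fun i => ((hm i).transfer_cross hB).2
  rw [hk] at c1 c2
  have t1 := treeTotal_pos hB₁ hB₂ hlam k hlo
  have t2 := treeTotal_pos hB₁ hB₂ hlam k hhi
  refine ⟨fun s => Finset.prod_nonneg fun i _ => hnn i s, ?_, ?_⟩
  · rw [one_sub_treeMap hB₁ hB₂ hlam k hlo, treeMap, mul_div_assoc', mul_div_assoc']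
    refine div_le_div_of_nonneg_right ?_ t1.le
    have := mul_le_mul_of_nonneg_left c1 hlam.le
    unfold pushMsg
    linarith
  · rw [one_sub_treeMap hB₁ hB₂ hlam k hhi, treeMap, mul_div_assoc', mul_div_assoc']
    refine div_le_div_of_nonneg_right ?_ t2.le
    have := mul_le_mul_of_nonneg_left c2 hlam.le
    unfold pushMsg
    linarith

lemma iterate_min_max (hB₁ : 0 ≤ B₁) (hB₂ : 0 ≤ B₂) (hlam : 0 < lam) (hB : B₁ * B₂ ≤ 1)
    {x y : ℝ} (hx : x ∈ Set.Icc (0 : ℝ) 1) (hy : y ∈ Set.Icc (0 : ℝ) 1) (k : ℕ) :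
    treeMap B₁ B₂ lam k (max x y) = min (treeMap B₁ B₂ lam k x) (treeMap B₁ B₂ lam k y) ∧
    treeMap B₁ B₂ lam k (min x y) = max (treeMap B₁ B₂ lam k x) (treeMap B₁ B₂ lam k y) := by
  have hanti := antitoneOn_treeMap hB₁ hB₂ hlam k hB
  rcases le_total x y with h | h
  · have := hanti hx hy h
    simp [h, this]
  · have := hanti hy hx h
    simp [h, this]

/-- The probability of the spin `-1` at the root lies between those for constant boundary
conditions. -/
lemma rootProb_mem_Icc (hB₁ : 0 ≤ B₁) (hB₂ : 0 ≤ B₂) (hlam : 0 < lam) (hB : B₁ * B₂ ≤ 1)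
    (j : ℕ) (τ : Config Δ) (hτ : 0 < ballZ B₁ B₂ lam (boundary Δ (j + 1) τ)) :
    rootProb Δ B₁ B₂ lam (j + 1) τ ∈ Set.uIcc
      (treeMap B₁ B₂ lam Δ ((treeMap B₁ B₂ lam (Δ - 1))^[j] 0))
      (treeMap B₁ B₂ lam Δ ((treeMap B₁ B₂ lam (Δ - 1))^[j] 1)) := by
  set T := treeMap B₁ B₂ lam (Δ - 1) with hT
  have h0 : (0 : ℝ) ∈ Set.Icc (0 : ℝ) 1 := by simp
  have h1 : (1 : ℝ) ∈ Set.Icc (0 : ℝ) 1 := by simp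
  have hI0 : ∀ j, T^[j] 0 ∈ Set.Icc (0 : ℝ) 1 := fun j =>
    iterate_treeMap_mem_Icc hB₁ hB₂ hlam _ j h0
  have hI1 : ∀ j, T^[j] 1 ∈ Set.Icc (0 : ℝ) 1 := fun j =>
    iterate_treeMap_mem_Icc hB₁ hB₂ hlam _ j h1
  have hmin : ∀ j, min (T^[j] 0) (T^[j] 1) ∈ Set.Icc (0 : ℝ) 1 := fun j => by
    rcases min_choice (T^[j] 0) (T^[j] 1) with h | h <;> rw [h]
    exacts [hI0 j, hI1 j]
  have hmax : ∀ j, max (T^[j] 0) (T^[j] 1) ∈ Set.Icc (0 : ℝ) 1 := fun j => by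
    rcases max_choice (T^[j] 0) (T^[j] 1) with h | h <;> rw [h]
    exacts [hI0 j, hI1 j]
  -- Peel off i levels. The min and max absorb the reversal of the two iterates' order at each step.
  have key : ∀ (i k : ℕ), k ≠ 0 → ∀ (m : TreeVertex Δ → Spin → ℝ) (l : ℕ),
      (∀ w : TreeVertex Δ, w.1.length = k + i →
        MsgBounded lam (min (T^[l] 0) (T^[l] 1)) (max (T^[l] 0) (T^[l] 1)) (m w)) →
      ∃ m' : TreeVertex Δ → Spin → ℝ, (∀ w : TreeVertex Δ, w.1.length = k →
        MsgBounded lam (min (T^[l + i] 0) (T^[l + i] 1)) (max (T^[l + i] 0) (T^[l + i] 1))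
          (m' w)) ∧
        ∀ g : Config Δ → ℝ, IsLocal k g →
          msgZ B₁ B₂ lam (k + i) m g = msgZ B₁ B₂ lam k m' g := by
    intro i k hk
    induction i with
    | zero => exact fun m l hm => ⟨m, hm, fun g _ => rfl⟩
    | succ i ih =>
      intro m l hm
      obtain ⟨m', hm', hg'⟩ := ih (pushMsg B₁ B₂ lam m) (l + 1) (by
        intro w hw
        have := msgBounded_pushMsg hB₁ hB₂ hlam hB (hmin l) (hmax l) (m := m)
          (card_child (w := w) (by omega)) fun i => hm _ (by simp [childVertex, hw]; omega)
        rw [(iterate_min_max hB₁ hB₂ hlam hB (hI0 l) (hI1 l) _).1,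
          (iterate_min_max hB₁ hB₂ hlam hB (hI0 l) (hI1 l) _).2, ← hT,
          ← Function.iterate_succ_apply' T l, ← Function.iterate_succ_apply' T l] at this
        exact this)
      refine ⟨m', fun w hw => ?_, fun g hg => ?_⟩
      · have := hm' w hw
        rwa [show l + 1 + i = l + (i + 1) by omega] at this
      · rw [← hg' g hg, ← add_assoc, msgZ_succ m (hg.mono (Nat.le_add_right k i))]
  -- A fixed boundary spin satisfies the trivial bounds 0 and 1, the iterates for l = 0. The peeling
  -- stops at level 1 because the root has Δ children.
  obtain ⟨m', hm', hg'⟩ := key j 1 one_ne_zero (fun u t => if t = τ u then 1 else 0) 0 (by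
    intro w _
    refine ⟨fun t => by dsimp only; split_ifs <;> simp, ?_, ?_⟩
    · simp
      split_ifs <;> simp
    · simp
      split_ifs <;> simp [hlam.le])
  rw [zero_add] at hm'
  have hroot := msgBounded_pushMsg hB₁ hB₂ hlam hB (hmin j) (hmax j) (m := m')
    card_child_root fun i => hm' _ (by simp [childVertex, root])
  rw [(iterate_min_max hB₁ hB₂ hlam hB (hI0 j) (hI1 j) _).1,
    (iterate_min_max hB₁ hB₂ hlam hB (hI0 j) (hI1 j) _).2] at hroot
  set c := pushMsg B₁ B₂ lam m' (root Δ) with hc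
  rw [rootProb_eq, ballExp_boundary]
  rw [ballZ_boundary] at hτ
  rw [add_comm j 1] at hτ ⊢
  rw [hg' _ (isLocal_const 1 1), msgZ_succ _ (isLocal_const 0 1),
    msgZ_zero _ _ (fun _ => 1) fun _ => rfl, ← hc] at hτ ⊢
  have hnum := msgZ_zero (B₁ := B₁) (B₂ := B₂) (lam := lam) (pushMsg B₁ B₂ lam m') (rootInd Δ)
    (fun t => if t = true then 1 else 0) fun _ => rfl
  rw [hg' _ (isLocal_rootInd 1), msgZ_succ _ (isLocal_rootInd 0), hnum, ← hc]
  simp only [mul_one, if_true, Bool.false_eq_true, if_false, mul_zero, add_zero] at hτ ⊢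
  obtain ⟨-, u1, u2⟩ := hroot
  rw [Set.uIcc, Set.mem_Icc, le_div_iff₀ hτ, div_le_iff₀ hτ]
  constructor
  · linarith
  · linarith

end Bounds

/-! ### Weak limits from convergence of messages. -/

section WeakLimit

variable {B₁ B₂ lam : ℝ} {Δ : ℕ}

open CompactlySupported in
/-- A pointwise limit of normalised positive functionals on a compact space is integration against
a probability measure. -/
lemma exists_probabilityMeasure_of_tendsto {E : Type*} [TopologicalSpace E] [T2Space E]
    [CompactSpace E] [MeasurableSpace E] [BorelSpace E] (Φ : ℕ → (E → ℝ) → ℝ)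
    (hadd : ∀ n f g, Φ n (fun x => f x + g x) = Φ n f + Φ n g)
    (hsmul : ∀ n (c : ℝ) f, Φ n (fun x => c * f x) = c * Φ n f)
    (hpos : ∀ n f, (∀ x, 0 ≤ f x) → 0 ≤ Φ n f) (hone : ∀ n, Φ n (fun _ => 1) = 1)
    (hlim : ∀ f : C(E, ℝ), ∃ L, Tendsto (fun n => Φ n f) atTop (𝓝 L)) :
    ∃ μ : ProbabilityMeasure E, ∀ f : C(E, ℝ),
      Tendsto (fun n => Φ n f) atTop (𝓝 (∫ x, f x ∂(μ : Measure E))) := by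
  choose Λ hΛ using hlim
  let Λl : C_c(E, ℝ) →ₗ[ℝ] ℝ :=
    { toFun := fun f => Λ f.toContinuousMap
      map_add' := fun f g => by
        refine tendsto_nhds_unique (hΛ _) ?_
        refine ((hΛ f.toContinuousMap).add (hΛ g.toContinuousMap)).congr fun n => ?_
        exact (hadd n f g).symm
      map_smul' := fun c f => by
        refine tendsto_nhds_unique (hΛ _) ?_
        refine ((hΛ f.toContinuousMap).const_mul c).congr fun n => ?_
        exact (hsmul n c f).symm }
  -- The limit functional is linear and positive, so the Riesz-Markov-Kakutani theorem represents it
  -- by a measure, whose mass is the value at 1.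
  let Λp : C_c(E, ℝ) →ₚ[ℝ] ℝ := PositiveLinearMap.mk₀ Λl fun f hf =>
    ge_of_tendsto' (hΛ f.toContinuousMap) fun n => hpos n f fun x => hf x
  have hint : ∀ f : C(E, ℝ), ∫ x, f x ∂(RealRMK.rieszMeasure Λp) = Λ f := fun f =>
    RealRMK.integral_rieszMeasure Λp
      (CompactlySupportedContinuousMap.continuousMapEquiv f)
  have h1 : Λ 1 = 1 := by
    refine tendsto_nhds_unique (hΛ 1) (tendsto_const_nhds.congr fun n => ?_)
    exact (hone n).symm
  have hμ : IsProbabilityMeasure (RealRMK.rieszMeasure Λp) := by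
    have h := hint 1
    rw [h1] at h
    simp only [ContinuousMap.one_apply, integral_const, smul_eq_mul, mul_one] at h
    refine ⟨?_⟩
    rw [Measure.real, ENNReal.toReal_eq_one_iff] at h
    exact h
  refine ⟨⟨RealRMK.rieszMeasure Λp, hμ⟩, fun f => ?_⟩
  have := hΛ f
  rwa [← hint f] at this

lemma localFactor_nonneg (hB₁ : 0 ≤ B₁) (hB₂ : 0 ≤ B₂) (hlam : 0 < lam) (η : Config Δ)
    (v : TreeVertex Δ) : 0 ≤ localFactor B₁ B₂ lam η v := by
  unfold localFactor vertexFactor edgeFactor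
  refine mul_nonneg ?_ ?_
  · split_ifs <;> linarith
  · split_ifs <;> linarith

lemma probMsg_nonneg (hlam : 0 < lam) {p : ℝ} (hp : p ∈ Set.Icc (0 : ℝ) 1) (t : Spin) :
    0 ≤ probMsg lam p t := by
  unfold probMsg
  split_ifs
  · exact div_nonneg hp.1 hlam.le
  · linarith [hp.2]

lemma homExp_add_fun (k : ℕ) (p : ℝ) (f g : Config Δ → ℝ) :
    homExp B₁ B₂ lam k p (fun η => f η + g η)
      = homExp B₁ B₂ lam k p f + homExp B₁ B₂ lam k p g := by
  unfold homExp homZ msgZ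
  rw [← add_div, ← Finset.sum_add_distrib]
  congr 1
  exact Finset.sum_congr rfl fun σ _ => by ring

lemma homExp_const_mul (k : ℕ) (p c : ℝ) (f : Config Δ → ℝ) :
    homExp B₁ B₂ lam k p (fun η => c * f η) = c * homExp B₁ B₂ lam k p f := by
  unfold homExp homZ msgZ
  rw [← mul_div_assoc, Finset.mul_sum]
  congr 1
  exact Finset.sum_congr rfl fun σ _ => by ring

lemma homExp_nonneg (hB₁ : 0 ≤ B₁) (hB₂ : 0 ≤ B₂) (hlam : 0 < lam) (k : ℕ) {p : ℝ}
    (hp : p ∈ Set.Icc (0 : ℝ) 1) {f : Config Δ → ℝ} (hf : ∀ η, 0 ≤ f η) :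
    0 ≤ homExp B₁ B₂ lam k p f := by
  have h : ∀ f : Config Δ → ℝ, (∀ η, 0 ≤ f η) → 0 ≤ homZ B₁ B₂ lam k p f := fun f hf =>
    Finset.sum_nonneg fun σ _ => mul_nonneg (mul_nonneg
      (Finset.prod_nonneg fun v _ => localFactor_nonneg hB₁ hB₂ hlam _ _) (hf _))
      (Finset.prod_nonneg fun u _ => probMsg_nonneg hlam hp _)
  exact div_nonneg (h f hf) (h _ fun _ => zero_le_one)

lemma homExp_one (hB₁ : 0 ≤ B₁) (hB₂ : 0 ≤ B₂) (hlam : 0 < lam) (k : ℕ) {p : ℝ}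
    (hp : p ∈ Set.Icc (0 : ℝ) 1) : homExp (Δ := Δ) B₁ B₂ lam k p (fun _ => 1) = 1 :=
  div_self (homZ_one_pos hB₁ hB₂ hlam k hp).ne'

lemma homExp_sub_le (hB₁ : 0 ≤ B₁) (hB₂ : 0 ≤ B₂) (hlam : 0 < lam) (k : ℕ) {p ε : ℝ}
    (hp : p ∈ Set.Icc (0 : ℝ) 1) {f g : Config Δ → ℝ} (h : ∀ η, f η ≤ g η + ε) :
    homExp B₁ B₂ lam k p f ≤ homExp B₁ B₂ lam k p g + ε := by
  have h0 := homExp_nonneg hB₁ hB₂ hlam k hp (f := fun η => (g η + ε * 1) + (-1) * f η)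
    fun η => by linarith [h η]
  rw [homExp_add_fun, homExp_add_fun, homExp_const_mul, homExp_const_mul,
    homExp_one hB₁ hB₂ hlam k hp] at h0
  linarith

lemma abs_homExp_sub_le (hB₁ : 0 ≤ B₁) (hB₂ : 0 ≤ B₂) (hlam : 0 < lam) (k : ℕ) {p ε : ℝ}
    (hp : p ∈ Set.Icc (0 : ℝ) 1) {f g : Config Δ → ℝ} (h : ∀ η, |f η - g η| ≤ ε) :
    |homExp B₁ B₂ lam k p f - homExp B₁ B₂ lam k p g| ≤ ε := by
  have h1 := homExp_sub_le hB₁ hB₂ hlam k hp (f := f) (g := g) (ε := ε)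
    fun η => by linarith [(abs_le.1 (h η)).2]
  have h2 := homExp_sub_le hB₁ hB₂ hlam k hp (f := g) (g := f) (ε := ε)
    fun η => by linarith [(abs_le.1 (h η)).1]
  exact abs_le.2 ⟨by linarith, by linarith⟩

/-- The configuration that is changed to `+1` outside the ball of radius `k`. -/
def truncate (k : ℕ) (η : Config Δ) : Config Δ := fun v => if v.1.length ≤ k then η v else false

lemma isLocal_comp_truncate (k : ℕ) (f : Config Δ → ℝ) : IsLocal k fun η => f (truncate k η) := by
  intro η η' h
  have : truncate k η = truncate k η' := by
    funext v
    unfold truncate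
    split_ifs with hv
    · exact h v hv
    · rfl
  simp only [this]

/-- Truncation tends to the identity uniformly, because the uniformity of a product is controlled
coordinate by coordinate, and f is uniformly continuous by compactness. Thus f is uniformly close to
a local function. -/
lemma exists_truncate_close (f : C(Config Δ, ℝ)) {ε : ℝ} (hε : 0 < ε) :
    ∃ k : ℕ, k ≠ 0 ∧ ∀ η : Config Δ, |f η - f (truncate k η)| ≤ ε := by
  have hunif : TendstoUniformly (fun k (η : Config Δ) => truncate k η) id atTop := by
    rw [tendstoUniformly_iff_tendsto, Pi.uniformity, tendsto_iInf]
    intro v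
    rw [tendsto_comap_iff]
    refine Tendsto.mono_right (y := 𝓟 SetRel.id) ?_ refl_le_uniformity
    rw [tendsto_principal, eventually_prod_iff]
    refine ⟨fun k => v.1.length ≤ k, eventually_ge_atTop _, fun _ => True,
      Eventually.of_forall fun _ => trivial, fun {k} hk η _ => ?_⟩
    simp [truncate, hk]
  have hf := (CompactSpace.uniformContinuous_of_continuous f.continuous).comp_tendstoUniformly hunif
  obtain ⟨k, hk, hk0⟩ := ((Metric.tendstoUniformly_iff.1 hf ε hε).and
    (eventually_ne_atTop 0)).exists
  exact ⟨k, hk0, fun η => by simpa [Real.dist_eq] using (hk η).le⟩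

lemma continuous_rootInd : Continuous (rootInd Δ) :=
  (continuous_of_discreteTopology (f := fun t : Spin => if t = true then (1 : ℝ) else 0)).comp
    (continuous_apply (root Δ))

lemma integral_rootInd (μ : ProbabilityMeasure (Config Δ)) :
    ∫ σ, rootInd Δ σ ∂(μ : Measure (Config Δ)) = rootMarginal μ := by
  have hm : MeasurableSet {σ : Config Δ | σ (root Δ) = true} :=
    measurableSet_eq_fun (measurable_pi_apply _) measurable_const
  have : rootInd Δ = {σ : Config Δ | σ (root Δ) = true}.indicator 1 := by
    funext σ
    simp [rootInd, Set.indicator_apply]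
  rw [this, integral_indicator_one hm, rootMarginal]

/-- Convergence of the messages implies weak convergence of the Gibbs distributions. -/
theorem exists_weakLimit (hB₁ : 0 ≤ B₁) (hB₂ : 0 ≤ B₂) (hlam : 0 < lam) {p : ℝ}
    (hp : p ∈ Set.Icc (0 : ℝ) 1) {r : ℕ → ℕ} (hr : Tendsto r atTop atTop)
    (hq : ∀ k, ∃ q, Tendsto (fun n => (treeMap B₁ B₂ lam (Δ - 1))^[r n - k] p) atTop (𝓝 q)) :
    ∃ μ : ProbabilityMeasure (Config Δ),
      (∀ f : C(Config Δ, ℝ), Tendsto (fun n => homExp B₁ B₂ lam (r n) p f) atTop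
        (𝓝 (∫ σ, f σ ∂(μ : Measure (Config Δ))))) ∧
      ∀ q, Tendsto (fun n => (treeMap B₁ B₂ lam (Δ - 1))^[r n - 1] p) atTop (𝓝 q) →
        rootMarginal μ = treeMap B₁ B₂ lam Δ q := by
  -- The expectation of a local function depends on the boundary only through the message that
  -- reaches level k, and continuously so.
  have hlocal : ∀ (k : ℕ), k ≠ 0 → ∀ g : Config Δ → ℝ, IsLocal k g → ∀ q,
      Tendsto (fun n => (treeMap B₁ B₂ lam (Δ - 1))^[r n - k] p) atTop (𝓝 q) →
      Tendsto (fun n => homExp B₁ B₂ lam (r n) p g) atTop (𝓝 (homExp B₁ B₂ lam k q g)) := by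
    intro k hk g hg q hq
    have hmem : ∀ n, (treeMap B₁ B₂ lam (Δ - 1))^[r n - k] p ∈ Set.Icc (0 : ℝ) 1 := fun n =>
      iterate_treeMap_mem_Icc hB₁ hB₂ hlam _ _ hp
    have hqI : q ∈ Set.Icc (0 : ℝ) 1 :=
      isClosed_Icc.mem_of_tendsto hq (Eventually.of_forall hmem)
    have h := ((continuousOn_homExp hB₁ hB₂ hlam k g q hqI).tendsto.comp
      (tendsto_nhdsWithin_iff.2 ⟨hq, Eventually.of_forall hmem⟩))
    refine h.congr' ?_
    filter_upwards [hr.eventually_ge_atTop k] with n hn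
    simp only [Function.comp]
    rw [← homExp_add hB₁ hB₂ hlam hp hk _ hg, Nat.add_sub_cancel' hn]
  obtain ⟨μ, hμ⟩ := exists_probabilityMeasure_of_tendsto (E := Config Δ)
    (fun n f => homExp B₁ B₂ lam (r n) p f)
    (fun n f g => homExp_add_fun _ _ f g) (fun n c f => homExp_const_mul _ _ c f)
    (fun n f hf => homExp_nonneg hB₁ hB₂ hlam _ hp hf)
    (fun n => homExp_one hB₁ hB₂ hlam _ hp) (by
      intro f
      -- Three errors of ε/4: two truncations, and the convergence already known for the truncated
      -- function.
      refine cauchySeq_tendsto_of_complete (Metric.cauchySeq_iff'.2 fun ε hε => ?_)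
      obtain ⟨k, hk, hclose⟩ := exists_truncate_close f (show 0 < ε / 4 by linarith)
      obtain ⟨q, hq⟩ := hq k
      obtain ⟨n₀, hn₀⟩ := Metric.cauchySeq_iff'.1
        (hlocal k hk _ (isLocal_comp_truncate k f) q hq).cauchySeq (ε / 4) (by linarith)
      refine ⟨n₀, fun n hn => ?_⟩
      have h1 := abs_homExp_sub_le hB₁ hB₂ hlam (r n) hp hclose
      have h2 := abs_homExp_sub_le hB₁ hB₂ hlam (r n₀) hp hclose
      have h3 := hn₀ n hn
      rw [Real.dist_eq] at h3 ⊢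
      rw [abs_le] at h1 h2
      rw [abs_lt] at h3 ⊢
      constructor <;> linarith)
  refine ⟨μ, hμ, fun q hq => ?_⟩
  have hqI : q ∈ Set.Icc (0 : ℝ) 1 := isClosed_Icc.mem_of_tendsto hq
    (Eventually.of_forall fun n => iterate_treeMap_mem_Icc hB₁ hB₂ hlam _ _ hp)
  rw [← integral_rootInd, ← homExp_rootInd hB₁ hB₂ hlam hqI]
  exact tendsto_nhds_unique (hμ ⟨rootInd Δ, continuous_rootInd⟩)
    (hlocal 1 one_ne_zero _ (isLocal_rootInd 1) q hq)

end WeakLimit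

/-! ### Uniqueness, non-uniqueness and the limits of the recursion. -/

section Dichotomy

variable {B₁ B₂ lam : ℝ} {Δ : ℕ}

lemma zero_mem_unit : (0 : ℝ) ∈ Set.Icc (0 : ℝ) 1 := by simp

lemma one_mem_unit : (1 : ℝ) ∈ Set.Icc (0 : ℝ) 1 := by simp

lemma tendsto_sub_of_continuousOn {f : ℝ → ℝ} (hf : ContinuousOn f (Set.Icc 0 1)) {x y : ℕ → ℝ}
    (hx : ∀ n, x n ∈ Set.Icc (0 : ℝ) 1) (hy : ∀ n, y n ∈ Set.Icc (0 : ℝ) 1)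
    (h : Tendsto (fun n => dist (x n) (y n)) atTop (𝓝 0)) :
    Tendsto (fun n => dist (f (x n)) (f (y n))) atTop (𝓝 0) := by
  rw [Metric.tendsto_atTop] at h ⊢
  intro ε hε
  obtain ⟨δ, hδ, hfδ⟩ := Metric.uniformContinuousOn_iff.1
    (isCompact_Icc.uniformContinuousOn_of_continuous hf) ε hε
  obtain ⟨n₀, hn₀⟩ := h δ hδ
  refine ⟨n₀, fun n hn => ?_⟩
  have := hn₀ n hn
  rw [Real.dist_0_eq_abs, abs_of_nonneg dist_nonneg] at this ⊢
  exact hfδ _ (hx n) _ (hy n) this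

/-- The recursion is monotone or antitone, so images of the endpoints enclose all images; the
unordered interval treats both cases alike. -/
lemma iterate_mem_uIcc (hB₁ : 0 ≤ B₁) (hB₂ : 0 ≤ B₂) (hlam : 0 < lam) (k j : ℕ) {p : ℝ}
    (hp : p ∈ Set.Icc (0 : ℝ) 1) : (treeMap B₁ B₂ lam k)^[j] p ∈
      Set.uIcc ((treeMap B₁ B₂ lam k)^[j] 0) ((treeMap B₁ B₂ lam k)^[j] 1) := by
  induction j with
  | zero => simpa using hp
  | succ j ih =>
    simp only [Function.iterate_succ_apply']
    have hsub : Set.uIcc ((treeMap B₁ B₂ lam k)^[j] 0) ((treeMap B₁ B₂ lam k)^[j] 1)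
        ⊆ Set.Icc 0 1 := Set.ordConnected_Icc.uIcc_subset
      (iterate_treeMap_mem_Icc hB₁ hB₂ hlam k j zero_mem_unit)
      (iterate_treeMap_mem_Icc hB₁ hB₂ hlam k j one_mem_unit)
    rcases le_total (B₁ * B₂) 1 with hB | hB
    · exact ((antitoneOn_treeMap hB₁ hB₂ hlam k hB).mono hsub).mapsTo_uIcc ih
    · exact ((monotoneOn_treeMap hB₁ hB₂ hlam k hB).mono hsub).mapsTo_uIcc ih

/-- Uniqueness on the tree means that the tree recursion forgets its initial value. -/
lemma Uniqueness.tendsto_dist (hΔ : 3 ≤ Δ) (hB₁ : 0 ≤ B₁) (hB₂ : 0 ≤ B₂) (hlam : 0 < lam)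
    (hU : Uniqueness Δ B₁ B₂ lam) :
    Tendsto (fun j => dist ((treeMap B₁ B₂ lam (Δ - 1))^[j] 0)
      ((treeMap B₁ B₂ lam (Δ - 1))^[j] 1)) atTop (𝓝 0) := by
  have hmem0 : ∀ j, (treeMap B₁ B₂ lam (Δ - 1))^[j] 0 ∈ Set.Icc (0 : ℝ) 1 := fun j =>
    iterate_treeMap_mem_Icc hB₁ hB₂ hlam _ j zero_mem_unit
  have hmem1 : ∀ j, (treeMap B₁ B₂ lam (Δ - 1))^[j] 1 ∈ Set.Icc (0 : ℝ) 1 := fun j =>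
    iterate_treeMap_mem_Icc hB₁ hB₂ hlam _ j one_mem_unit
  have hR : Tendsto (fun j => dist (treeMap B₁ B₂ lam Δ ((treeMap B₁ B₂ lam (Δ - 1))^[j] 0))
      (treeMap B₁ B₂ lam Δ ((treeMap B₁ B₂ lam (Δ - 1))^[j] 1))) atTop (𝓝 0) := by
    rw [Metric.tendsto_atTop]
    intro ε hε
    obtain ⟨H, hH⟩ := hU ε hε
    refine ⟨H, fun j hj => ?_⟩
    have h := hH (j + 1) (by omega) (fun _ => false) (fun _ => true)
      (ballZ_boundary_false_pos hB₁ hB₂ hlam _) (ballZ_boundary_true_pos hB₁ hB₂ hlam _)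
    rw [rootProb_eq, rootProb_eq, ballExp_boundary_false, ballExp_boundary_true hlam,
      homExp_rootInd_succ hB₁ hB₂ hlam j zero_mem_unit,
      homExp_rootInd_succ hB₁ hB₂ hlam j one_mem_unit] at h
    rw [Real.dist_0_eq_abs, abs_of_nonneg dist_nonneg]
    exact h
  -- `message` turns the root marginal of T^j p into T^(j+1) p, so its uniform continuity transfers
  -- closeness from root marginals to iterates.
  rw [← tendsto_add_atTop_iff_nat 1]
  refine (tendsto_sub_of_continuousOn (continuousOn_message hΔ hlam)
    (fun j => treeMap_mem_Icc hB₁ hB₂ hlam Δ (hmem0 j))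
    (fun j => treeMap_mem_Icc hB₁ hB₂ hlam Δ (hmem1 j)) hR).congr fun j => ?_
  rw [message_treeMap hΔ hB₁ hB₂ hlam (hmem0 j), message_treeMap hΔ hB₁ hB₂ hlam (hmem1 j),
    Function.iterate_succ_apply', Function.iterate_succ_apply']

/-- In the antiferromagnetic case, conversely, uniqueness holds if the tree recursion forgets its
initial value. -/
lemma uniqueness_of_tendsto_dist (hB₁ : 0 ≤ B₁) (hB₂ : 0 ≤ B₂) (hlam : 0 < lam)
    (hB : B₁ * B₂ ≤ 1)
    (h : Tendsto (fun j => dist ((treeMap B₁ B₂ lam (Δ - 1))^[j] 0)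
      ((treeMap B₁ B₂ lam (Δ - 1))^[j] 1)) atTop (𝓝 0)) : Uniqueness Δ B₁ B₂ lam := by
  intro ε hε
  have hR := tendsto_sub_of_continuousOn (continuousOn_treeMap hB₁ hB₂ hlam Δ)
    (fun j => iterate_treeMap_mem_Icc hB₁ hB₂ hlam _ j zero_mem_unit)
    (fun j => iterate_treeMap_mem_Icc hB₁ hB₂ hlam _ j one_mem_unit) h
  obtain ⟨H, hH⟩ := Metric.tendsto_atTop.1 hR ε hε
  refine ⟨H + 1, fun h hh τ τ' hτ hτ' => ?_⟩
  obtain ⟨j, rfl⟩ : ∃ j, h = j + 1 := ⟨h - 1, by omega⟩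
  have h1 := hH j (by omega)
  rw [Real.dist_0_eq_abs, abs_of_nonneg dist_nonneg] at h1
  rw [← Real.dist_eq]
  exact (Real.dist_le_of_mem_uIcc (rootProb_mem_Icc hB₁ hB₂ hlam hB j τ hτ)
    (rootProb_mem_Icc hB₁ hB₂ hlam hB j τ' hτ')).trans_lt h1

lemma tendsto_iterate_of_tendsto_dist (hB₁ : 0 ≤ B₁) (hB₂ : 0 ≤ B₂) (hlam : 0 < lam) {k : ℕ}
    (h : Tendsto (fun j => dist ((treeMap B₁ B₂ lam k)^[j] 0)
      ((treeMap B₁ B₂ lam k)^[j] 1)) atTop (𝓝 0)) {s p : ℝ} (hs : s ∈ Set.Icc (0 : ℝ) 1)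
    (hTs : treeMap B₁ B₂ lam k s = s) (hp : p ∈ Set.Icc (0 : ℝ) 1) :
    Tendsto (fun j => (treeMap B₁ B₂ lam k)^[j] p) atTop (𝓝 s) := by
  rw [tendsto_iff_dist_tendsto_zero]
  refine squeeze_zero (fun _ => dist_nonneg) (fun j => ?_) h
  have h1 := iterate_mem_uIcc hB₁ hB₂ hlam k j hs
  rw [Function.iterate_fixed hTs] at h1
  exact Real.dist_le_of_mem_uIcc (iterate_mem_uIcc hB₁ hB₂ hlam k j hp) h1

/-- The measures and maximizers in the uniqueness region. -/
theorem exists_freeMeasure (hΔ : 3 ≤ Δ) (hB₁ : 0 ≤ B₁) (hB₂ : 0 ≤ B₂) (hlam : 0 < lam)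
    (hU : Uniqueness Δ B₁ B₂ lam) :
    ∃ μ : ProbabilityMeasure (Config Δ), IsFreeMeasure Δ B₁ B₂ lam μ ∧
      maximizers (firstMomentRate Δ B₁ B₂ lam) = {(rootMarginal μ, rootMarginal μ)} := by
  obtain ⟨s, hs, hTs⟩ := exists_treeMap_eq_self hB₁ hB₂ hlam (Δ - 1)
  have hlim : ∀ p ∈ Set.Icc (0 : ℝ) 1, _ := fun p hp =>
    tendsto_iterate_of_tendsto_dist hB₁ hB₂ hlam (hU.tendsto_dist hΔ hB₁ hB₂ hlam) hs hTs hp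
  have hp : lam / (1 + lam) ∈ Set.Icc (0 : ℝ) 1 :=
    ⟨by positivity, by rw [div_le_one (by positivity)]; linarith⟩
  have hsub : ∀ k, Tendsto (fun n => (treeMap B₁ B₂ lam (Δ - 1))^[n - k] (lam / (1 + lam))) atTop
      (𝓝 s) := fun k => (hlim _ hp).comp (tendsto_sub_atTop_nat k)
  obtain ⟨μ, hμ, hroot⟩ := exists_weakLimit (Δ := Δ) hB₁ hB₂ hlam hp tendsto_id
    fun k => ⟨s, hsub k⟩
  refine ⟨μ, fun f => (hμ f).congr fun n => (ballExp_univ_eq hlam f).symm, ?_⟩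
  rw [hroot s (hsub 1)]
  refine maximizers_of_unique hΔ hB₁ hB₂ hlam hTs fun p hp hTp => ?_
  -- The even iterates of a two-step fixed point are constant, yet its orbit converges to s.
  have h2 : (treeMap B₁ B₂ lam (Δ - 1))^[2] p = p := hTp
  refine tendsto_nhds_unique (tendsto_const_nhds.congr fun j => ?_)
    ((hlim p hp).comp (tendsto_id.const_mul_atTop' (by norm_num : 0 < 2)))
  simp only [Function.comp, id]
  rw [Function.iterate_mul, Function.iterate_fixed h2]

/-- The limits of the two-step recursion. -/
lemma exists_two_step_limits (hB₁ : 0 ≤ B₁) (hB₂ : 0 ≤ B₂) (hlam : 0 < lam) (hB : B₁ * B₂ ≤ 1)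
    (k : ℕ) : ∃ a ∈ Set.Icc (0 : ℝ) 1, ∃ b ∈ Set.Icc (0 : ℝ) 1,
      Tendsto (fun j => (treeMap B₁ B₂ lam k)^[2 * j] 0) atTop (𝓝 a) ∧
      Tendsto (fun j => (treeMap B₁ B₂ lam k)^[2 * j] 1) atTop (𝓝 b) ∧
      treeMap B₁ B₂ lam k a = b ∧ treeMap B₁ B₂ lam k b = a := by
  set T := treeMap B₁ B₂ lam k with hT
  have hI : ∀ j, ∀ p ∈ Set.Icc (0 : ℝ) 1, T^[j] p ∈ Set.Icc (0 : ℝ) 1 := fun j p hp =>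
    iterate_treeMap_mem_Icc hB₁ hB₂ hlam k j hp
  have hTI : ∀ p ∈ Set.Icc (0 : ℝ) 1, T p ∈ Set.Icc (0 : ℝ) 1 := hI 1
  have hanti : AntitoneOn T (Set.Icc 0 1) := antitoneOn_treeMap hB₁ hB₂ hlam k hB
  have hmono : ∀ j, ∀ p ∈ Set.Icc (0 : ℝ) 1, ∀ q ∈ Set.Icc (0 : ℝ) 1, p ≤ q →
      T^[2 * j] p ≤ T^[2 * j] q := by
    intro j
    induction j with
    | zero => exact fun p _ q _ h => h
    | succ j ih =>
      intro p hp q hq h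
      rw [show 2 * (j + 1) = 2 * j + 1 + 1 by ring, Function.iterate_succ_apply,
        Function.iterate_succ_apply, Function.iterate_succ_apply, Function.iterate_succ_apply]
      exact ih _ (hTI _ (hTI p hp)) _ (hTI _ (hTI q hq))
        (hanti (hTI q hq) (hTI p hp) (hanti hp hq h))
  have hsucc : ∀ j p, T^[2 * (j + 1)] p = T^[2 * j] (T (T p)) := fun j p => by
    rw [show 2 * (j + 1) = 2 * j + 1 + 1 by ring, Function.iterate_succ_apply,
      Function.iterate_succ_apply]
  -- T ∘ T is increasing, so the even iterates of 0 increase and those of 1 decrease.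
  have hm0 : Monotone fun j => T^[2 * j] 0 := monotone_nat_of_le_succ fun j => by
    rw [hsucc]
    exact hmono j _ zero_mem_unit _ (hTI _ (hTI _ zero_mem_unit)) (hTI _ (hTI _ zero_mem_unit)).1
  have hm1 : Antitone fun j => T^[2 * j] 1 := antitone_nat_of_succ_le fun j => by
    rw [hsucc]
    exact hmono j _ (hTI _ (hTI _ one_mem_unit)) _ one_mem_unit (hTI _ (hTI _ one_mem_unit)).2
  have ha := tendsto_atTop_ciSup hm0
    ⟨1, by rintro _ ⟨j, rfl⟩; exact (hI (2 * j) 0 zero_mem_unit).2⟩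
  have hb := tendsto_atTop_ciInf hm1
    ⟨0, by rintro _ ⟨j, rfl⟩; exact (hI (2 * j) 1 one_mem_unit).1⟩
  have haI := isClosed_Icc.mem_of_tendsto ha
    (Eventually.of_forall fun j => hI (2 * j) 0 zero_mem_unit)
  have hbI := isClosed_Icc.mem_of_tendsto hb
    (Eventually.of_forall fun j => hI (2 * j) 1 one_mem_unit)
  have hcont : ContinuousOn T (Set.Icc 0 1) := continuousOn_treeMap hB₁ hB₂ hlam k
  have hTa := (hcont _ haI).tendsto.comp (tendsto_nhdsWithin_iff.2
    ⟨ha, Eventually.of_forall fun j => hI (2 * j) 0 zero_mem_unit⟩)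
  have hTb := (hcont _ hbI).tendsto.comp (tendsto_nhdsWithin_iff.2
    ⟨hb, Eventually.of_forall fun j => hI (2 * j) 1 one_mem_unit⟩)
  have hcomm : ∀ j p, T (T^[2 * j] p) = T^[2 * j] (T p) := fun j p =>
    (Function.iterate_succ_apply' T (2 * j) p).symm.trans (Function.iterate_succ_apply T (2 * j) p)
  refine ⟨_, haI, _, hbI, ha, hb, tendsto_nhds_unique hTa ?_, tendsto_nhds_unique hTb ?_⟩
  -- T 0 lies between T (T 1) and 1, so its even iterates are squeezed between shifted and unshifted
  -- even iterates of 1; likewise T 1 lies between 0 and T (T 0).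
  · refine tendsto_of_tendsto_of_tendsto_of_le_of_le ((tendsto_add_atTop_iff_nat 1).2 hb) hb
      (fun j => ?_) fun j => ?_
    · simp only [Function.comp, hcomm, hsucc]
      exact hmono j _ (hTI _ (hTI _ one_mem_unit)) _ (hTI _ zero_mem_unit)
        (hanti zero_mem_unit (hTI _ one_mem_unit) (hTI _ one_mem_unit).1)
    · simp only [Function.comp, hcomm]
      exact hmono j _ (hTI _ zero_mem_unit) _ one_mem_unit (hTI _ zero_mem_unit).2
  · refine tendsto_of_tendsto_of_tendsto_of_le_of_le ha ((tendsto_add_atTop_iff_nat 1).2 ha)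
      (fun j => ?_) fun j => ?_
    · simp only [Function.comp, hcomm]
      exact hmono j _ zero_mem_unit _ (hTI _ one_mem_unit) (hTI _ one_mem_unit).1
    · simp only [Function.comp, hcomm, hsucc]
      exact hmono j _ (hTI _ one_mem_unit) _ (hTI _ (hTI _ zero_mem_unit))
        (hanti (hTI _ zero_mem_unit) one_mem_unit (hTI _ zero_mem_unit).2)

/-- T ∘ T is increasing, so the even iterates of 0 and 1 continue to enclose any point that it
fixes. -/
lemma fixed_mem_Icc (hB₁ : 0 ≤ B₁) (hB₂ : 0 ≤ B₂) (hlam : 0 < lam) (hB : B₁ * B₂ ≤ 1)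
    {k : ℕ} {a b : ℝ}
    (ha : Tendsto (fun j => (treeMap B₁ B₂ lam k)^[2 * j] 0) atTop (𝓝 a))
    (hb : Tendsto (fun j => (treeMap B₁ B₂ lam k)^[2 * j] 1) atTop (𝓝 b))
    {p : ℝ} (hp : p ∈ Set.Icc (0 : ℝ) 1)
    (hTp : treeMap B₁ B₂ lam k (treeMap B₁ B₂ lam k p) = p) : p ∈ Set.Icc a b := by
  have hfix : ∀ j, (treeMap B₁ B₂ lam k)^[2 * j] p = p := fun j => by
    rw [Function.iterate_mul]
    exact Function.iterate_fixed (f := (treeMap B₁ B₂ lam k)^[2]) hTp j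
  have hanti := antitoneOn_treeMap hB₁ hB₂ hlam k hB
  have hbd : ∀ j, (treeMap B₁ B₂ lam k)^[2 * j] 0 ≤ p ∧ p ≤ (treeMap B₁ B₂ lam k)^[2 * j] 1 := by
    intro j
    induction j with
    | zero => exact hp
    | succ j ih =>
      have h0 := iterate_treeMap_mem_Icc hB₁ hB₂ hlam k (2 * j) zero_mem_unit
      have h1 := iterate_treeMap_mem_Icc hB₁ hB₂ hlam k (2 * j) one_mem_unit
      have hI : ∀ q ∈ Set.Icc (0 : ℝ) 1, treeMap B₁ B₂ lam k q ∈ Set.Icc (0 : ℝ) 1 := fun q hq =>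
        treeMap_mem_Icc hB₁ hB₂ hlam k hq
      rw [show 2 * (j + 1) = 2 * j + 1 + 1 by ring]
      simp only [Function.iterate_succ_apply']
      constructor
      · calc _ ≤ treeMap B₁ B₂ lam k (treeMap B₁ B₂ lam k p) :=
              hanti (hI p hp) (hI _ h0) (hanti h0 hp ih.1)
          _ = p := hTp
      · calc p = treeMap B₁ B₂ lam k (treeMap B₁ B₂ lam k p) := hTp.symm
          _ ≤ _ := hanti (hI _ h1) (hI p hp) (hanti hp h1 ih.2)
  exact ⟨le_of_tendsto' ha fun j => (hbd j).1, ge_of_tendsto' hb fun j => (hbd j).2⟩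

/-- The measures and maximizers in the antiferromagnetic non-uniqueness region. -/
theorem exists_evenMeasure_oddMeasure (hΔ : 3 ≤ Δ) (hB₁ : 0 ≤ B₁) (hB₂ : 0 ≤ B₂) (hlam : 0 < lam)
    (hB : B₁ * B₂ < 1) (hU : ¬ Uniqueness Δ B₁ B₂ lam) :
    ∃ μp μm : ProbabilityMeasure (Config Δ),
      IsEvenMeasure Δ B₁ B₂ lam μp ∧ IsOddMeasure Δ B₁ B₂ lam μm ∧
      maximizers (firstMomentRate Δ B₁ B₂ lam)
        = {(rootMarginal μp, rootMarginal μm), (rootMarginal μm, rootMarginal μp)} := by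
  obtain ⟨a, haI, b, hbI, ha, hb, hTa, hTb⟩ :=
    exists_two_step_limits hB₁ hB₂ hlam hB.le (Δ - 1)
  obtain ⟨s, hs, hTs⟩ := exists_treeMap_eq_self hB₁ hB₂ hlam (Δ - 1)
  have hext : ∀ p ∈ Set.Icc (0 : ℝ) 1,
      treeMap B₁ B₂ lam (Δ - 1) (treeMap B₁ B₂ lam (Δ - 1) p) = p → p ∈ Set.Icc a b :=
    fun p hp hTp => fixed_mem_Icc hB₁ hB₂ hlam hB.le ha hb hp hTp
  obtain ⟨has, hsb⟩ := hext s hs (by rw [hTs, hTs])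
  -- If a = b, the iterates of 0 and 1 merge along even times. Their distance is nonincreasing in j,
  -- so it tends to 0, and uniqueness would follow.
  have hab : a ≠ b := by
    rintro rfl
    refine hU (uniqueness_of_tendsto_dist hB₁ hB₂ hlam hB.le ?_)
    have hanti : Antitone fun j => dist ((treeMap B₁ B₂ lam (Δ - 1))^[j] 0)
        ((treeMap B₁ B₂ lam (Δ - 1))^[j] 1) := antitone_nat_of_succ_le fun j => by
      rw [Function.iterate_succ_apply, Function.iterate_succ_apply]
      exact Real.dist_le_of_mem_uIcc
        (iterate_mem_uIcc hB₁ hB₂ hlam _ j (treeMap_mem_Icc hB₁ hB₂ hlam _ zero_mem_unit))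
        (iterate_mem_uIcc hB₁ hB₂ hlam _ j (treeMap_mem_Icc hB₁ hB₂ hlam _ one_mem_unit))
    rw [Metric.tendsto_atTop]
    intro ε hε
    have hd := ha.dist hb
    rw [dist_self] at hd
    obtain ⟨i, hi⟩ := (hd.eventually_lt_const hε).exists
    refine ⟨2 * i, fun j hj => ?_⟩
    rw [Real.dist_0_eq_abs, abs_of_nonneg dist_nonneg]
    exact (hanti hj).trans_lt hi
  have has : a < s := lt_of_le_of_ne has fun h => hab (by rw [← hTa, h, hTs])
  have hsb : s < b := lt_of_le_of_ne hsb fun h => hab (by rw [← hTb, ← h, hTs])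
  have hodd : Tendsto (fun j => (treeMap B₁ B₂ lam (Δ - 1))^[2 * j + 1] 1) atTop (𝓝 a) := by
    have h := (continuousOn_treeMap hB₁ hB₂ hlam (Δ - 1) b hbI).tendsto.comp
      (tendsto_nhdsWithin_iff.2 ⟨hb, Eventually.of_forall fun j =>
        iterate_treeMap_mem_Icc hB₁ hB₂ hlam _ (2 * j) one_mem_unit⟩)
    rw [hTb] at h
    exact h.congr fun j => (Function.iterate_succ_apply' _ _ _).symm
  -- The limiting message at level k depends on the parity of its distance to the boundary: b for
  -- even and a for odd distance.
  have heven_even : ∀ i, Tendsto (fun l => (treeMap B₁ B₂ lam (Δ - 1))^[2 * l - 2 * i] 1) atTop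
      (𝓝 b) := fun i => (hb.comp (tendsto_sub_atTop_nat i)).congr fun l => by
    simp only [Function.comp, Nat.mul_sub]
  have heven_odd : ∀ i, Tendsto (fun l => (treeMap B₁ B₂ lam (Δ - 1))^[2 * l - (2 * i + 1)] 1)
      atTop (𝓝 a) := fun i => (hodd.comp (tendsto_sub_atTop_nat (i + 1))).congr' (by
    filter_upwards [eventually_ge_atTop (i + 1)] with l hl
    simp only [Function.comp]
    congr 1
    omega)
  have hodd_even : ∀ i, Tendsto (fun l => (treeMap B₁ B₂ lam (Δ - 1))^[2 * l + 1 - 2 * i] 1)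
      atTop (𝓝 a) := fun i => (hodd.comp (tendsto_sub_atTop_nat i)).congr' (by
    filter_upwards [eventually_ge_atTop i] with l hl
    simp only [Function.comp]
    congr 1
    omega)
  have hodd_odd : ∀ i, Tendsto
      (fun l => (treeMap B₁ B₂ lam (Δ - 1))^[2 * l + 1 - (2 * i + 1)] 1) atTop (𝓝 b) :=
    fun i => (heven_even i).congr fun l => by
      rw [Nat.add_sub_add_right]
  have hr0 : Tendsto (fun l : ℕ => 2 * l) atTop atTop :=
    tendsto_id.const_mul_atTop' (by norm_num : 0 < 2)
  have hr1 : Tendsto (fun l : ℕ => 2 * l + 1) atTop atTop :=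
    (tendsto_add_atTop_nat 1).comp hr0
  obtain ⟨μp, hμp, hrp⟩ := exists_weakLimit (Δ := Δ) hB₁ hB₂ hlam one_mem_unit hr0 fun k => by
    rcases Nat.even_or_odd' k with ⟨i, rfl | rfl⟩
    exacts [⟨b, heven_even i⟩, ⟨a, heven_odd i⟩]
  obtain ⟨μm, hμm, hrm⟩ := exists_weakLimit (Δ := Δ) hB₁ hB₂ hlam one_mem_unit hr1 fun k => by
    rcases Nat.even_or_odd' k with ⟨i, rfl | rfl⟩
    exacts [⟨a, hodd_even i⟩, ⟨b, hodd_odd i⟩]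
  refine ⟨μp, μm, fun f => (hμp f).congr fun n => (ballExp_boundary_true hlam f).symm,
    fun f => (hμm f).congr fun n => (ballExp_boundary_true hlam f).symm, ?_⟩
  -- The neighbours of the root are at odd distance from an even boundary level, so the root
  -- marginal of μ⁺ comes from a, and that of μ⁻ from b.
  rw [hrp a (heven_odd 0), hrm b (hodd_odd 0)]
  exact maximizers_of_not_unique hΔ hB₁ hB₂ hlam hB haI.1 hbI.2 has hsb hTs hTa hTb hext

end Dichotomy

end TwoSpin

theorem mainTheorem7 (Δ : ℕ) (hΔ : 3 ≤ Δ) (B₁ B₂ lam : ℝ) (hB₁ : 0 ≤ B₁) (hB₂ : 0 ≤ B₂)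
    (hlam : 0 < lam) :
    ∃ φ : ℝ × ℝ → EReal,
      (∀ α ∈ Set.Icc (0 : ℝ) 1, ∀ β ∈ Set.Icc (0 : ℝ) 1,
        TwoSpin.IsFirstMomentRate Δ B₁ B₂ lam α β (φ (α, β))) ∧
      (TwoSpin.Uniqueness Δ B₁ B₂ lam →
        ∃ μ : ProbabilityMeasure (TwoSpin.Config Δ),
          TwoSpin.IsFreeMeasure Δ B₁ B₂ lam μ ∧
          TwoSpin.maximizers φ = {(TwoSpin.rootMarginal μ, TwoSpin.rootMarginal μ)}) ∧
      (B₁ * B₂ < 1 → ¬ TwoSpin.Uniqueness Δ B₁ B₂ lam →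
        ∃ μp μm : ProbabilityMeasure (TwoSpin.Config Δ),
          TwoSpin.IsEvenMeasure Δ B₁ B₂ lam μp ∧
          TwoSpin.IsOddMeasure Δ B₁ B₂ lam μm ∧
          TwoSpin.maximizers φ =
            {(TwoSpin.rootMarginal μp, TwoSpin.rootMarginal μm),
             (TwoSpin.rootMarginal μm, TwoSpin.rootMarginal μp)}) := by
  exact ⟨TwoSpin.firstMomentRate Δ B₁ B₂ lam,
    fun α _ β _ => TwoSpin.isFirstMomentRate_firstMomentRate hB₁ hB₂ hlam (by omega) α β,
    TwoSpin.exists_freeMeasure hΔ hB₁ hB₂ hlam,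
    TwoSpin.exists_evenMeasure_oddMeasure hΔ hB₁ hB₂ hlam⟩
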